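/- Let $n\ge 2$, and let $z=x+iw\in\mathbb{C}^n$ ($x,w\in\mathbb{R}^n$) be a nonzero vector. Let $a_1,\dots,a_m\in\mathbb{C}^n$ be i.i.d. standard complex Gaussian vectors (all real and imaginary parts of all entries are independent with law $\mathcal N(0,1/2)$), and put $$y_i=|a_i^*z|^2,\qquad \mathbf a_i^T=\begin{bmatrix}\Re(a_i^*) & \Im(a_i^*)\end{bmatrix}\in\mathbb{R}^{2n},\qquad Z=\begin{bmatrix}x & w\\ -w & x\end{bmatrix}\in\mathbb{R}^{2n\times 2},$$ so that $y_i=\|\mathbf a_i^TZ\|_2^2$. Algorithm (with $r=2$, step size $\gamma$, $k$ steps, data $(y_i,\mathbf a_i)_{i\le m}$). Let $\sigma_1\ge\sigma_2\ge\dots\ge\sigma_{2n}$ be the eigenvalues of $M=\frac1{2m}\sum_i y_i\mathbf a_i\mathbf a_i^T$, let $u_1,u_2$ be orthonormal eigenvectors for $\sigma_1,\sigma_2$ (any choice is allowed), and start from $U_0=[\sqrt{\sigma_1-\sigma_3}\,u_1\ \ \sqrt{\sigma_2-\sigma_3}\,u_2]$. Iterate $U_{j+1}=U_j-\gamma\nabla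 f(U_j)$ for $f(U)=\frac1{4m}\sum_i\bigl(y_i-\|\mathbf a_i^TU\|_2^2\bigr)^2$ on $\mathbb{R}^{2n\times 2}$. The output is $\hat Z_k=U_k$. There are absolute constants $c,C_0,C_1>0$ with $cC_1^2\le 1/9$ such that for every $\beta>0$ there is a constant $C>0$ depending only on $\beta$ with the following property. If $m\ge Cn(\log n)^2$ and the step size satisfies $0<\gamma<c\,n^{-4}\|z\|_2^{-2}$, then with probability at least $1-3e^{-\beta n}-7/m^2$ the following holds simultaneously for all $k\ge 0$: $$\min_{O\in\mathcal O(2)}\|ZO-\hat Z_k\|_F^2\;\le\; C_0\|z\|_2^2\left[1-\frac{\gamma\|z\|_2^2}{9}+\gamma^2C_1^2n^4\|z\|_2^4\right]^k .$$ (The condition $cC_1^2\le 1/9$ makes the bracket smaller than $1$ for every such $\gamma$. For $\|z\|_2=1$ the step size condition is $\gamma<cn^{-4}$ and the bracket is $1-\gamma/9+\gamma^2C_1^2n^4$.) -/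

import Mathlib

open MeasureTheory ProbabilityTheory

noncomputable section

namespace LowRankRecovery

/-! ### Real rank-`r` recovery: the algorithm

The data are `y : Fin m → ℝ` and measurement vectors `a : Fin m → ι → ℝ`. -/

section Algorithm

set_option linter.unusedSectionVars false

variable {ι : Type*} [Fintype ι] [DecidableEq ι] {r m : ℕ}

/-- The squared Frobenius norm of a real matrix. -/
def frobSq (A : Matrix ι (Fin r) ℝ) : ℝ := ∑ i, ∑ j, A i j ^ 2

/-- `min_{O ∈ O(r)} ‖X O - U‖_F²` (the infimum is attained, see `exists_orbitDistSq_eq`). -/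
def orbitDistSq (X U : Matrix ι (Fin r) ℝ) : ℝ :=
  ⨅ O : Matrix.orthogonalGroup (Fin r) ℝ, frobSq (X * (O : Matrix (Fin r) (Fin r) ℝ) - U)

/-- The minimum over `O(r)` is attained. -/
theorem exists_orbitDistSq_eq (X U : Matrix ι (Fin r) ℝ) :
    ∃ O : Matrix.orthogonalGroup (Fin r) ℝ,
      orbitDistSq X U = frobSq (X * (O : Matrix (Fin r) (Fin r) ℝ) - U) := by
  have hc : IsCompact ((Matrix.orthogonalGroup (Fin r) ℝ : Submonoid _) :
      Set (Matrix (Fin r) (Fin r) ℝ)) := by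
    refine IsCompact.of_isClosed_subset
      (isCompact_univ_pi fun _ : Fin r => isCompact_univ_pi fun _ : Fin r =>
        isCompact_Icc (a := (-1 : ℝ)) (b := 1)) ?_ ?_
    · have : ((Matrix.orthogonalGroup (Fin r) ℝ : Submonoid _) : Set (Matrix (Fin r) (Fin r) ℝ))
          = {A | A * A.transpose = 1} := by
        ext A; exact Matrix.mem_orthogonalGroup_iff (Fin r) ℝ
      rw [this]
      exact isClosed_eq (by fun_prop) continuous_const
    · intro A hA i _ j _
      have := entry_norm_bound_of_unitary (𝕜 := ℝ) hA i j
      rw [Real.norm_eq_abs] at this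
      exact abs_le.mp this
  have : CompactSpace (Matrix.orthogonalGroup (Fin r) ℝ) := isCompact_iff_compactSpace.mp hc
  have hf : Continuous fun O : Matrix.orthogonalGroup (Fin r) ℝ =>
      frobSq (X * (O : Matrix (Fin r) (Fin r) ℝ) - U) := by
    unfold frobSq
    have : Continuous fun O : Matrix.orthogonalGroup (Fin r) ℝ =>
      (X * (O : Matrix (Fin r) (Fin r) ℝ) - U) := by fun_prop
    refine continuous_finsetSum _ fun i _ => continuous_finsetSum _ fun j _ => ?_
    exact (this.matrix_elem i j).pow 2
  obtain ⟨O, -, hO⟩ := isCompact_univ.exists_isMinOn Set.univ_nonempty hf.continuousOn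
  refine ⟨O, le_antisymm (ciInf_le ⟨0, ?_⟩ O) (le_ciInf fun O1 => hO (Set.mem_univ O1))⟩
  rintro _ ⟨O1, rfl⟩
  exact Finset.sum_nonneg fun i _ => Finset.sum_nonneg fun j _ => sq_nonneg _

/-- The objective `f(U) = 1/(4m) ∑ᵢ (yᵢ - ‖aᵢᵀ U‖²)²`. -/
def objective (y : Fin m → ℝ) (a : Fin m → ι → ℝ) (U : Matrix ι (Fin r) ℝ) : ℝ :=
  1 / (4 * (m : ℝ)) * ∑ i, (y i - ∑ j, (Matrix.vecMul (a i) U j) ^ 2) ^ 2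

/-- The gradient of the (polynomial) objective: the matrix of its partial derivatives with respect
to the entries of `U`. -/
def objectiveGradient (y : Fin m → ℝ) (a : Fin m → ι → ℝ) (U : Matrix ι (Fin r) ℝ) :
    Matrix ι (Fin r) ℝ :=
  Matrix.of fun p q => lineDeriv ℝ (objective y a) U (Matrix.single p q 1)

/-- The matrix `M = 1/(2m) ∑ᵢ yᵢ aᵢ aᵢᵀ`. -/
def spectralMatrix (y : Fin m → ℝ) (a : Fin m → ι → ℝ) : Matrix ι ι ℝ :=
  (1 / (2 * (m : ℝ))) • ∑ i, y i • Matrix.vecMulVec (a i) (a i)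

theorem spectralMatrix_isHermitian (y : Fin m → ℝ) (a : Fin m → ι → ℝ) :
    (spectralMatrix y a).IsHermitian := by
  ext p q
  simp [spectralMatrix, Matrix.sum_apply, Matrix.vecMulVec_apply, mul_comm (a _ p)]

/-- The eigenvalues of `M`, with multiplicity, in decreasing order (index `0` is the largest). -/
def spectralEigenvalue (y : Fin m → ℝ) (a : Fin m → ι → ℝ) : Fin (Fintype.card ι) → ℝ :=
  (spectralMatrix_isHermitian y a).eigenvalues₀

/-- `U₀` is a spectral initialization: `U₀ = V Λ^{1/2}`, where the columns of `V` are orthonormal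
eigenvectors of `M` for its `r` largest eigenvalues `σ₁ ≥ … ≥ σᵣ` and `Λ = diag(σⱼ - σ_{r+1})`.
Any admissible choice of the eigenvectors is allowed. -/
def IsSpectralInit (y : Fin m → ℝ) (a : Fin m → ι → ℝ) (U₀ : Matrix ι (Fin r) ℝ) : Prop :=
  ∃ (h : r < Fintype.card ι) (V : Matrix ι (Fin r) ℝ),
    V.transpose * V = 1 ∧
    (∀ j : Fin r, (spectralMatrix y a).mulVec (V.col j) =
      spectralEigenvalue y a ⟨j, j.isLt.trans h⟩ • V.col j) ∧
    U₀ = V * Matrix.diagonal fun j : Fin r =>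
      Real.sqrt (spectralEigenvalue y a ⟨j, j.isLt.trans h⟩ - spectralEigenvalue y a ⟨r, h⟩)

/-- A spectral initialization exists whenever `r` is smaller than the dimension. -/
theorem exists_isSpectralInit (h : r < Fintype.card ι) (y : Fin m → ℝ) (a : Fin m → ι → ℝ) :
    ∃ U₀ : Matrix ι (Fin r) ℝ, IsSpectralInit y a U₀ := by
  let hM := spectralMatrix_isHermitian y a
  let e : Fin (Fintype.card ι) ≃ ι := Fintype.equivOfCardEq (Fintype.card_fin _)
  let V : Matrix ι (Fin r) ℝ := Matrix.of fun i j => hM.eigenvectorBasis (e ⟨j, j.isLt.trans h⟩) i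
  refine ⟨_, h, V, ?_, ?_, rfl⟩
  · ext p q
    have := hM.eigenvectorBasis.inner_eq_ite (e ⟨p, p.isLt.trans h⟩) (e ⟨q, q.isLt.trans h⟩)
    rw [PiLp.inner_apply] at this
    simp only [Matrix.mul_apply, Matrix.transpose_apply, V, Matrix.of_apply, Matrix.one_apply]
    simp only [RCLike.inner_apply, conj_trivial, EmbeddingLike.apply_eq_iff_eq, Fin.mk.injEq,
      ← Fin.ext_iff] at this
    rw [← this]
    exact Finset.sum_congr rfl fun _ _ => mul_comm _ _
  · intro j
    have := hM.mulVec_eigenvectorBasis (e ⟨j, j.isLt.trans h⟩)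
    simp only [Matrix.IsHermitian.eigenvalues, e, Equiv.symm_apply_apply] at this
    exact this

/-- One gradient descent step with step size `γ`. -/
def descentStep (y : Fin m → ℝ) (a : Fin m → ι → ℝ) (γ : ℝ) (U : Matrix ι (Fin r) ℝ) :
    Matrix ι (Fin r) ℝ :=
  U - γ • objectiveGradient y a U

/-- `Xhat` is an output of "initialize and descend" after `k` gradient steps of size `γ`. -/
def IsOutput (y : Fin m → ℝ) (a : Fin m → ι → ℝ) (γ : ℝ) (k : ℕ) (Xhat : Matrix ι (Fin r) ℝ) :
    Prop :=
  ∃ U₀, IsSpectralInit y a U₀ ∧ Xhat = (descentStep y a γ)^[k] U₀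

end Algorithm

/-! ### Complex phase retrieval as a real rank-two problem -/

section Complex

variable {n : ℕ}

/-- The measurement `|a* z|²`. -/
def intensity (z : EuclideanSpace ℂ (Fin n)) (a : Fin n → ℂ) : ℝ :=
  ‖∑ j, star (a j) * z j‖ ^ 2

/-- The real vector `[Re(a*) Im(a*)]` of length `2n`. -/
def realify (a : Fin n → ℂ) : Fin n ⊕ Fin n → ℝ :=
  Sum.elim (fun j => (star (a j)).re) (fun j => (star (a j)).im)

/-- The real `2n × 2` matrix `[x w; -w x]` attached to `z = x + i w`. -/
def liftMatrix (z : EuclideanSpace ℂ (Fin n)) : Matrix (Fin n ⊕ Fin n) (Fin 2) ℝ :=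
  Matrix.of (Sum.elim (fun j => ![(z j).re, (z j).im]) (fun j => ![-(z j).im, (z j).re]))

/-- `|a* z|² = ‖[Re(a*) Im(a*)] Z‖²` with `Z = liftMatrix z`. -/
theorem intensity_eq (z : EuclideanSpace ℂ (Fin n)) (a : Fin n → ℂ) :
    intensity z a = ∑ j, Matrix.vecMul (realify a) (liftMatrix z) j ^ 2 := by
  rw [intensity, ← Complex.normSq_eq_norm_sq, Complex.normSq_apply, Fin.sum_univ_two]
  simp only [Matrix.vecMul, dotProduct, realify, liftMatrix, Fintype.sum_sum_type, Matrix.of_apply,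
    Sum.elim_inl, Sum.elim_inr, Matrix.cons_val_zero, Matrix.cons_val_one, Complex.re_sum,
    Complex.im_sum, Complex.mul_re, Complex.mul_im]
  simp only [← Finset.sum_add_distrib, sub_eq_add_neg, mul_neg, sq]

/-- `a₁, …, aₘ` are i.i.d. standard complex Gaussian vectors in `ℂⁿ`: all real and imaginary
parts of all entries are independent and have law `N(0, 1/2)`. -/
structure IsComplexGaussianSample {Ω : Type*} [MeasurableSpace Ω] {m : ℕ}
    (a : Fin m → Ω → Fin n → ℂ) (P : Measure Ω) : Prop where
  re_law : ∀ i j, HasLaw (fun ω => (a i ω j).re) (gaussianReal 0 (1 / 2)) P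
  im_law : ∀ i j, HasLaw (fun ω => (a i ω j).im) (gaussianReal 0 (1 / 2)) P
  indep : iIndepFun (fun (p : Fin m × (Fin n ⊕ Fin n)) ω =>
    Sum.elim (fun j => (a p.1 ω j).re) (fun j => (a p.1 ω j).im) p.2) P

end Complex

end LowRankRecovery

end

/-! All randomness is confined to one event, `IsRegularSample` with ε = 1/10000. On it the whole run
of the algorithm, for every number of steps and every choice of eigenvectors, is controlled by
deterministic inequalities. The lift of z has two orthogonal columns of equal norm ρ = ‖z‖, so it is
ρ times an orthonormal frame e.

Initialization. For Gaussian vectors the form v ↦ ⟪v, Mv⟫ has mean ρ²(‖v‖² + ∑ ⟪v, e k⟫²)/4, with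
eigenvalues ρ²/2 on the span of e and ρ²/4 on its complement. The spectral start is therefore close
to half of a rotated copy of Z, at squared distance close to ρ²/2.
`IsRegularSample.orbitDistSq_spectralInit_le` shows that the error stays below 0.505 ρ².

Descent. Let X be the nearest solution, H = U - X, p = ∑ ⟪b, X j⟫⟪b, H j⟫ and q = ∑ ⟪b, H j⟫². The
pairing of the gradient with H is the empirical mean of (2p + q)(p + q) = (3p/2 + q)² - p²/4. The
square is bounded below by the uniform quartic bound; p² is bounded above by Cauchy-Schwarz and the
weighted quadratic bound. At the nearest solution the cross Gram matrix is symmetric, and then the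
resulting quadratic expression is positive on the whole ball of squared radius 0.505 ρ²
(`IsRegularSample.regularity`). With the gradient bound `frobSq_objectiveGradient_le`, each step
contracts the distance to X, and hence the distance to the orbit
(`IsRegularSample.orbitDistSq_iterate_le`).

Probability. Quartic Gaussian averages have heavy upper tails, so the quartic condition is only a
lower bound: truncation, a Chernoff bound and a net prove it with exponentially small failure. The
upper bounds concern quadratic forms with quartic weights. There the weights are truncated at a
level L of order log m, which changes nothing outside an event of polynomially small probability
(`measureReal_not_isRegularSample_le`). The price is a rate m / L against nets of size exponential
in n, so m must dominate n log m; `exists_sample_size_bound` derives this from the sample size. -/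

namespace LowRankRecovery

set_option linter.unusedSectionVars false

open scoped RealInnerProductSpace

variable {ι : Type*} [Fintype ι] [DecidableEq ι]

/-! ### Column calculus, the closed form of the gradient and a bound for it. -/

section Columns

variable {r m : ℕ}

/-- The `j`-th column of a matrix, as a vector of Euclidean space. -/
noncomputable def colVec (U : Matrix ι (Fin r) ℝ) (j : Fin r) : EuclideanSpace ℝ ι :=
  WithLp.toLp 2 fun i => U i j

theorem inner_colVec (U V : Matrix ι (Fin r) ℝ) (j k : Fin r) :
    ⟪colVec U j, colVec V k⟫ = ∑ i, U i j * V i k := by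
  simp [colVec, PiLp.inner_apply, mul_comm]

theorem vecMul_eq_inner (a : EuclideanSpace ℝ ι) (U : Matrix ι (Fin r) ℝ) (j : Fin r) :
    Matrix.vecMul a U j = ⟪a, colVec U j⟫ := by
  simp [Matrix.vecMul, dotProduct, colVec, PiLp.inner_apply, mul_comm]

theorem frobSq_eq_sum_norm (U : Matrix ι (Fin r) ℝ) : frobSq U = ∑ j, ‖colVec U j‖ ^ 2 := by
  rw [frobSq, Finset.sum_comm]
  simp_rw [← real_inner_self_eq_norm_sq, inner_colVec, sq]

theorem frobSq_nonneg (U : Matrix ι (Fin r) ℝ) : 0 ≤ frobSq U :=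
  Finset.sum_nonneg fun _ _ => Finset.sum_nonneg fun _ _ => sq_nonneg _

theorem colVec_sub (U V : Matrix ι (Fin r) ℝ) (j : Fin r) :
    colVec (U - V) j = colVec U j - colVec V j := rfl

theorem colVec_add (U V : Matrix ι (Fin r) ℝ) (j : Fin r) :
    colVec (U + V) j = colVec U j + colVec V j := rfl

theorem frobSq_add_le (U V : Matrix ι (Fin r) ℝ) :
    frobSq (U + V) ≤ 2 * frobSq U + 2 * frobSq V := by
  simp only [frobSq, Finset.mul_sum, ← Finset.sum_add_distrib, Matrix.add_apply]
  exact Finset.sum_le_sum fun i _ => Finset.sum_le_sum fun j _ => by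
    nlinarith [sq_nonneg (U i j - V i j)]

theorem frobSq_neg (U : Matrix ι (Fin r) ℝ) : frobSq (-U) = frobSq U := by
  simp [frobSq]

theorem vecMul_add_smul_single (a : ι → ℝ) (U : Matrix ι (Fin r) ℝ) (p : ι) (q j : Fin r)
    (t : ℝ) : Matrix.vecMul a (U + t • Matrix.single p q 1) j =
      Matrix.vecMul a U j + t * (if j = q then a p else 0) := by
  simp only [Matrix.vecMul_add, Matrix.vecMul_smul, Pi.add_apply, Pi.smul_apply, smul_eq_mul]
  congr 2
  simp only [Matrix.vecMul, dotProduct, Matrix.single_apply]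
  rcases eq_or_ne j q with rfl | h
  · simp
  · simp [h, h.symm]

/-- The gradient of the objective in closed form. -/
theorem objectiveGradient_apply (y : Fin m → ℝ) (a : Fin m → ι → ℝ) (U : Matrix ι (Fin r) ℝ)
    (p : ι) (q : Fin r) :
    objectiveGradient y a U p q =
      (∑ i, (∑ j, Matrix.vecMul (a i) U j ^ 2 - y i) * (a i p * Matrix.vecMul (a i) U q)) / m := by
  simp only [objectiveGradient, Matrix.of_apply]
  apply HasLineDerivAt.lineDeriv
  unfold HasLineDerivAt objective
  simp only [vecMul_add_smul_single]
  have h1 : ∀ i j, HasDerivAt (fun t : ℝ =>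
      (Matrix.vecMul (a i) U j + t * (if j = q then a i p else 0)) ^ 2)
      (2 * Matrix.vecMul (a i) U j * (if j = q then a i p else 0)) 0 := fun i j => by
    have := (((hasDerivAt_id (0 : ℝ)).mul_const (if j = q then a i p else 0)).const_add
      (Matrix.vecMul (a i) U j)).pow 2
    exact this.congr_deriv (by simp)
  have h2 : ∀ i, HasDerivAt (fun t : ℝ => (y i - ∑ j,
      (Matrix.vecMul (a i) U j + t * (if j = q then a i p else 0)) ^ 2) ^ 2)
      (4 * ((∑ j, Matrix.vecMul (a i) U j ^ 2 - y i) * (a i p * Matrix.vecMul (a i) U q))) 0 := by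
    intro i
    have := ((HasDerivAt.fun_sum (u := Finset.univ) fun j _ => h1 i j).const_sub (y i)).pow 2
    refine this.congr_deriv ?_
    simp only [zero_mul, add_zero]
    simp only [mul_ite, mul_zero, Finset.sum_ite_eq', Finset.mem_univ, if_true]
    push_cast
    ring
  have h3 := (HasDerivAt.fun_sum (u := Finset.univ) fun i _ => h2 i).const_mul (1 / (4 * (m : ℝ)))
  refine h3.congr_deriv ?_
  rw [← Finset.mul_sum]
  rcases eq_or_ne (m : ℝ) 0 with h | h
  · simp [h]
  · field_simp

/-- The pairing of the gradient with a matrix `V`. -/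
theorem sum_objectiveGradient_mul (y : Fin m → ℝ) (b : Fin m → EuclideanSpace ℝ ι)
    (U V : Matrix ι (Fin r) ℝ) :
    ∑ p, ∑ q, objectiveGradient y (fun i => b i) U p q * V p q =
      (∑ i, (∑ j, ⟪b i, colVec U j⟫ ^ 2 - y i) *
        ∑ j, ⟪b i, colVec U j⟫ * ⟪b i, colVec V j⟫) / m := by
  simp only [objectiveGradient_apply, vecMul_eq_inner]
  simp_rw [div_mul_eq_mul_div, ← Finset.sum_div, Finset.sum_mul]
  congr 1
  rw [Finset.sum_congr rfl fun p _ => Finset.sum_comm, Finset.sum_comm]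
  refine Finset.sum_congr rfl fun i _ => ?_
  rw [Finset.mul_sum, Finset.sum_comm]
  refine Finset.sum_congr rfl fun j _ => ?_
  rw [← vecMul_eq_inner (b i) V j]
  simp only [Matrix.vecMul, dotProduct, Finset.mul_sum]
  exact Finset.sum_congr rfl fun p _ => by ring

theorem sq_sum_inner_mul_le (b : EuclideanSpace ℝ ι) (U V : Matrix ι (Fin r) ℝ) :
    (∑ j, ⟪b, colVec U j⟫ * ⟪b, colVec V j⟫) ^ 2 ≤ (‖b‖ ^ 2) ^ 2 * (frobSq U * frobSq V) := by
  have h : ∀ W : Matrix ι (Fin r) ℝ, ∑ j, ⟪b, colVec W j⟫ ^ 2 ≤ ‖b‖ ^ 2 * frobSq W := fun W => by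
    rw [frobSq_eq_sum_norm, Finset.mul_sum]
    refine Finset.sum_le_sum fun j _ => ?_
    rw [← mul_pow, ← sq_abs]
    exact pow_le_pow_left₀ (abs_nonneg _) (abs_real_inner_le_norm _ _) 2
  calc _ ≤ _ := Finset.sum_mul_sq_le_sq_mul_sq _ _ _
    _ ≤ (‖b‖ ^ 2 * frobSq U) * (‖b‖ ^ 2 * frobSq V) :=
      mul_le_mul (h U) (h V) (Finset.sum_nonneg fun _ _ => sq_nonneg _)
        (mul_nonneg (sq_nonneg _) (frobSq_nonneg _))
    _ = _ := by ring

/-- A bound for the gradient in terms of the distance to a matrix that fits the data. -/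
theorem frobSq_objectiveGradient_le (y : Fin m → ℝ) (b : Fin m → EuclideanSpace ℝ ι)
    (U X : Matrix ι (Fin r) ℝ) (hy : ∀ i, y i = ∑ j, ⟪b i, colVec X j⟫ ^ 2) :
    frobSq (objectiveGradient y (fun i => b i) U) ≤
      ((∑ i, ‖b i‖ ^ 4) / m) ^ 2 * (frobSq (U - X) * frobSq (U + X) * frobSq U) := by
  set G := objectiveGradient y (fun i => b i) U with hG
  set K := (∑ i, ‖b i‖ ^ 4) / (m : ℝ)
  have hK : 0 ≤ K := div_nonneg (Finset.sum_nonneg fun i _ => by positivity) (Nat.cast_nonneg m)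
  set S := Real.sqrt (frobSq (U - X) * frobSq (U + X))
  set T := Real.sqrt (frobSq U * frobSq G)
  have h0 : frobSq G = ∑ p, ∑ q, G p q * G p q := by simp [frobSq, sq]
  have h1 : frobSq G ≤ K * (S * T) := by
    rw [h0, hG, sum_objectiveGradient_mul, ← hG, div_mul_eq_mul_div]
    refine div_le_div_of_nonneg_right ?_ (Nat.cast_nonneg m)
    rw [Finset.sum_mul]
    refine Finset.sum_le_sum fun i _ => (le_abs_self _).trans ?_
    have e : ∑ j, ⟪b i, colVec U j⟫ ^ 2 - y i =
        ∑ j, ⟪b i, colVec (U - X) j⟫ * ⟪b i, colVec (U + X) j⟫ := by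
      rw [hy, ← Finset.sum_sub_distrib]
      refine Finset.sum_congr rfl fun j _ => ?_
      rw [colVec_sub, colVec_add, inner_sub_right, inner_add_right]; ring
    have key : ∀ V W : Matrix ι (Fin r) ℝ, |∑ j, ⟪b i, colVec V j⟫ * ⟪b i, colVec W j⟫| ≤
        ‖b i‖ ^ 2 * Real.sqrt (frobSq V * frobSq W) := fun V W => by
      refine Real.abs_le_sqrt (sq_sum_inner_mul_le (b i) V W) |>.trans (le_of_eq ?_)
      rw [Real.sqrt_mul (by positivity), Real.sqrt_sq (by positivity)]
    rw [e, abs_mul]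
    refine (mul_le_mul (key _ _) (key _ _) (abs_nonneg _) (by positivity)).trans (le_of_eq ?_)
    ring
  have hS : S ^ 2 = frobSq (U - X) * frobSq (U + X) :=
    Real.sq_sqrt (mul_nonneg (frobSq_nonneg _) (frobSq_nonneg _))
  have hT : T ^ 2 = frobSq U * frobSq G :=
    Real.sq_sqrt (mul_nonneg (frobSq_nonneg _) (frobSq_nonneg _))
  -- `h1` contains only the square root of `frobSq G` on the right; after squaring, one factor
  -- `frobSq G` can be cancelled.
  have h2 : frobSq G ^ 2 ≤ (K ^ 2 * (S ^ 2 * frobSq U)) * frobSq G := by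
    calc frobSq G ^ 2 ≤ (K * (S * T)) ^ 2 := pow_le_pow_left₀ (frobSq_nonneg _) h1 2
      _ = K ^ 2 * (S ^ 2 * T ^ 2) := by ring
      _ = _ := by rw [hT]; ring
  rw [← hS]
  rcases (frobSq_nonneg G).eq_or_lt with h | h
  · rw [← h]
    have := frobSq_nonneg U
    positivity
  · rw [sq] at h2
    exact le_of_mul_le_mul_right h2 h

/-- Right multiplication by an orthogonal matrix keeps the norms of the rows. -/
theorem sum_sq_inner_colVec_mul_orthogonal (b : EuclideanSpace ℝ ι) (X : Matrix ι (Fin r) ℝ)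
    (O : Matrix.orthogonalGroup (Fin r) ℝ) :
    ∑ j, ⟪b, colVec (X * (O : Matrix (Fin r) (Fin r) ℝ)) j⟫ ^ 2 = ∑ j, ⟪b, colVec X j⟫ ^ 2 := by
  have hO : (O : Matrix (Fin r) (Fin r) ℝ) * (O : Matrix (Fin r) (Fin r) ℝ).transpose = 1 :=
    (Matrix.mem_orthogonalGroup_iff (Fin r) ℝ).1 O.2
  simp_rw [← vecMul_eq_inner]
  have : ∀ v : Fin r → ℝ, ∑ j, v j ^ 2 = v ⬝ᵥ v := fun v => by simp [dotProduct, sq]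
  rw [this, this, ← Matrix.vecMul_vecMul]
  conv_lhs => rw [← Matrix.dotProduct_mulVec, ← Matrix.vecMul_transpose, Matrix.vecMul_vecMul, hO,
    Matrix.vecMul_one]

end Columns

/-! ### Regular samples and the curvature inequality at unit scale. -/

section RegularityCondition

variable {m : ℕ}

/-- The deterministic properties of the sample `b` that gradient descent relies on. They compare
quartic empirical averages with their expectations for `N(0, 1/2)` entries. -/
structure IsRegularSample (b : Fin m → EuclideanSpace ℝ ι) (e : Fin 2 → EuclideanSpace ℝ ι)
    (ε : ℝ) : Prop where
  weighted_le : ∀ v, (∑ i, (∑ k, ⟪b i, e k⟫ ^ 2) * ⟪b i, v⟫ ^ 2) / m ≤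
    (2 * ‖v‖ ^ 2 + 2 * ∑ k, ⟪v, e k⟫ ^ 2) / 4 + 2 * ε * ‖v‖ ^ 2
  le_quartic : ∀ x y : Fin 2 → EuclideanSpace ℝ ι, (∀ j, ‖x j‖ ≤ 4) → (∀ j, ‖y j‖ ≤ 4) →
    (∑ j, ∑ k, (⟪x j, y j⟫ * ⟪x k, y k⟫ + ⟪x j, x k⟫ * ⟪y j, y k⟫ +
      ⟪x j, y k⟫ * ⟪y j, x k⟫)) / 4 - ε ≤ (∑ i, (∑ j, ⟪b i, x j⟫ * ⟪b i, y j⟫) ^ 2) / m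
  fourth_le : (∑ i, ‖b i‖ ^ 4) / m ≤ (Fintype.card ι : ℝ) ^ 2

/-- Only the span of the frame enters the condition. This lets the frame rotate along with the
nearest point of the orbit. -/
theorem IsRegularSample.congr {b : Fin m → EuclideanSpace ℝ ι} {e e' : Fin 2 → EuclideanSpace ℝ ι}
    {ε : ℝ} (h : IsRegularSample b e ε) (he : ∀ v, ∑ k, ⟪v, e' k⟫ ^ 2 = ∑ k, ⟪v, e k⟫ ^ 2) :
    IsRegularSample b e' ε where
  weighted_le v := by simpa only [he] using h.weighted_le v
  le_quartic := h.le_quartic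
  fourth_le := h.fourth_le

theorem sum_sq_inner_le_of_orthonormal {e : Fin 2 → EuclideanSpace ℝ ι} (he : Orthonormal ℝ e)
    (v : EuclideanSpace ℝ ι) : ⟪v, e 0⟫ ^ 2 + ⟪v, e 1⟫ ^ 2 ≤ ‖v‖ ^ 2 := by
  have := he.sum_inner_products_le v (s := Finset.univ)
  simpa [Fin.sum_univ_two, real_inner_comm] using this

/-- The unconstrained minimum in α is at α = 12σ/7. For σ up to about 7/12 this point is admissible;
beyond it the worst case is α = 1, where 3.5 - 6σ + 2σ² at σ² = 0.505 is just above 0.24. This fixes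
the usable radius of the basin. -/
theorem quartic_regularity_aux {α σ : ℝ} (h0 : 0 ≤ α) (h1 : α ≤ 1) (h2 : 0 ≤ σ)
    (h3 : σ ^ 2 ≤ 505 / 1000) :
    24 / 100 ≤ 175 / 100 + 175 / 100 * α ^ 2 - 6 * (α * σ) + 2 * σ ^ 2 := by
  have h4 : σ ≤ 711 / 1000 := by nlinarith
  rcases le_total σ (583 / 1000) with h | h
  · nlinarith [sq_nonneg (α - 12 / 7 * σ)]
  · nlinarith [mul_nonneg (sub_nonneg.2 h1) (sub_nonneg.2 h), mul_nonneg h0 (sub_nonneg.2 h1)]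

/-- The right side is four times the population value of the curvature, with a the symmetric matrix
of the ⟪x j, e k⟫ and g the Gram matrix of x. The coefficient 7/4 is 9/4 from Isserlis' formula
minus 1/2 from the subtracted Cauchy-Schwarz term. Dropping the first square and bounding the
pairing of g and a by Cauchy-Schwarz leaves the scalar inequality with α = √A and σ = s√G. -/
theorem quartic_regularity_aux' {a00 a01 a11 g00 g01 g11 s : ℝ} (hg : g00 + g11 = 1)
    (hcs : g01 ^ 2 ≤ g00 * g11) (ha : a00 ^ 2 + 2 * a01 ^ 2 + a11 ^ 2 ≤ 1)
    (hs : 0 ≤ s) (hs' : s ^ 2 ≤ 505 / 1000) :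
    24 / 100 ≤ (3 / 2 * (a00 + a11) + s) ^ 2 + 175 / 100 +
      175 / 100 * (a00 ^ 2 + 2 * a01 ^ 2 + a11 ^ 2) +
      6 * s * (g00 * a00 + 2 * (g01 * a01) + g11 * a11) +
      2 * s ^ 2 * (g00 ^ 2 + 2 * g01 ^ 2 + g11 ^ 2) := by
  set A := a00 ^ 2 + 2 * a01 ^ 2 + a11 ^ 2 with hA
  set G := g00 ^ 2 + 2 * g01 ^ 2 + g11 ^ 2 with hG
  have hA0 : 0 ≤ A := by positivity
  have hG0 : 0 ≤ G := by positivity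
  have hG1 : G ≤ 1 := by
    have : (g00 + g11) ^ 2 = 1 := by rw [hg]; norm_num
    nlinarith
  have hc : (g00 * a00 + 2 * (g01 * a01) + g11 * a11) ^ 2 ≤ A * G := by
    nlinarith [sq_nonneg (g00 * a01 - g01 * a00), sq_nonneg (g00 * a11 - g11 * a00),
      sq_nonneg (g01 * a11 - g11 * a01)]
  have hc' := Real.abs_le_sqrt hc
  rw [Real.sqrt_mul hA0] at hc'
  have hA2 := Real.sq_sqrt hA0
  have hG2 := Real.sq_sqrt hG0
  have hGs : Real.sqrt G ≤ 1 := Real.sqrt_le_one.2 hG1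
  have hσ : (s * Real.sqrt G) ^ 2 ≤ 505 / 1000 := by
    rw [mul_pow, hG2]; nlinarith [sq_nonneg s]
  have := quartic_regularity_aux (Real.sqrt_nonneg A) (Real.sqrt_le_one.2 ha)
    (mul_nonneg hs (Real.sqrt_nonneg G)) hσ
  rw [mul_pow, hA2, hG2] at this
  have h6 := mul_le_mul_of_nonneg_left (neg_le_of_abs_le hc') hs
  nlinarith [sq_nonneg (3 / 2 * (a00 + a11) + s)]

/-- Completing the square: 2p² + 3spq + s²q² = (3p/2 + sq)² - p²/4, where 3p/2 + sq is the bilinear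
form of x against 3e/2 + sx. So `le_quartic` bounds the square from below and `weighted_le` bounds
p² from above. The margin 0.24/4 = 0.06 absorbs the sampling errors and still exceeds 1/18. -/
theorem IsRegularSample.regularity_of_unit {b : Fin m → EuclideanSpace ℝ ι}
    {e : Fin 2 → EuclideanSpace ℝ ι} (hb : IsRegularSample b e (1 / 10000))
    (he : Orthonormal ℝ e) {x : Fin 2 → EuclideanSpace ℝ ι}
    (hx : ‖x 0‖ ^ 2 + ‖x 1‖ ^ 2 = 1) (hsymm : ⟪e 0, x 1⟫ = ⟪e 1, x 0⟫) {s : ℝ} (hs : 0 ≤ s)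
    (hs' : s ^ 2 ≤ 505 / 1000) :
    1 / 18 ≤ (∑ i, (2 * (∑ k, ⟪b i, e k⟫ * ⟪b i, x k⟫) ^ 2 +
      3 * s * (∑ k, ⟪b i, e k⟫ * ⟪b i, x k⟫) * (∑ k, ⟪b i, x k⟫ ^ 2) +
      s ^ 2 * (∑ k, ⟪b i, x k⟫ ^ 2) ^ 2)) / (m : ℝ) := by
  have he1 : ∀ k, ‖e k‖ = 1 := he.1
  have he01 : ⟪e 0, e 1⟫ = 0 := he.2 (by decide)
  have he10 : ⟪e 1, e 0⟫ = 0 := he.2 (by decide)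
  have hx0 : ‖x 0‖ ≤ 1 := by nlinarith [norm_nonneg (x 0), sq_nonneg ‖x 1‖]
  have hx1 : ‖x 1‖ ≤ 1 := by nlinarith [norm_nonneg (x 1), sq_nonneg ‖x 0‖]
  have hxk : ∀ k, ‖x k‖ ≤ 1 := fun k => by fin_cases k <;> assumption
  have hs1 : s ≤ 1 := by nlinarith
  have hq := hb.le_quartic x (fun k => (3 / 2 : ℝ) • e k + s • x k)
    (fun k => (hxk k).trans (by norm_num)) (fun k => by
      refine (norm_add_le _ _).trans ?_
      rw [norm_smul, norm_smul, he1, Real.norm_of_nonneg hs]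
      norm_num
      nlinarith [hxk k, norm_nonneg (x k)])
  have hw0 := hb.weighted_le (x 0)
  have hw1 := hb.weighted_le (x 1)
  have hsplit : (∑ i, (∑ j, ⟪b i, x j⟫ * ⟪b i, (3 / 2 : ℝ) • e j + s • x j⟫) ^ 2) / m -
      ((∑ i, (∑ k, ⟪b i, e k⟫ ^ 2) * ⟪b i, x 0⟫ ^ 2) / m +
        (∑ i, (∑ k, ⟪b i, e k⟫ ^ 2) * ⟪b i, x 1⟫ ^ 2) / m) / 4 ≤
      (∑ i, (2 * (∑ k, ⟪b i, e k⟫ * ⟪b i, x k⟫) ^ 2 +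
      3 * s * (∑ k, ⟪b i, e k⟫ * ⟪b i, x k⟫) * (∑ k, ⟪b i, x k⟫ ^ 2) +
      s ^ 2 * (∑ k, ⟪b i, x k⟫ ^ 2) ^ 2)) / (m : ℝ) := by
    rw [← add_div, ← Finset.sum_add_distrib, div_right_comm, ← sub_div, Finset.sum_div,
      ← Finset.sum_sub_distrib]
    refine div_le_div_of_nonneg_right (Finset.sum_le_sum fun i _ => ?_) (Nat.cast_nonneg m)
    simp only [Fin.sum_univ_two, inner_add_right, real_inner_smul_right]
    -- The hint is the Lagrange defect in p² ≤ (∑ ⟪b, e k⟫²)(∑ ⟪b, x k⟫²).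
    nlinarith [sq_nonneg (⟪b i, e 0⟫ * ⟪b i, x 1⟫ - ⟪b i, e 1⟫ * ⟪b i, x 0⟫)]
  refine le_trans ?_ hsplit
  have hcs : ⟪x 0, x 1⟫ ^ 2 ≤ ‖x 0‖ ^ 2 * ‖x 1‖ ^ 2 := by
    rw [← mul_pow, ← sq_abs]
    exact pow_le_pow_left₀ (abs_nonneg _) (abs_real_inner_le_norm _ _) 2
  have hb0 := sum_sq_inner_le_of_orthonormal he (x 0)
  have hb1 := sum_sq_inner_le_of_orthonormal he (x 1)
  have hs10 : ⟪x 1, e 0⟫ = ⟪x 0, e 1⟫ := by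
    rw [real_inner_comm, hsymm, real_inner_comm]
  have := quartic_regularity_aux' (a00 := ⟪x 0, e 0⟫) (a01 := ⟪x 0, e 1⟫) (a11 := ⟪x 1, e 1⟫)
    (g00 := ‖x 0‖ ^ 2) (g01 := ⟪x 0, x 1⟫) (g11 := ‖x 1‖ ^ 2) hx hcs
    (by rw [hs10] at hb1; linarith) hs hs'
  simp only [Fin.sum_univ_two, inner_add_right, inner_add_left, real_inner_smul_right,
    real_inner_smul_left, real_inner_self_eq_norm_sq, he1, he01, he10, hs10,
    real_inner_comm (x 0) (x 1), real_inner_comm (x 0) (e 0), real_inner_comm (x 1) (e 0),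
    real_inner_comm (x 1) (e 1), real_inner_comm (x 0) (e 1)] at hq hw0 hw1 this ⊢
  generalize (∑ i, (⟪b i, x 0⟫ * _ + _) ^ 2) / (m : ℝ) = T at *
  generalize (∑ i, (⟪b i, e 0⟫ ^ 2 + ⟪b i, e 1⟫ ^ 2) * ⟪b i, x 0⟫ ^ 2) / (m : ℝ) = T0 at *
  generalize (∑ i, (⟪b i, e 0⟫ ^ 2 + ⟪b i, e 1⟫ ^ 2) * ⟪b i, x 1⟫ ^ 2) / (m : ℝ) = T1 at *
  generalize ‖x 0‖ ^ 2 = g0 at *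
  generalize ‖x 1‖ ^ 2 = g1 at *
  obtain rfl : g1 = 1 - g0 := by linarith
  linarith

end RegularityCondition

/-! ### Alignment with the nearest solution and contraction of the descent. -/

section Descent

variable {m r : ℕ}

theorem orbitDistSq_le (X U : Matrix ι (Fin r) ℝ) (O : Matrix.orthogonalGroup (Fin r) ℝ) :
    orbitDistSq X U ≤ frobSq (X * (O : Matrix (Fin r) (Fin r) ℝ) - U) :=
  ciInf_le ⟨0, by rintro _ ⟨O1, rfl⟩; exact frobSq_nonneg _⟩ O

/-- The rotation of the plane with cosine `c` and sine `s`. -/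
def planeRotation (c s : ℝ) (h : c ^ 2 + s ^ 2 = 1) : Matrix.orthogonalGroup (Fin 2) ℝ :=
  ⟨!![c, -s; s, c], by
    rw [Matrix.mem_orthogonalGroup_iff]
    ext i j
    fin_cases i <;> fin_cases j <;> simp [Matrix.mul_apply] <;> nlinarith⟩

/-- The reflection of the plane with parameters `c` and `s`. -/
def planeReflection (c s : ℝ) (h : c ^ 2 + s ^ 2 = 1) : Matrix.orthogonalGroup (Fin 2) ℝ :=
  ⟨!![c, s; s, -c], by
    rw [Matrix.mem_orthogonalGroup_iff]
    ext i j
    fin_cases i <;> fin_cases j <;> simp [Matrix.mul_apply] <;> nlinarith⟩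

theorem frobSq_mul_planeRotation_sub (X U : Matrix ι (Fin 2) ℝ) (c s : ℝ) (h : c ^ 2 + s ^ 2 = 1) :
    frobSq (X * (planeRotation c s h : Matrix (Fin 2) (Fin 2) ℝ) - U) = frobSq X + frobSq U -
      2 * (c * (⟪colVec X 0, colVec U 0⟫ + ⟪colVec X 1, colVec U 1⟫) +
        s * (⟪colVec X 1, colVec U 0⟫ - ⟪colVec X 0, colVec U 1⟫)) := by
  simp only [inner_colVec, frobSq, ← Finset.sum_add_distrib, ← Finset.sum_sub_distrib,
    Finset.mul_sum]
  refine Finset.sum_congr rfl fun i _ => ?_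
  simp [Fin.sum_univ_two, planeRotation, Matrix.mul_apply]
  linear_combination (X i 0 ^ 2 + X i 1 ^ 2) * h

theorem frobSq_mul_planeReflection_sub (X U : Matrix ι (Fin 2) ℝ) (c s : ℝ)
    (h : c ^ 2 + s ^ 2 = 1) :
    frobSq (X * (planeReflection c s h : Matrix (Fin 2) (Fin 2) ℝ) - U) = frobSq X + frobSq U -
      2 * (c * (⟪colVec X 0, colVec U 0⟫ - ⟪colVec X 1, colVec U 1⟫) +
        s * (⟪colVec X 1, colVec U 0⟫ + ⟪colVec X 0, colVec U 1⟫)) := by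
  simp only [inner_colVec, frobSq, ← Finset.sum_add_distrib, ← Finset.sum_sub_distrib,
    Finset.mul_sum]
  refine Finset.sum_congr rfl fun i _ => ?_
  simp [Fin.sum_univ_two, planeReflection, Matrix.mul_apply]
  linear_combination (X i 0 ^ 2 + X i 1 ^ 2) * h

/-- At the closest point of the orbit the cross Gram matrix is symmetric. -/
theorem exists_orbitDistSq_eq_and_symm (X U : Matrix ι (Fin 2) ℝ) :
    ∃ O : Matrix.orthogonalGroup (Fin 2) ℝ,
      orbitDistSq X U = frobSq (X * (O : Matrix (Fin 2) (Fin 2) ℝ) - U) ∧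
      ⟪colVec (X * (O : Matrix (Fin 2) (Fin 2) ℝ)) 0, colVec U 1⟫ =
        ⟪colVec (X * (O : Matrix (Fin 2) (Fin 2) ℝ)) 1, colVec U 0⟫ := by
  obtain ⟨O, hO⟩ := exists_orbitDistSq_eq X U
  refine ⟨O, hO, ?_⟩
  set W := X * (O : Matrix (Fin 2) (Fin 2) ℝ) with hW
  set S := ⟪colVec W 0, colVec U 0⟫ + ⟪colVec W 1, colVec U 1⟫ with hS
  set D := ⟪colVec W 1, colVec U 0⟫ - ⟪colVec W 0, colVec U 1⟫ with hD
  have key : ∀ c s : ℝ, c ^ 2 + s ^ 2 = 1 → c * S + s * D ≤ S := fun c s h => by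
    have h1 := orbitDistSq_le X U (O * planeRotation c s h)
    have h2 := frobSq_mul_planeRotation_sub W U 1 0 (by norm_num)
    have e : (planeRotation 1 0 (by norm_num) : Matrix (Fin 2) (Fin 2) ℝ) = 1 := by
      ext i j; fin_cases i <;> fin_cases j <;> simp [planeRotation]
    rw [e, Matrix.mul_one] at h2
    rw [Submonoid.coe_mul, ← Matrix.mul_assoc, ← hW, frobSq_mul_planeRotation_sub, hO, h2] at h1
    linarith
  suffices D = 0 by linarith
  by_contra hne
  have hpos : 0 < S ^ 2 + D ^ 2 := by positivity
  have ht := Real.sqrt_pos.2 hpos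
  have ht2 := Real.sq_sqrt hpos.le
  set t := Real.sqrt (S ^ 2 + D ^ 2)
  -- This angle maximizes c * S + s * D, with maximum t = √(S² + D²). Optimality of O gives t ≤ S,
  -- which is impossible for D ≠ 0.
  have h := key (S / t) (D / t) (by field_simp; linarith)
  have h' : S / t * S + D / t * D = t := by field_simp; linarith
  rw [h'] at h
  have : 0 < D ^ 2 := by positivity
  nlinarith

/-- Homogeneity reduces this to unit scale: with X = ρe and U - X = tx, the pairing is ρ²t² times
the unit expression at s = t/ρ. -/
theorem IsRegularSample.regularity {b : Fin m → EuclideanSpace ℝ ι}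
    {e : Fin 2 → EuclideanSpace ℝ ι} (hb : IsRegularSample b e (1 / 10000))
    (he : Orthonormal ℝ e) {ρ : ℝ} (hρ : 0 < ρ) {X U : Matrix ι (Fin 2) ℝ}
    (hX : ∀ j, colVec X j = ρ • e j) (hsymm : ⟪colVec X 0, colVec U 1⟫ = ⟪colVec X 1, colVec U 0⟫)
    (hU : frobSq (U - X) ≤ 505 / 1000 * ρ ^ 2) {y : Fin m → ℝ}
    (hy : ∀ i, y i = ∑ j, ⟪b i, colVec X j⟫ ^ 2) :
    ρ ^ 2 / 18 * frobSq (U - X) ≤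
      ∑ p, ∑ q, objectiveGradient y (fun i => b i) U p q * (U - X) p q := by
  rw [sum_objectiveGradient_mul]
  set H := U - X with hH
  rcases (frobSq_nonneg H).eq_or_lt with h0 | h0
  · have hz : ∀ j, colVec H j = 0 := fun j => by
      rw [frobSq_eq_sum_norm] at h0
      have := (Finset.sum_eq_zero_iff_of_nonneg fun j _ => sq_nonneg ‖colVec H j‖).1 h0.symm j
        (Finset.mem_univ j)
      simpa using this
    simp [← h0, hz]
  set t := Real.sqrt (frobSq H) with ht
  have htpos : 0 < t := Real.sqrt_pos.2 h0
  have ht2 : t ^ 2 = frobSq H := Real.sq_sqrt h0.le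
  have hUe : ∀ j, colVec U j = ρ • e j + colVec H j := fun j => by
    rw [hH, colVec_sub, hX]; abel
  have he01 : ⟪e 0, e 1⟫ = 0 := he.2 (by decide)
  have he10 : ⟪e 1, e 0⟫ = 0 := he.2 (by decide)
  let x : Fin 2 → EuclideanSpace ℝ ι := fun j => t⁻¹ • colVec H j
  have hHx : ∀ j, colVec H j = t • x j := fun j => by
    simp [x, smul_smul, mul_inv_cancel₀ htpos.ne']
  have hx : ‖x 0‖ ^ 2 + ‖x 1‖ ^ 2 = 1 := by
    rw [frobSq_eq_sum_norm, Fin.sum_univ_two, hHx 0, hHx 1, norm_smul t, norm_smul t,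
      Real.norm_of_nonneg htpos.le] at ht2
    have : t ^ 2 * (‖x 0‖ ^ 2 + ‖x 1‖ ^ 2) = t ^ 2 * 1 := by linarith
    exact mul_left_cancel₀ (by positivity) this
  have hxs : ⟪e 0, x 1⟫ = ⟪e 1, x 0⟫ := by
    simp only [hX, hUe, hHx, real_inner_smul_left, inner_add_right, real_inner_smul_right,
      he01, he10, mul_zero, zero_add] at hsymm
    exact mul_left_cancel₀ hρ.ne' (mul_left_cancel₀ htpos.ne' hsymm)
  have hs' : (t / ρ) ^ 2 ≤ 505 / 1000 := by
    rw [div_pow, ht2, div_le_iff₀ (by positivity)]; exact hU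
  have := hb.regularity_of_unit he hx hxs (div_nonneg htpos.le hρ.le) hs'
  have h2 : (∑ i, (∑ j, ⟪b i, colVec U j⟫ ^ 2 - y i) *
      ∑ j, ⟪b i, colVec U j⟫ * ⟪b i, colVec H j⟫) / (m : ℝ) =
      ρ ^ 2 * t ^ 2 * ((∑ i, (2 * (∑ k, ⟪b i, e k⟫ * ⟪b i, x k⟫) ^ 2 +
      3 * (t / ρ) * (∑ k, ⟪b i, e k⟫ * ⟪b i, x k⟫) * (∑ k, ⟪b i, x k⟫ ^ 2) +
      (t / ρ) ^ 2 * (∑ k, ⟪b i, x k⟫ ^ 2) ^ 2)) / (m : ℝ)) := by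
    rw [← mul_div_assoc, Finset.mul_sum]
    congr 1
    refine Finset.sum_congr rfl fun i _ => ?_
    simp only [hy, hUe, hX, hHx, inner_add_right, real_inner_smul_right, Fin.sum_univ_two]
    field_simp
    ring
  rw [h2, ← ht2]
  nlinarith [mul_le_mul_of_nonneg_left this (by positivity : 0 ≤ ρ ^ 2 * t ^ 2)]

theorem frobSq_sub_smul (A B : Matrix ι (Fin r) ℝ) (γ : ℝ) :
    frobSq (A - γ • B) = frobSq A - 2 * γ * ∑ p, ∑ q, B p q * A p q + γ ^ 2 * frobSq B := by
  simp only [frobSq, Finset.mul_sum, ← Finset.sum_add_distrib, ← Finset.sum_sub_distrib,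
    Matrix.sub_apply, Matrix.smul_apply, smul_eq_mul]
  exact Finset.sum_congr rfl fun i _ => Finset.sum_congr rfl fun j _ => by ring

/-- One descent step contracts the distance to the nearest solution. -/
theorem IsRegularSample.frobSq_descentStep_sub_le {b : Fin m → EuclideanSpace ℝ ι}
    {e : Fin 2 → EuclideanSpace ℝ ι} (hb : IsRegularSample b e (1 / 10000))
    (he : Orthonormal ℝ e) {ρ : ℝ} (hρ : 0 < ρ) {X U : Matrix ι (Fin 2) ℝ}
    (hX : ∀ j, colVec X j = ρ • e j) (hsymm : ⟪colVec X 0, colVec U 1⟫ = ⟪colVec X 1, colVec U 0⟫)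
    (hU : frobSq (U - X) ≤ 505 / 1000 * ρ ^ 2) {y : Fin m → ℝ}
    (hy : ∀ i, y i = ∑ j, ⟪b i, colVec X j⟫ ^ 2) {γ : ℝ} (hγ : 0 ≤ γ) :
    frobSq (descentStep y (fun i => b i) γ U - X) ≤
      (1 - γ * ρ ^ 2 / 9 + γ ^ 2 * (108 * (Fintype.card ι : ℝ) ^ 4) * ρ ^ 4) *
        frobSq (U - X) := by
  have h1 := hb.regularity he hρ hX hsymm hU hy
  have h2 := frobSq_objectiveGradient_le y b U X hy
  have h0 := frobSq_nonneg (U - X)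
  have e : descentStep y (fun i => b i) γ U - X =
      (U - X) - γ • objectiveGradient y (fun i => b i) U := by
    rw [descentStep]; abel
  rw [e, frobSq_sub_smul]
  set G := objectiveGradient y (fun i => b i) U
  have hXX : frobSq X = 2 * ρ ^ 2 := by
    simp [frobSq_eq_sum_norm, hX, norm_smul, he.1]
  -- Since ‖X‖² = 2ρ² and ‖U - X‖² ≤ 0.505ρ², the bounds 6 and 18 leave slack; their product is the
  -- 108 of the statement.
  have hUU : frobSq U ≤ 6 * ρ ^ 2 := by
    have := frobSq_add_le (U - X) X
    rw [sub_add_cancel] at this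
    nlinarith
  have hUX : frobSq (U + X) ≤ 18 * ρ ^ 2 := by
    have h3 := frobSq_add_le (U - X) (X + X)
    have h4 := frobSq_add_le X X
    rw [show U - X + (X + X) = U + X by abel] at h3
    nlinarith
  have hK : ((∑ i, ‖b i‖ ^ 4) / (m : ℝ)) ^ 2 ≤ (Fintype.card ι : ℝ) ^ 4 := by
    refine (pow_le_pow_left₀ (div_nonneg (Finset.sum_nonneg fun i _ => by positivity)
      (Nat.cast_nonneg m)) hb.fourth_le 2).trans (le_of_eq (by ring))
  have hprod : frobSq (U - X) * frobSq (U + X) * frobSq U ≤ frobSq (U - X) * (108 * ρ ^ 4) := by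
    rw [mul_assoc]
    refine mul_le_mul_of_nonneg_left ?_ h0
    refine (mul_le_mul hUX hUU (frobSq_nonneg _) (by positivity)).trans (le_of_eq (by ring))
  have h3 : frobSq G ≤ (Fintype.card ι : ℝ) ^ 4 * (frobSq (U - X) * (108 * ρ ^ 4)) :=
    h2.trans (mul_le_mul hK hprod (mul_nonneg (mul_nonneg h0 (frobSq_nonneg _))
      (frobSq_nonneg _)) (by positivity))
  have h4 := mul_le_mul_of_nonneg_left h3 (sq_nonneg γ)
  have h5 := mul_le_mul_of_nonneg_left h1 hγ
  linarith

/-- Geometric convergence of the descent from a starting point in the basin of attraction. -/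
theorem IsRegularSample.orbitDistSq_iterate_le {b : Fin m → EuclideanSpace ℝ ι}
    {e : Fin 2 → EuclideanSpace ℝ ι} (hb : IsRegularSample b e (1 / 10000))
    (he : Orthonormal ℝ e) {ρ : ℝ} (hρ : 0 < ρ) {Z U₀ : Matrix ι (Fin 2) ℝ}
    (hZ : ∀ j, colVec Z j = ρ • e j) (hU : orbitDistSq Z U₀ ≤ 505 / 1000 * ρ ^ 2) {y : Fin m → ℝ}
    (hy : ∀ i, y i = ∑ j, ⟪b i, colVec Z j⟫ ^ 2) {γ q : ℝ} (hγ : 0 ≤ γ)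
    (hq : 1 - γ * ρ ^ 2 / 9 + γ ^ 2 * (108 * (Fintype.card ι : ℝ) ^ 4) * ρ ^ 4 ≤ q)
    (hq0 : 0 ≤ q) (hq1 : q ≤ 1) (k : ℕ) :
    orbitDistSq Z ((descentStep y (fun i => b i) γ)^[k] U₀) ≤ 505 / 1000 * ρ ^ 2 * q ^ k := by
  induction k with
  | zero => simpa using hU
  | succ k ih =>
    rw [Function.iterate_succ_apply']
    set U := (descentStep y (fun i => b i) γ)^[k] U₀
    obtain ⟨O, hO, hsymm⟩ := exists_orbitDistSq_eq_and_symm Z U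
    set X := Z * (O : Matrix (Fin 2) (Fin 2) ℝ) with hXdef
    have hOO : (O : Matrix (Fin 2) (Fin 2) ℝ).transpose * (O : Matrix (Fin 2) (Fin 2) ℝ) = 1 :=
      (Matrix.mem_orthogonalGroup_iff' (Fin 2) ℝ).1 O.2
    -- The frame is replaced by that of the nearest solution X. It is again orthonormal with the
    -- same span, so the sample stays regular for it.
    let e' : Fin 2 → EuclideanSpace ℝ ι := fun j => ρ⁻¹ • colVec X j
    have hXe : ∀ j, colVec X j = ρ • e' j := fun j => by
      simp [e', smul_smul, mul_inv_cancel₀ hρ.ne']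
    have hgram : ∀ j k, ⟪colVec Z j, colVec Z k⟫ = if j = k then ρ ^ 2 else 0 := fun j k => by
      rw [hZ, hZ, real_inner_smul_left, real_inner_smul_right, orthonormal_iff_ite.1 he]
      split_ifs <;> ring
    have hZZ : Z.transpose * Z = ρ ^ 2 • (1 : Matrix (Fin 2) (Fin 2) ℝ) := by
      ext j k
      have := hgram j k
      rw [inner_colVec] at this
      simp [Matrix.mul_apply, Matrix.one_apply, this]
    have hXX : X.transpose * X = ρ ^ 2 • (1 : Matrix (Fin 2) (Fin 2) ℝ) := by
      rw [hXdef, Matrix.transpose_mul, Matrix.mul_assoc, ← Matrix.mul_assoc Z.transpose, hZZ]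
      simp [hOO]
    have he' : Orthonormal ℝ e' := by
      rw [orthonormal_iff_ite]
      intro j k
      have h1 : (X.transpose * X) j k = (ρ ^ 2 • (1 : Matrix (Fin 2) (Fin 2) ℝ)) j k := by rw [hXX]
      simp only [Matrix.mul_apply, Matrix.transpose_apply, Matrix.smul_apply, Matrix.one_apply,
        smul_eq_mul, mul_ite, mul_one, mul_zero] at h1
      simp only [e', real_inner_smul_left, real_inner_smul_right, inner_colVec, h1]
      split_ifs
      · field_simp
      · simp
    have hrot : ∀ v, ∑ k, ⟪v, e' k⟫ ^ 2 = ∑ k, ⟪v, e k⟫ ^ 2 := fun v => by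
      have h1 := sum_sq_inner_colVec_mul_orthogonal v Z O
      rw [← hXdef] at h1
      simp only [hXe, hZ, real_inner_smul_right, mul_pow, ← Finset.mul_sum] at h1
      exact mul_left_cancel₀ (by positivity) h1
    have hfrob : frobSq (U - X) = orbitDistSq Z U := by
      rw [hO, ← frobSq_neg, neg_sub]
    -- This keeps the iterate inside the basin, where the one-step contraction applies.
    have hle1 : q ^ k ≤ 1 := pow_le_one₀ hq0 hq1
    have hstep := (hb.congr hrot).frobSq_descentStep_sub_le he' hρ hXe hsymm
      (by rw [hfrob]; refine ih.trans ?_; nlinarith [sq_nonneg ρ])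
      (y := y) (fun i => by rw [hy, hXdef, sum_sq_inner_colVec_mul_orthogonal]) hγ
    refine (orbitDistSq_le Z _ O).trans ?_
    rw [← hXdef, ← frobSq_neg, neg_sub]
    refine hstep.trans ?_
    rw [hfrob]
    have h0 : 0 ≤ orbitDistSq Z U := by rw [hO]; exact frobSq_nonneg _
    calc _ ≤ q * orbitDistSq Z U := mul_le_mul_of_nonneg_right hq h0
      _ ≤ q * (505 / 1000 * ρ ^ 2 * q ^ k) := mul_le_mul_of_nonneg_left ih hq0
      _ = _ := by ring

end Descent

/-! ### Quadratic forms in an eigenbasis and two-sided bounds for the spectral matrix. -/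

section TopEigenspace

variable {m : ℕ}

/-- The quadratic form of a Hermitian matrix in its eigenbasis. -/
theorem inner_mulVec_eq_sum_eigenvalues {M : Matrix ι ι ℝ} (hM : M.IsHermitian)
    (x : EuclideanSpace ℝ ι) :
    ⟪x, WithLp.toLp 2 (M.mulVec x)⟫ =
      ∑ i, hM.eigenvalues i * ⟪hM.eigenvectorBasis i, x⟫ ^ 2 := by
  rw [← hM.eigenvectorBasis.sum_inner_mul_inner]
  refine Finset.sum_congr rfl fun i _ => ?_
  have h : ⟪hM.eigenvectorBasis i, WithLp.toLp 2 (M.mulVec x)⟫ =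
      hM.eigenvalues i * ⟪hM.eigenvectorBasis i, x⟫ := by
    rw [EuclideanSpace.inner_eq_star_dotProduct, EuclideanSpace.inner_eq_star_dotProduct]
    simp only [star_trivial]
    rw [dotProduct_comm, Matrix.dotProduct_mulVec, ← Matrix.mulVec_transpose,
      show M.transpose = M from hM, hM.mulVec_eigenvectorBasis, smul_dotProduct, smul_eq_mul,
      dotProduct_comm]
  rw [h, real_inner_comm]
  ring

/-- Dimension count: l linear conditions on k > l coefficients have a nonzero solution. This is the
engine of both min-max estimates below. -/
theorem exists_ne_zero_forall_inner_sum_eq_zero {E : Type*} [NormedAddCommGroup E]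
    [InnerProductSpace ℝ E] {k l : ℕ} (hkl : l < k) {f : Fin k → E} (hf : Orthonormal ℝ f)
    (g : Fin l → E) : ∃ c : Fin k → ℝ, ∑ j, c j • f j ≠ 0 ∧ ∀ i, ⟪g i, ∑ j, c j • f j⟫ = 0 := by
  let T : (Fin k → ℝ) →ₗ[ℝ] (Fin l → ℝ) :=
    LinearMap.pi fun i => (innerₛₗ ℝ (g i)) ∘ₗ (Fintype.linearCombination ℝ f)
  have hT : LinearMap.ker T ≠ ⊥ := LinearMap.ker_ne_bot_of_finrank_lt (by simpa using hkl)
  obtain ⟨c, hc, hc0⟩ := Submodule.exists_mem_ne_zero_of_ne_bot hT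
  refine ⟨c, fun h => hc0 ?_, fun i => ?_⟩
  · have := (Fintype.linearIndependent_iff.1 hf.linearIndependent) c h
    exact funext this
  · have := congrFun (LinearMap.mem_ker.1 hc) i
    simpa [T, Fintype.linearCombination_apply] using this

section Spectral

variable {b : Fin m → EuclideanSpace ℝ ι} {e : Fin 2 → EuclideanSpace ℝ ι} {ρ : ℝ}
  {Z : Matrix ι (Fin 2) ℝ} {y : Fin m → ℝ}

theorem inner_spectralMatrix_mulVec (hZ : ∀ j, colVec Z j = ρ • e j)
    (hy : ∀ i, y i = ∑ j, ⟪b i, colVec Z j⟫ ^ 2) (v : EuclideanSpace ℝ ι) :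
    ⟪v, WithLp.toLp 2 ((spectralMatrix y fun i => b i).mulVec v)⟫ =
      ρ ^ 2 / 2 * ((∑ i, (∑ k, ⟪b i, e k⟫ ^ 2) * ⟪b i, v⟫ ^ 2) / m) := by
  have h : ∀ i, (Matrix.vecMulVec (b i) (b i)).mulVec v = ⟪b i, v⟫ • (b i).ofLp := fun i => by
    ext p
    simp only [Matrix.mulVec, dotProduct, Matrix.vecMulVec_apply, PiLp.inner_apply,
      RCLike.inner_apply, conj_trivial, Pi.smul_apply, smul_eq_mul, Finset.sum_mul]
    exact Finset.sum_congr rfl fun q _ => by ring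
  rw [spectralMatrix, Matrix.smul_mulVec, Matrix.sum_mulVec]
  simp only [Matrix.smul_mulVec, h, WithLp.toLp_smul, WithLp.toLp_sum, WithLp.toLp_ofLp,
    real_inner_smul_right, inner_sum]
  rw [← mul_div_assoc, Finset.mul_sum, Finset.mul_sum, Finset.sum_div]
  refine Finset.sum_congr rfl fun i _ => ?_
  rw [hy]
  simp only [hZ, real_inner_smul_right, mul_pow, ← Finset.mul_sum]
  rw [real_inner_comm v (b i)]
  ring

theorem IsRegularSample.inner_spectralMatrix_le (hb : IsRegularSample b e (1 / 10000))
    (hZ : ∀ j, colVec Z j = ρ • e j) (hy : ∀ i, y i = ∑ j, ⟪b i, colVec Z j⟫ ^ 2)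
    (v : EuclideanSpace ℝ ι) :
    ⟪v, WithLp.toLp 2 ((spectralMatrix y fun i => b i).mulVec v)⟫ ≤
      ρ ^ 2 * ((‖v‖ ^ 2 + ∑ k, ⟪v, e k⟫ ^ 2) / 4 + 1 / 10000 * ‖v‖ ^ 2) := by
  rw [inner_spectralMatrix_mulVec hZ hy]
  have := mul_le_mul_of_nonneg_left (hb.weighted_le v) (by positivity : 0 ≤ ρ ^ 2 / 2)
  linarith

/-- For unit w, `le_quartic` applied to the pairs (e k, 0) and (w, 0) is a lower bound for the mean
of ⟪b, e k⟫²⟪b, w⟫². Its error is absolute, so general v are reached by scaling. -/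
theorem IsRegularSample.le_inner_spectralMatrix (hb : IsRegularSample b e (1 / 10000))
    (he : Orthonormal ℝ e) (hZ : ∀ j, colVec Z j = ρ • e j)
    (hy : ∀ i, y i = ∑ j, ⟪b i, colVec Z j⟫ ^ 2) (v : EuclideanSpace ℝ ι) :
    ρ ^ 2 * ((‖v‖ ^ 2 + ∑ k, ⟪v, e k⟫ ^ 2) / 4 - 1 / 10000 * ‖v‖ ^ 2) ≤
      ⟪v, WithLp.toLp 2 ((spectralMatrix y fun i => b i).mulVec v)⟫ := by
  have unit : ∀ w : EuclideanSpace ℝ ι, ‖w‖ = 1 →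
      (1 + ∑ k, ⟪w, e k⟫ ^ 2) / 4 - 1 / 10000 ≤
        1 / 2 * ((∑ i, (∑ k, ⟪b i, e k⟫ ^ 2) * ⟪b i, w⟫ ^ 2) / m) := fun w hw => by
    have h := fun k => hb.le_quartic ![e k, 0] ![w, 0]
      (fun j => by fin_cases j <;> simp [he.1]) (fun j => by fin_cases j <;> simp [hw])
    have h0 := h 0
    have h1 := h 1
    simp only [Fin.sum_univ_two, Matrix.cons_val_zero, Matrix.cons_val_one, inner_zero_left,
      inner_zero_right, mul_zero, zero_mul, add_zero, real_inner_self_eq_norm_sq, hw, he.1] at h0 h1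
    have e1 : (∑ i, (∑ k, ⟪b i, e k⟫ ^ 2) * ⟪b i, w⟫ ^ 2) / (m : ℝ) =
        (∑ i, (⟪b i, e 0⟫ * ⟪b i, w⟫) ^ 2) / m + (∑ i, (⟪b i, e 1⟫ * ⟪b i, w⟫) ^ 2) / m := by
      rw [← add_div, ← Finset.sum_add_distrib]
      simp only [Fin.sum_univ_two, mul_pow, add_mul]
    rw [e1, Fin.sum_univ_two, real_inner_comm, real_inner_comm (e 1)]
    rw [real_inner_comm] at h0
    rw [real_inner_comm] at h1
    simp only [real_inner_comm w (e 0), real_inner_comm w (e 1)] at h0 h1 ⊢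
    linarith
  rw [inner_spectralMatrix_mulVec hZ hy]
  rcases eq_or_ne v 0 with rfl | hv
  · simp
  obtain ⟨t, w, ht, hw, rfl⟩ : ∃ (t : ℝ) (w : EuclideanSpace ℝ ι), 0 < t ∧ ‖w‖ = 1 ∧ v = t • w := by
    have hn : 0 < ‖v‖ := norm_pos_iff.2 hv
    exact ⟨‖v‖, ‖v‖⁻¹ • v, hn, by simp [norm_smul, hn.ne'],
      by simp [smul_smul, mul_inv_cancel₀ hn.ne']⟩
  have := mul_le_mul_of_nonneg_left (unit w hw) (by positivity : 0 ≤ ρ ^ 2 * t ^ 2)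
  simp only [real_inner_smul_left, real_inner_smul_right, mul_pow, ← Finset.mul_sum,
    norm_smul, hw, Real.norm_of_nonneg ht.le, mul_left_comm _ (t ^ 2)]
  rw [mul_div_assoc (t ^ 2)]
  linarith

end Spectral

end TopEigenspace

/-! ### Min-max bounds for eigenvalues and the error of the spectral start. -/

section SpectralInitialization

variable {m : ℕ}

section Spectral

variable {M : Matrix ι ι ℝ}

/-- The eigenbasis indexed in the order of the sorted eigenvalues. -/
noncomputable def sortedEigenvector (hM : M.IsHermitian) (j : Fin (Fintype.card ι)) :
    EuclideanSpace ℝ ι :=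
  hM.eigenvectorBasis (Fintype.equivOfCardEq (Fintype.card_fin _) j)

theorem orthonormal_sortedEigenvector (hM : M.IsHermitian) :
    Orthonormal ℝ (sortedEigenvector hM) :=
  hM.eigenvectorBasis.orthonormal.comp _ (Equiv.injective _)

theorem inner_mulVec_eq_sum_eigenvalues₀ (hM : M.IsHermitian) (x : EuclideanSpace ℝ ι) :
    ⟪x, WithLp.toLp 2 (M.mulVec x)⟫ =
      ∑ j, hM.eigenvalues₀ j * ⟪sortedEigenvector hM j, x⟫ ^ 2 := by
  rw [inner_mulVec_eq_sum_eigenvalues hM,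
    ← Equiv.sum_comp (Fintype.equivOfCardEq (Fintype.card_fin _))]
  simp [sortedEigenvector, Matrix.IsHermitian.eigenvalues]

theorem norm_sq_eq_sum_sortedEigenvector (hM : M.IsHermitian) (x : EuclideanSpace ℝ ι) :
    ‖x‖ ^ 2 = ∑ j, ⟪sortedEigenvector hM j, x⟫ ^ 2 := by
  rw [← hM.eigenvectorBasis.sum_sq_inner_right x,
    ← Equiv.sum_comp (Fintype.equivOfCardEq (Fintype.card_fin _))]
  rfl

/-- If the quadratic form is at least `μ` on the span of more than `k` orthonormal vectors, then
the eigenvalue of index `k` is at least `μ`. -/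
theorem le_eigenvalues₀_of_orthonormal (hM : M.IsHermitian) {k : ℕ} (hk : k < Fintype.card ι)
    {f : Fin (k + 1) → EuclideanSpace ℝ ι} (hf : Orthonormal ℝ f) {μ : ℝ}
    (h : ∀ c : Fin (k + 1) → ℝ, μ * ‖∑ j, c j • f j‖ ^ 2 ≤
      ⟪∑ j, c j • f j, WithLp.toLp 2 (M.mulVec (∑ j, c j • f j).ofLp)⟫) :
    μ ≤ hM.eigenvalues₀ ⟨k, hk⟩ := by
  obtain ⟨c, hc0, hc⟩ := exists_ne_zero_forall_inner_sum_eq_zero (Nat.lt_succ_self k) hf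
    (fun i : Fin k => sortedEigenvector hM ⟨i, i.2.trans hk⟩)
  have h1 := h c
  set x := ∑ j, c j • f j
  have h2 : ⟪x, WithLp.toLp 2 (M.mulVec x)⟫ ≤ hM.eigenvalues₀ ⟨k, hk⟩ * ‖x‖ ^ 2 := by
    rw [inner_mulVec_eq_sum_eigenvalues₀ hM, norm_sq_eq_sum_sortedEigenvector hM, Finset.mul_sum]
    refine Finset.sum_le_sum fun j _ => ?_
    rcases lt_or_ge j.1 k with hj | hj
    · have := hc ⟨j, hj⟩
      simp only [Fin.eta] at this
      simp [this]
    · exact mul_le_mul_of_nonneg_right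
        (hM.eigenvalues₀_antitone (show (⟨k, hk⟩ : Fin _) ≤ j from hj)) (sq_nonneg _)
  have hx : 0 < ‖x‖ ^ 2 := by positivity
  exact le_of_mul_le_mul_right (h1.trans h2) hx

/-- If the quadratic form is at most `μ` on the orthogonal complement of `k` vectors, then the
eigenvalue of index `k` is at most `μ`. -/
theorem eigenvalues₀_le_of_forall_orthogonal (hM : M.IsHermitian) {k : ℕ}
    (hk : k < Fintype.card ι) (g : Fin k → EuclideanSpace ℝ ι) {μ : ℝ}
    (h : ∀ x : EuclideanSpace ℝ ι, (∀ i, ⟪g i, x⟫ = 0) →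
      ⟪x, WithLp.toLp 2 (M.mulVec x)⟫ ≤ μ * ‖x‖ ^ 2) :
    hM.eigenvalues₀ ⟨k, hk⟩ ≤ μ := by
  have hinj : Function.Injective
      (fun j : Fin (k + 1) => (⟨j, by omega⟩ : Fin (Fintype.card ι))) := fun a b hab => by
    simpa [Fin.ext_iff] using hab
  obtain ⟨c, hc0, hc⟩ := exists_ne_zero_forall_inner_sum_eq_zero (Nat.lt_succ_self k)
    ((orthonormal_sortedEigenvector hM).comp _ hinj) g
  have h1 := h _ hc
  set x := ∑ j, c j • (sortedEigenvector hM ∘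
    fun j : Fin (k + 1) => (⟨j, by omega⟩ : Fin (Fintype.card ι))) j with hx
  have h2 : hM.eigenvalues₀ ⟨k, hk⟩ * ‖x‖ ^ 2 ≤ ⟪x, WithLp.toLp 2 (M.mulVec x)⟫ := by
    rw [inner_mulVec_eq_sum_eigenvalues₀ hM, norm_sq_eq_sum_sortedEigenvector hM, Finset.mul_sum]
    refine Finset.sum_le_sum fun j _ => ?_
    rcases le_or_gt j.1 k with hj | hj
    · exact mul_le_mul_of_nonneg_right
        (hM.eigenvalues₀_antitone (show j ≤ (⟨k, hk⟩ : Fin _) from hj)) (sq_nonneg _)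
    · have : ⟪sortedEigenvector hM j, x⟫ = 0 := by
        rw [hx, inner_sum]
        refine Finset.sum_eq_zero fun i _ => ?_
        rw [real_inner_smul_right, Function.comp_apply,
          (orthonormal_sortedEigenvector hM).2 (by simp [Fin.ext_iff]; omega), mul_zero]
      simp [this]
  have hx : 0 < ‖x‖ ^ 2 := by positivity
  exact le_of_mul_le_mul_right (h2.trans h1) hx

end Spectral

/-- Orthogonal Procrustes in two dimensions: for the 2 × 2 cross Gram matrix B, the square of its
nuclear norm is ‖B‖² + 2|det B|. A rotation attains it when det B ≥ 0, a reflection when det B ≤ 0.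
-/
theorem orbitDistSq_le_of_gram (X U : Matrix ι (Fin 2) ℝ) {N : ℝ} (hN : 0 < N)
    (h : N ^ 2 ≤ ⟪colVec X 0, colVec U 0⟫ ^ 2 + ⟪colVec X 1, colVec U 0⟫ ^ 2 +
      ⟪colVec X 0, colVec U 1⟫ ^ 2 + ⟪colVec X 1, colVec U 1⟫ ^ 2 +
      2 * |⟪colVec X 0, colVec U 0⟫ * ⟪colVec X 1, colVec U 1⟫ -
        ⟪colVec X 1, colVec U 0⟫ * ⟪colVec X 0, colVec U 1⟫|) :
    orbitDistSq X U ≤ frobSq X + frobSq U - 2 * N := by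
  have aux : ∀ S D : ℝ, N ^ 2 ≤ S ^ 2 + D ^ 2 →
      ∃ c s : ℝ, c ^ 2 + s ^ 2 = 1 ∧ N ≤ c * S + s * D := fun S D hSD => by
    have hpos : 0 < S ^ 2 + D ^ 2 := lt_of_lt_of_le (by positivity) hSD
    have ht := Real.sqrt_pos.2 hpos
    have ht2 := Real.sq_sqrt hpos.le
    have hNt := Real.le_sqrt_of_sq_le hSD
    set t := Real.sqrt (S ^ 2 + D ^ 2)
    refine ⟨S / t, D / t, by field_simp; linarith, hNt.trans (le_of_eq ?_)⟩
    field_simp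
    linarith
  set B00 := ⟪colVec X 0, colVec U 0⟫
  set B10 := ⟪colVec X 1, colVec U 0⟫
  set B01 := ⟪colVec X 0, colVec U 1⟫
  set B11 := ⟪colVec X 1, colVec U 1⟫
  rcases le_total 0 (B00 * B11 - B10 * B01) with hd | hd
  · rw [abs_of_nonneg hd] at h
    obtain ⟨c, s, hcs, hle⟩ := aux (B00 + B11) (B10 - B01) (by nlinarith)
    refine (orbitDistSq_le X U (planeRotation c s hcs)).trans ?_
    rw [frobSq_mul_planeRotation_sub]
    linarith
  · rw [abs_of_nonpos hd] at h
    obtain ⟨c, s, hcs, hle⟩ := aux (B00 - B11) (B10 + B01) (by nlinarith)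
    refine (orbitDistSq_le X U (planeReflection c s hcs)).trans ?_
    rw [frobSq_mul_planeReflection_sub]
    linarith

/-- Here w is the matrix of inner products of the two eigenvectors with the frame. Testing at (1, 0)
and (0, 1) forces each row of w to have norm near 1; testing at (1, ±1) forces the rows to be nearly
orthogonal. Lagrange's identity then puts |det w| near 1. -/
theorem spectralInit_gram_aux {w00 w01 w10 w11 σ0 σ1 R : ℝ} (hR : 0 < R)
    (h1 : R * (1 / 2 - 1 / 10000) ≤ σ1) (hanti : σ1 ≤ σ0) (hb0 : w00 ^ 2 + w01 ^ 2 ≤ 1)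
    (hb1 : w10 ^ 2 + w11 ^ 2 ≤ 1)
    (hq : ∀ c s : ℝ, c ^ 2 * σ0 + s ^ 2 * σ1 ≤ R * ((c ^ 2 + s ^ 2 +
      ((c * w00 + s * w10) ^ 2 + (c * w01 + s * w11) ^ 2)) / 4 + 1 / 10000 * (c ^ 2 + s ^ 2))) :
    9992 / 10000 ≤ w00 ^ 2 + w01 ^ 2 ∧ 9992 / 10000 ≤ w10 ^ 2 + w11 ^ 2 ∧
      σ0 ≤ R * (1 / 2 + 1 / 10000) ∧ 998 / 1000 ≤ |w00 * w11 - w01 * w10| := by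
  have q10 := hq 1 0
  have q01 := hq 0 1
  have q11 := hq 1 1
  have q1m := hq 1 (-1)
  have c0 : 9992 / 10000 ≤ w00 ^ 2 + w01 ^ 2 := by
    refine le_of_mul_le_mul_left ?_ hR; linarith
  have c1 : 9992 / 10000 ≤ w10 ^ 2 + w11 ^ 2 := by
    refine le_of_mul_le_mul_left ?_ hR; linarith
  have hRb0 := mul_le_mul_of_nonneg_left hb0 hR.le
  have hRb1 := mul_le_mul_of_nonneg_left hb1 hR.le
  have cp : -(1 / 1000) ≤ w00 * w10 + w01 * w11 := by
    refine le_of_mul_le_mul_left ?_ hR; linarith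
  have cm : w00 * w10 + w01 * w11 ≤ 1 / 1000 := by
    refine le_of_mul_le_mul_left ?_ hR; linarith
  refine ⟨c0, c1, by linarith, ?_⟩
  have hsq : (w00 * w10 + w01 * w11) ^ 2 ≤ (1 / 1000) ^ 2 := sq_le_sq' cp cm
  have hp := mul_le_mul c0 c1 (by norm_num) (by positivity)
  refine abs_le_of_sq_le_sq' ?_ (abs_nonneg _) |>.2
  rw [sq_abs]
  have : (w00 * w11 - w01 * w10) ^ 2 = (w00 ^ 2 + w01 ^ 2) * (w10 ^ 2 + w11 ^ 2) -
    (w00 * w10 + w01 * w11) ^ 2 := by ring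
  rw [this]
  linarith

/-- Both shifted eigenvalues are at least 0.2498 ρ², so the cross Gram matrix has nuclear norm close
to ρ · 2 · (ρ/2) = ρ². The constant 0.9985 is what remains after all errors. -/
theorem spectralInit_sqrt_aux {w00 w01 w10 w11 σ0 σ1 τ ρ : ℝ} (hρ : 0 < ρ)
    (h1 : ρ ^ 2 * (1 / 2 - 1 / 10000) ≤ σ1) (hanti : σ1 ≤ σ0)
    (h2 : τ ≤ ρ ^ 2 * (1 / 4 + 1 / 10000)) (c0 : 9992 / 10000 ≤ w00 ^ 2 + w01 ^ 2)
    (c1 : 9992 / 10000 ≤ w10 ^ 2 + w11 ^ 2) (hdet : 998 / 1000 ≤ |w00 * w11 - w01 * w10|) :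
    (ρ ^ 2 * (9985 / 10000)) ^ 2 ≤ (ρ * Real.sqrt (σ0 - τ) * w00) ^ 2 +
      (ρ * Real.sqrt (σ0 - τ) * w01) ^ 2 + (ρ * Real.sqrt (σ1 - τ) * w10) ^ 2 +
      (ρ * Real.sqrt (σ1 - τ) * w11) ^ 2 +
      2 * |ρ * Real.sqrt (σ0 - τ) * w00 * (ρ * Real.sqrt (σ1 - τ) * w11) -
        ρ * Real.sqrt (σ0 - τ) * w01 * (ρ * Real.sqrt (σ1 - τ) * w10)| := by
  have hρ2 : 0 < ρ ^ 2 := by positivity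
  have e0 : Real.sqrt (σ0 - τ) ^ 2 = σ0 - τ := Real.sq_sqrt (by linarith)
  have e1 : Real.sqrt (σ1 - τ) ^ 2 = σ1 - τ := Real.sq_sqrt (by linarith)
  have n0 := Real.sqrt_nonneg (σ0 - τ)
  have n1 := Real.sqrt_nonneg (σ1 - τ)
  generalize Real.sqrt (σ0 - τ) = s0 at *
  generalize Real.sqrt (σ1 - τ) = s1 at *
  have l0 : ρ ^ 2 * (2498 / 10000) ≤ s0 ^ 2 := by linarith
  have l1 : ρ ^ 2 * (2498 / 10000) ≤ s1 ^ 2 := by linarith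
  have l01 : ρ ^ 2 * (2498 / 10000) ≤ s0 * s1 := by
    refine abs_le_of_sq_le_sq' ?_ (by positivity) |>.2
    rw [mul_pow s0 s1, sq (ρ ^ 2 * _)]
    exact mul_le_mul l0 l1 (by positivity) (by positivity)
  have ha : |ρ * s0 * w00 * (ρ * s1 * w11) - ρ * s0 * w01 * (ρ * s1 * w10)| =
      ρ ^ 2 * ((s0 * s1) * |w00 * w11 - w01 * w10|) := by
    rw [show ρ * s0 * w00 * (ρ * s1 * w11) - ρ * s0 * w01 * (ρ * s1 * w10) =
      (ρ ^ 2 * (s0 * s1)) * (w00 * w11 - w01 * w10) by ring, abs_mul,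
      abs_of_nonneg (a := ρ ^ 2 * (s0 * s1)) (by positivity)]
    ring
  have m0 := mul_le_mul l0 c0 (by norm_num) (sq_nonneg s0)
  have m1 := mul_le_mul l1 c1 (by norm_num) (sq_nonneg s1)
  have m2 := mul_le_mul l01 hdet (by norm_num) (by positivity)
  rw [ha]
  have : (ρ * s0 * w00) ^ 2 + (ρ * s0 * w01) ^ 2 + (ρ * s1 * w10) ^ 2 + (ρ * s1 * w11) ^ 2 +
      2 * (ρ ^ 2 * ((s0 * s1) * |w00 * w11 - w01 * w10|)) =
      ρ ^ 2 * (s0 ^ 2 * (w00 ^ 2 + w01 ^ 2) + s1 ^ 2 * (w10 ^ 2 + w11 ^ 2) +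
        2 * ((s0 * s1) * |w00 * w11 - w01 * w10|)) := by ring
  rw [this, show (ρ ^ 2 * (9985 / 10000)) ^ 2 = ρ ^ 2 * (ρ ^ 2 * (9985 / 10000) ^ 2) by ring]
  refine mul_le_mul_of_nonneg_left ?_ hρ2.le
  linarith

section Init

variable {b : Fin m → EuclideanSpace ℝ ι} {e : Fin 2 → EuclideanSpace ℝ ι} {ρ : ℝ}
  {Z : Matrix ι (Fin 2) ℝ} {y : Fin m → ℝ}

/-- The quadratic form is within ρ²/10000 · ‖v‖² of ρ²(‖v‖² + ∑ ⟪v, e k⟫²)/4. The min-max principle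
transfers this: the frame is the test space for the second eigenvalue, its complement for the third.
-/
theorem IsRegularSample.spectralEigenvalue_bounds (hb : IsRegularSample b e (1 / 10000))
    (he : Orthonormal ℝ e) (hZ : ∀ j, colVec Z j = ρ • e j)
    (hy : ∀ i, y i = ∑ j, ⟪b i, colVec Z j⟫ ^ 2) (hcard : 2 < Fintype.card ι) :
    ρ ^ 2 * (1 / 2 - 1 / 10000) ≤ spectralEigenvalue y (fun i => b i) ⟨1, by omega⟩ ∧
    spectralEigenvalue y (fun i => b i) ⟨2, hcard⟩ ≤ ρ ^ 2 * (1 / 4 + 1 / 10000) ∧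
    ρ ^ 2 * (1 / 4 - 1 / 10000) ≤ spectralEigenvalue y (fun i => b i) ⟨2, hcard⟩ := by
  have hM := spectralMatrix_isHermitian y (fun i => b i)
  refine ⟨?_, ?_, ?_⟩
  · refine le_eigenvalues₀_of_orthonormal hM _ he fun c => ?_
    have h := hb.le_inner_spectralMatrix he hZ hy (∑ j, c j • e j)
    have h2 : ∑ k, ⟪∑ j, c j • e j, e k⟫ ^ 2 = ‖∑ j, c j • e j‖ ^ 2 := by
      rw [← real_inner_self_eq_norm_sq, he.inner_sum]
      exact Finset.sum_congr rfl fun k _ => by rw [he.inner_left_fintype, sq]; rfl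
    rw [h2] at h
    linarith
  · refine eigenvalues₀_le_of_forall_orthogonal hM _ e fun x hx => ?_
    have h := hb.inner_spectralMatrix_le hZ hy x
    simp only [fun k => (real_inner_comm (e k) x).trans (hx k)] at h
    simp at h
    linarith
  -- The lower bound ρ²(1/4 - 1/10000) holds on every vector, so any three orthonormal vectors serve
  -- as a test space.
  · have hinj : Function.Injective
        (fun j : Fin (2 + 1) => (⟨j, by omega⟩ : Fin (Fintype.card ι))) := fun a b hab => by
      simpa [Fin.ext_iff] using hab
    refine le_eigenvalues₀_of_orthonormal hM _ ((orthonormal_sortedEigenvector hM).comp _ hinj)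
      fun c => ?_
    refine le_trans ?_ (hb.le_inner_spectralMatrix he hZ hy _)
    have := Finset.sum_nonneg fun k (_ : k ∈ (Finset.univ : Finset (Fin 2))) =>
      sq_nonneg ⟪∑ j, c j • (sortedEigenvector hM ∘
        fun j : Fin (2 + 1) => (⟨j, by omega⟩ : Fin (Fintype.card ι))) j, e k⟫
    nlinarith [mul_nonneg (sq_nonneg ρ) this]

/-- A spectral initialization of a regular sample lies in the basin of attraction. -/
theorem IsRegularSample.orbitDistSq_spectralInit_le (hb : IsRegularSample b e (1 / 10000))
    (he : Orthonormal ℝ e) (hρ : 0 < ρ) (hZ : ∀ j, colVec Z j = ρ • e j)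
    (hy : ∀ i, y i = ∑ j, ⟪b i, colVec Z j⟫ ^ 2) {U₀ : Matrix ι (Fin 2) ℝ}
    (hU : IsSpectralInit y (fun i => b i) U₀) : orbitDistSq Z U₀ ≤ 505 / 1000 * ρ ^ 2 := by
  obtain ⟨hcard, V, hV, hMV, rfl⟩ := hU
  obtain ⟨h1, h2u, h2l⟩ := hb.spectralEigenvalue_bounds he hZ hy hcard
  have hanti : spectralEigenvalue y (fun i => b i) ⟨1, by omega⟩ ≤
      spectralEigenvalue y (fun i => b i) ⟨0, by omega⟩ :=
    (spectralMatrix_isHermitian y (fun i => b i)).eigenvalues₀_antitone (by simp)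
  set v : Fin 2 → EuclideanSpace ℝ ι := colVec V with hv
  set σ : Fin 2 → ℝ := fun j => spectralEigenvalue y (fun i => b i) ⟨j, j.isLt.trans hcard⟩ with hσ
  set τ := spectralEigenvalue y (fun i => b i) ⟨2, hcard⟩
  change ρ ^ 2 * (1 / 2 - 1 / 10000) ≤ σ 1 at h1
  change σ 1 ≤ σ 0 at hanti
  have hvo : Orthonormal ℝ v := by
    rw [orthonormal_iff_ite]
    intro j k
    have := congrFun (congrFun hV j) k
    simpa [hv, inner_colVec, Matrix.mul_apply, Matrix.one_apply] using this
  have hv1 := hvo.1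
  have hv01 : ⟪v 0, v 1⟫ = 0 := hvo.2 (by decide)
  have hv10 : ⟪v 1, v 0⟫ = 0 := hvo.2 (by decide)
  have hMv : ∀ j, WithLp.toLp 2 ((spectralMatrix y fun i => b i).mulVec (v j)) = σ j • v j :=
    fun j => by
      have := congrArg (WithLp.toLp 2) (hMV j)
      exact this
  have hup := fun x => hb.inner_spectralMatrix_le hZ hy x
  have hq : ∀ c s : ℝ, c ^ 2 * σ 0 + s ^ 2 * σ 1 ≤ ρ ^ 2 * ((c ^ 2 + s ^ 2 +
      ((c * ⟪v 0, e 0⟫ + s * ⟪v 1, e 0⟫) ^ 2 + (c * ⟪v 0, e 1⟫ + s * ⟪v 1, e 1⟫) ^ 2)) / 4 + 1 / 10000 * (c ^ 2 + s ^ 2)) := by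
    intro c s
    have h := hup (c • v 0 + s • v 1)
    have hn : ‖c • v 0 + s • v 1‖ ^ 2 = c ^ 2 + s ^ 2 := by
      rw [norm_add_sq_real, real_inner_smul_left, real_inner_smul_right, hv01, norm_smul,
        norm_smul, mul_pow, mul_pow, hv1, hv1, Real.norm_eq_abs, Real.norm_eq_abs, sq_abs, sq_abs]
      ring
    rw [hn] at h
    have hMx : WithLp.toLp 2 ((spectralMatrix y fun i => b i).mulVec (c • v 0 + s • v 1).ofLp) =
        (c * σ 0) • v 0 + (s * σ 1) • v 1 := by
      rw [WithLp.ofLp_add, WithLp.ofLp_smul, WithLp.ofLp_smul, Matrix.mulVec_add,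
        Matrix.mulVec_smul, Matrix.mulVec_smul, WithLp.toLp_add, WithLp.toLp_smul,
        WithLp.toLp_smul, hMv, hMv, smul_smul, smul_smul]
    rw [hMx] at h
    simp only [inner_add_left, inner_add_right, real_inner_smul_left, real_inner_smul_right,
        hv01, hv10, real_inner_self_eq_norm_sq (v _), hv1, Fin.sum_univ_two] at h
    linarith
  have hρ2 : 0 < ρ ^ 2 := by positivity
  obtain ⟨c0, c1, hσ0, hdet⟩ := spectralInit_gram_aux hρ2 h1 hanti
    (by simpa [hv1] using sum_sq_inner_le_of_orthonormal he (v 0))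
    (by simpa [hv1] using sum_sq_inner_le_of_orthonormal he (v 1)) hq
  have hs := spectralInit_sqrt_aux (w00 := ⟪v 0, e 0⟫) (w01 := ⟪v 0, e 1⟫) (w10 := ⟪v 1, e 0⟫)
    (w11 := ⟪v 1, e 1⟫) hρ h1 hanti h2u c0 c1 hdet
  have e0 := Real.sq_sqrt (show 0 ≤ σ 0 - τ by nlinarith)
  have e1 := Real.sq_sqrt (show 0 ≤ σ 1 - τ by nlinarith)
  set U := V * Matrix.diagonal fun j : Fin 2 => Real.sqrt (σ j - τ) with hUdef
  have hUc : ∀ j, colVec U j = Real.sqrt (σ j - τ) • v j := fun j => by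
    ext i
    simp [hUdef, hv, colVec, Matrix.mul_diagonal, mul_comm]
  have hfU : frobSq U = σ 0 - τ + (σ 1 - τ) := by
    rw [frobSq_eq_sum_norm, Fin.sum_univ_two, hUc, hUc, norm_smul, norm_smul, hv1, hv1,
      Real.norm_of_nonneg (Real.sqrt_nonneg _), Real.norm_of_nonneg (Real.sqrt_nonneg _),
      mul_one, mul_one, e0, e1]
  have hfZ : frobSq Z = 2 * ρ ^ 2 := by
    simp [frobSq_eq_sum_norm, hZ, norm_smul, he.1]
  have hin : ∀ j k, ⟪colVec Z k, colVec U j⟫ = ρ * Real.sqrt (σ j - τ) * ⟪v j, e k⟫ :=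
    fun j k => by
      rw [hZ, hUc, real_inner_smul_left, real_inner_smul_right, real_inner_comm]; ring
  have := orbitDistSq_le_of_gram Z U (N := ρ ^ 2 * (9985 / 10000)) (by positivity)
    (by rw [hin, hin, hin, hin]; exact hs)
  refine this.trans ?_
  -- The sum is about 2ρ² + ρ²/2 - 2ρ²; the accumulated errors keep it at most 0.505ρ².
  rw [hfU, hfZ]
  linarith

end Init

end SpectralInitialization

/-! ### Moments of the one-dimensional law N(0, 1/2). -/

section Gaussian

theorem gaussianPDFReal_half (x : ℝ) :
    gaussianPDFReal 0 (1 / 2) x = (Real.sqrt Real.pi)⁻¹ * Real.exp (-x ^ 2) := by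
  have h : ((1 / 2 : NNReal) : ℝ) = 1 / 2 := by norm_num
  rw [gaussianPDFReal_def, h, show 2 * Real.pi * (1 / 2) = Real.pi by ring]
  simp

theorem exp_mul_sq_gaussianPDFReal (x : ℝ) :
    gaussianPDFReal 0 (1 / 2) x • Real.exp (3 / 4 * x ^ 2) =
      (Real.sqrt Real.pi)⁻¹ * Real.exp (-(1 / 4) * x ^ 2) := by
  rw [gaussianPDFReal_half, smul_eq_mul, mul_assoc, ← Real.exp_add]
  congr 2
  ring

/-- The exponent 3/4 is below the critical value 1 for variance 1/2. This single exponential moment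
dominates all powers and products needed later. -/
theorem integral_exp_sq_gaussianReal :
    ∫ x, Real.exp (3 / 4 * x ^ 2) ∂(gaussianReal 0 (1 / 2)) = 2 := by
  rw [integral_gaussianReal_eq_integral_smul (by norm_num)]
  simp_rw [exp_mul_sq_gaussianPDFReal]
  rw [integral_const_mul, integral_gaussian, show Real.pi / (1 / 4) = Real.pi * 2 ^ 2 by ring,
    Real.sqrt_mul Real.pi_pos.le, Real.sqrt_sq (by norm_num), ← mul_assoc,
    inv_mul_cancel₀ (Real.sqrt_pos.2 Real.pi_pos).ne', one_mul]

theorem integrable_exp_sq_gaussianReal :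
    Integrable (fun x : ℝ => Real.exp (3 / 4 * x ^ 2)) (gaussianReal 0 (1 / 2)) := by
  by_contra h
  -- A nonintegrable function has Bochner integral 0, but the computed value is 2.
  have := integral_undef h
  rw [integral_exp_sq_gaussianReal] at this
  norm_num at this

theorem integral_pow_four_gaussianReal :
    ∫ x, x ^ 4 ∂(gaussianReal 0 (1 / 2)) = 3 / 4 := by
  rw [integral_gaussianReal_eq_integral_smul (by norm_num)]
  have h1 : ∀ x : ℝ, gaussianPDFReal 0 (1 / 2) x • x ^ 4 =
      (Real.sqrt Real.pi)⁻¹ * (|x| ^ (4 : ℝ) * Real.exp (-1 * |x| ^ (2 : ℝ))) := fun x => by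
    have h4 : |x| ^ (4 : ℝ) = x ^ 4 := by
      rw [show (4 : ℝ) = ((4 : ℕ) : ℝ) by norm_num, Real.rpow_natCast, ← abs_pow,
        abs_of_nonneg (by positivity)]
    have h2 : |x| ^ (2 : ℝ) = x ^ 2 := by
      rw [show (2 : ℝ) = ((2 : ℕ) : ℝ) by norm_num, Real.rpow_natCast, sq_abs]
    rw [h4, h2]
    rw [gaussianPDFReal_half, smul_eq_mul, neg_one_mul]
    ring
  simp_rw [h1]
  rw [integral_const_mul, integral_comp_abs (f := fun x => x ^ (4 : ℝ) * Real.exp (-1 * x ^ (2 : ℝ))),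
    integral_rpow_mul_exp_neg_mul_rpow (by norm_num) (by norm_num) (by norm_num)]
  have hG : Real.Gamma ((4 + 1) / 2) = 3 / 4 * Real.sqrt Real.pi := by
    rw [show ((4 : ℝ) + 1) / 2 = 1 / 2 + 1 + 1 by norm_num, Real.Gamma_add_one (by norm_num),
      Real.Gamma_add_one (by norm_num), Real.Gamma_one_half_eq]
    ring
  rw [hG]
  have := (Real.sqrt_pos.2 Real.pi_pos).ne'
  simp
  field_simp

theorem integral_sq_gaussianReal : ∫ x, x ^ 2 ∂(gaussianReal 0 (1 / 2)) = 1 / 2 := by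
  have h := variance_fun_id_gaussianReal (μ := 0) (v := 1 / 2)
  rw [variance_eq_integral (by fun_prop)] at h
  simpa using h

end Gaussian

/-! ### Gaussian vectors: rotation invariance and mixed moments. -/

variable (ι) in
/-- The law of a random vector with independent `N(0, 1/2)` coordinates. -/
noncomputable def halfGaussian : Measure (EuclideanSpace ℝ ι) :=
  (Measure.pi fun _ : ι => gaussianReal 0 (1 / 2)).map (WithLp.toLp 2)

instance : IsProbabilityMeasure (halfGaussian ι) :=
  Measure.isProbabilityMeasure_map (Measurable.aemeasurable (by fun_prop))

/-- Rotation invariance, read off from characteristic functions: the product of the coordinate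
factors depends on v only through ∑ v i ^ 2. -/
theorem hasLaw_inner_halfGaussian {v : EuclideanSpace ℝ ι} (hv : ‖v‖ = 1) :
    HasLaw (fun x => ⟪x, v⟫) (gaussianReal 0 (1 / 2)) (halfGaussian ι) where
  map_eq := by
    have : IsProbabilityMeasure ((halfGaussian ι).map fun x => ⟪x, v⟫) :=
      Measure.isProbabilityMeasure_map (by fun_prop)
    apply Measure.ext_of_charFun
    ext t
    have h : charFun ((halfGaussian ι).map fun x => ⟪x, v⟫) t = charFun (halfGaussian ι) (t • v) := by
      rw [charFun_apply_real, charFun_apply, integral_map (by fun_prop) (by fun_prop)]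
      simp [real_inner_smul_right]
    have hs : ∑ i, v i ^ 2 = 1 := by
      rw [← EuclideanSpace.real_norm_sq_eq, hv, one_pow]
    have hs' : ∑ i, (v i : ℂ) ^ 2 = 1 := by exact_mod_cast hs
    rw [h, halfGaussian, charFun_pi]
    simp_rw [charFun_gaussianReal]
    rw [← Complex.exp_sum]
    congr 1
    simp only [PiLp.smul_apply, smul_eq_mul, Complex.ofReal_mul, Complex.ofReal_zero, mul_zero,
      zero_mul, zero_sub, mul_pow, Finset.sum_neg_distrib, ← Finset.sum_div]
    simp only [← Finset.mul_sum, hs']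
    ring

theorem exists_unit_smul {v : EuclideanSpace ℝ ι} (hv : v ≠ 0) :
    ∃ u : EuclideanSpace ℝ ι, ‖u‖ = 1 ∧ v = ‖v‖ • u := by
  have hn : 0 < ‖v‖ := norm_pos_iff.2 hv
  exact ⟨‖v‖⁻¹ • v, by simp [norm_smul, hn.ne'], by simp [smul_smul, mul_inv_cancel₀ hn.ne']⟩

theorem integrable_exp_sq_inner {v : EuclideanSpace ℝ ι} (hv : ‖v‖ = 1) :
    Integrable (fun x => Real.exp (3 / 4 * ⟪x, v⟫ ^ 2)) (halfGaussian ι) := by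
  have h := integrable_exp_sq_gaussianReal
  rw [← (hasLaw_inner_halfGaussian hv).map_eq] at h
  exact h.comp_aemeasurable (hasLaw_inner_halfGaussian hv).aemeasurable

theorem integral_exp_sq_inner {v : EuclideanSpace ℝ ι} (hv : ‖v‖ = 1) :
    ∫ x, Real.exp (3 / 4 * ⟪x, v⟫ ^ 2) ∂(halfGaussian ι) = 2 := by
  rw [← integral_exp_sq_gaussianReal]
  exact (hasLaw_inner_halfGaussian hv).integral_comp
    (f := fun t => Real.exp (3 / 4 * t ^ 2)) (by fun_prop)

theorem pow_four_le_exp (t : ℝ) : t ^ 4 ≤ 4 * Real.exp (3 / 4 * t ^ 2) := by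
  have := Real.quadratic_le_exp_of_nonneg (show 0 ≤ 3 / 4 * t ^ 2 by positivity)
  nlinarith [sq_nonneg t]

theorem pow_eight_le_exp (t : ℝ) : t ^ 8 ≤ 76 * Real.exp (3 / 4 * t ^ 2) := by
  have := Real.pow_div_factorial_le_exp (3 / 4 * t ^ 2) (by positivity) 4
  norm_num [Nat.factorial] at this
  have h : (3 / 4 * t ^ 2) ^ 4 = 81 / 256 * t ^ 8 := by ring
  rw [h] at this
  have := Real.exp_pos (3 / 4 * t ^ 2)
  linarith

theorem integrable_inner_pow_four (v : EuclideanSpace ℝ ι) :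
    Integrable (fun x => ⟪x, v⟫ ^ 4) (halfGaussian ι) := by
  rcases eq_or_ne v 0 with rfl | hv
  · simp
  obtain ⟨u, hu, huv⟩ := exists_unit_smul hv
  rw [huv]
  simp_rw [real_inner_smul_right, mul_pow]
  refine Integrable.const_mul ?_ _
  refine ((integrable_exp_sq_inner hu).const_mul 4).mono' (by fun_prop) (ae_of_all _ fun x => ?_)
  rw [Real.norm_of_nonneg (by positivity)]
  exact pow_four_le_exp _

theorem integral_inner_pow_four (v : EuclideanSpace ℝ ι) :
    ∫ x, ⟪x, v⟫ ^ 4 ∂(halfGaussian ι) = 3 / 4 * ‖v‖ ^ 4 := by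
  rcases eq_or_ne v 0 with rfl | hv
  · simp
  obtain ⟨u, hu, huv⟩ := exists_unit_smul hv
  have h : ∫ x, ⟪x, u⟫ ^ 4 ∂(halfGaussian ι) = 3 / 4 := by
    rw [← integral_pow_four_gaussianReal]
    exact (hasLaw_inner_halfGaussian hu).integral_comp (f := fun t => t ^ 4) (by fun_prop)
  conv_lhs => rw [huv]
  simp_rw [real_inner_smul_right, mul_pow]
  rw [integral_const_mul, h]
  ring

theorem integrable_inner_pow_eight (v : EuclideanSpace ℝ ι) :
    Integrable (fun x => ⟪x, v⟫ ^ 8) (halfGaussian ι) := by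
  rcases eq_or_ne v 0 with rfl | hv
  · simp
  obtain ⟨u, hu, huv⟩ := exists_unit_smul hv
  rw [huv]
  simp_rw [real_inner_smul_right, mul_pow]
  refine Integrable.const_mul ?_ _
  refine ((integrable_exp_sq_inner hu).const_mul 76).mono' (by fun_prop) (ae_of_all _ fun x => ?_)
  rw [Real.norm_of_nonneg (by positivity)]
  exact pow_eight_le_exp _

theorem integral_inner_pow_eight_le {v : EuclideanSpace ℝ ι} (hv4 : ‖v‖ ≤ 4) :
    ∫ x, ⟪x, v⟫ ^ 8 ∂(halfGaussian ι) ≤ 10000000 := by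
  rcases eq_or_ne v 0 with rfl | hv
  · simp
  obtain ⟨u, hu, huv⟩ := exists_unit_smul hv
  have h : ∫ x, ⟪x, u⟫ ^ 8 ∂(halfGaussian ι) ≤ 152 := by
    calc _ ≤ ∫ x, 76 * Real.exp (3 / 4 * ⟪x, u⟫ ^ 2) ∂(halfGaussian ι) :=
          integral_mono (integrable_inner_pow_eight u) ((integrable_exp_sq_inner hu).const_mul 76)
            fun x => pow_eight_le_exp _
      _ = 152 := by rw [integral_const_mul, integral_exp_sq_inner hu]; norm_num
  conv_lhs => rw [huv]
  simp_rw [real_inner_smul_right, mul_pow]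
  rw [integral_const_mul]
  have h8 : ‖v‖ ^ 8 ≤ 4 ^ 8 := pow_le_pow_left₀ (norm_nonneg _) hv4 8
  calc _ ≤ (4 : ℝ) ^ 8 * 152 := mul_le_mul h8 h (integral_nonneg fun x => by positivity)
        (by positivity)
    _ ≤ _ := by norm_num

theorem integrable_inner_sq (v : EuclideanSpace ℝ ι) :
    Integrable (fun x => ⟪x, v⟫ ^ 2) (halfGaussian ι) := by
  refine ((integrable_const (1 : ℝ)).add (integrable_inner_pow_four v)).mono' (by fun_prop)
    (ae_of_all _ fun x => ?_)
  rw [Real.norm_of_nonneg (by positivity)]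
  simp only [Pi.add_apply]
  nlinarith [sq_nonneg (⟪x, v⟫ ^ 2 - 1)]

theorem integral_inner_sq (v : EuclideanSpace ℝ ι) :
    ∫ x, ⟪x, v⟫ ^ 2 ∂(halfGaussian ι) = 1 / 2 * ‖v‖ ^ 2 := by
  rcases eq_or_ne v 0 with rfl | hv
  · simp
  obtain ⟨u, hu, huv⟩ := exists_unit_smul hv
  have h : ∫ x, ⟪x, u⟫ ^ 2 ∂(halfGaussian ι) = 1 / 2 := by
    rw [← integral_sq_gaussianReal]
    exact (hasLaw_inner_halfGaussian hu).integral_comp (f := fun t => t ^ 2) (by fun_prop)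
  conv_lhs => rw [huv]
  simp_rw [real_inner_smul_right, mul_pow]
  rw [integral_const_mul, h]
  ring

theorem integrable_inner_mul_four (a c d e : EuclideanSpace ℝ ι) :
    Integrable (fun x => ⟪x, a⟫ * ⟪x, c⟫ * (⟪x, d⟫ * ⟪x, e⟫)) (halfGaussian ι) := by
  refine (((integrable_inner_pow_four a).add (integrable_inner_pow_four c)).add
    ((integrable_inner_pow_four d).add (integrable_inner_pow_four e))).mono' (by fun_prop)
    (ae_of_all _ fun x => ?_)
  simp only [Pi.add_apply, Real.norm_eq_abs]
  generalize ⟪x, a⟫ = a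
  generalize ⟪x, c⟫ = c
  generalize ⟪x, d⟫ = d
  generalize ⟪x, e⟫ = e
  rw [abs_le]
  constructor <;> nlinarith [sq_nonneg (a * c + d * e), sq_nonneg (a * c - d * e),
    sq_nonneg (a ^ 2 - c ^ 2), sq_nonneg (d ^ 2 - e ^ 2), sq_nonneg (a ^ 2), sq_nonneg (c ^ 2),
    sq_nonneg (d ^ 2), sq_nonneg (e ^ 2)]

theorem integrable_inner_sq_mul_inner_sq (a c : EuclideanSpace ℝ ι) :
    Integrable (fun x => ⟪x, a⟫ ^ 2 * ⟪x, c⟫ ^ 2) (halfGaussian ι) := by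
  simpa only [sq] using integrable_inner_mul_four a a c c

/-- Polarization, 12a²c² = (a + c)⁴ + (a - c)⁴ - 2a⁴ - 2c⁴, reduces this to pure fourth powers. -/
theorem integral_inner_sq_mul_inner_sq (a c : EuclideanSpace ℝ ι) :
    ∫ x, ⟪x, a⟫ ^ 2 * ⟪x, c⟫ ^ 2 ∂(halfGaussian ι) =
      (‖a‖ ^ 2 * ‖c‖ ^ 2 + 2 * ⟪a, c⟫ ^ 2) / 4 := by
  have h : ∀ x : EuclideanSpace ℝ ι, ⟪x, a⟫ ^ 2 * ⟪x, c⟫ ^ 2 =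
      1 / 12 * ((⟪x, a + c⟫ ^ 4 + ⟪x, a - c⟫ ^ 4) - 2 * (⟪x, a⟫ ^ 4 + ⟪x, c⟫ ^ 4)) := fun x => by
    rw [inner_add_right, inner_sub_right]; ring
  simp_rw [h]
  rw [integral_const_mul, integral_sub, integral_add, integral_const_mul, integral_add]
  · simp only [integral_inner_pow_four]
    have e1 : ‖a + c‖ ^ 4 = (‖a‖ ^ 2 + 2 * ⟪a, c⟫ + ‖c‖ ^ 2) ^ 2 := by
      rw [← norm_add_sq_real]; ring
    have e2 : ‖a - c‖ ^ 4 = (‖a‖ ^ 2 - 2 * ⟪a, c⟫ + ‖c‖ ^ 2) ^ 2 := by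
      rw [← norm_sub_sq_real]; ring
    rw [e1, e2]
    ring
  · exact integrable_inner_pow_four _
  · exact integrable_inner_pow_four _
  · exact integrable_inner_pow_four _
  · exact integrable_inner_pow_four _
  · exact (integrable_inner_pow_four _).add (integrable_inner_pow_four _)
  · exact ((integrable_inner_pow_four _).add (integrable_inner_pow_four _)).const_mul _

/-- The fourth order moments of a Gaussian vector (Isserlis' formula). -/
theorem integral_inner_mul_four (a c d e : EuclideanSpace ℝ ι) :
    ∫ x, ⟪x, a⟫ * ⟪x, c⟫ * (⟪x, d⟫ * ⟪x, e⟫) ∂(halfGaussian ι) =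
      (⟪a, c⟫ * ⟪d, e⟫ + ⟪a, d⟫ * ⟪c, e⟫ + ⟪a, e⟫ * ⟪c, d⟫) / 4 := by
  -- A second polarization, 4st = (s + t)² - (s - t)², in each of the two products.
  have h : ∀ x : EuclideanSpace ℝ ι, ⟪x, a⟫ * ⟪x, c⟫ * (⟪x, d⟫ * ⟪x, e⟫) =
      1 / 16 * ((⟪x, a + c⟫ ^ 2 * ⟪x, d + e⟫ ^ 2 - ⟪x, a + c⟫ ^ 2 * ⟪x, d - e⟫ ^ 2) -
        (⟪x, a - c⟫ ^ 2 * ⟪x, d + e⟫ ^ 2 - ⟪x, a - c⟫ ^ 2 * ⟪x, d - e⟫ ^ 2)) := fun x => by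
    simp only [inner_add_right, inner_sub_right]; ring
  have hi := fun a c : EuclideanSpace ℝ ι => integrable_inner_sq_mul_inner_sq a c
  simp_rw [h]
  rw [integral_const_mul, integral_sub, integral_sub, integral_sub]
  · simp only [integral_inner_sq_mul_inner_sq]
    simp only [norm_add_sq_real, norm_sub_sq_real, inner_add_left,
      inner_add_right, inner_sub_left, inner_sub_right]
    ring
  · exact hi _ _
  · exact hi _ _
  · exact hi _ _
  · exact hi _ _
  · exact (hi _ _).sub (hi _ _)
  · exact (hi _ _).sub (hi _ _)

theorem integrable_sq_sum_inner_mul (x y : Fin 2 → EuclideanSpace ℝ ι) :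
    Integrable (fun b => (∑ j, ⟪b, x j⟫ * ⟪b, y j⟫) ^ 2) (halfGaussian ι) := by
  simp_rw [sq, Finset.sum_mul_sum]
  exact integrable_finsetSum _ fun j _ => integrable_finsetSum _ fun k _ =>
    integrable_inner_mul_four _ _ _ _

theorem integral_sq_sum_inner_mul (x y : Fin 2 → EuclideanSpace ℝ ι) :
    ∫ b, (∑ j, ⟪b, x j⟫ * ⟪b, y j⟫) ^ 2 ∂(halfGaussian ι) =
      (∑ j, ∑ k, (⟪x j, y j⟫ * ⟪x k, y k⟫ + ⟪x j, x k⟫ * ⟪y j, y k⟫ +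
        ⟪x j, y k⟫ * ⟪y j, x k⟫)) / 4 := by
  simp_rw [sq, Finset.sum_mul_sum]
  rw [integral_finsetSum _ fun j _ => integrable_finsetSum _ fun k _ =>
    integrable_inner_mul_four _ _ _ _, Finset.sum_div]
  refine Finset.sum_congr rfl fun j _ => ?_
  rw [integral_finsetSum _ fun k _ => integrable_inner_mul_four _ _ _ _, Finset.sum_div]
  exact Finset.sum_congr rfl fun k _ => integral_inner_mul_four _ _ _ _

theorem pow_four_sum_inner_mul_le (x y : Fin 2 → EuclideanSpace ℝ ι) (b : EuclideanSpace ℝ ι) :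
    (∑ j, ⟪b, x j⟫ * ⟪b, y j⟫) ^ 4 ≤
      4 * ∑ j, (⟪b, x j⟫ ^ 8 + ⟪b, y j⟫ ^ 8) := by
  simp only [Fin.sum_univ_two]
  have h1 : ∀ s t : ℝ, (s + t) ^ 4 ≤ 8 * (s ^ 4 + t ^ 4) := fun s t => by
    nlinarith [sq_nonneg (s ^ 2 - t ^ 2), sq_nonneg (s - t), sq_nonneg ((s - t) * (s + t)),
      sq_nonneg ((s - t) ^ 2)]
  have h2 : ∀ s t : ℝ, (s * t) ^ 4 ≤ (s ^ 8 + t ^ 8) / 2 := fun s t => by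
    nlinarith [sq_nonneg (s ^ 4 - t ^ 4)]
  refine (h1 _ _).trans ?_
  linarith [h2 ⟪b, x 0⟫ ⟪b, y 0⟫, h2 ⟪b, x 1⟫ ⟪b, y 1⟫]

theorem integrable_pow_four_sum_inner_mul (x y : Fin 2 → EuclideanSpace ℝ ι) :
    Integrable (fun b => (∑ j, ⟪b, x j⟫ * ⟪b, y j⟫) ^ 4) (halfGaussian ι) := by
  refine ((integrable_finsetSum Finset.univ fun j _ => (integrable_inner_pow_eight (x j)).add
    (integrable_inner_pow_eight (y j))).const_mul 4).mono' (by fun_prop) (ae_of_all _ fun b => ?_)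
  rw [Real.norm_of_nonneg (by positivity)]
  simpa using pow_four_sum_inner_mul_le x y b

theorem integral_pow_four_sum_inner_mul_le {x y : Fin 2 → EuclideanSpace ℝ ι}
    (hx : ∀ j, ‖x j‖ ≤ 4) (hy : ∀ j, ‖y j‖ ≤ 4) :
    ∫ b, (∑ j, ⟪b, x j⟫ * ⟪b, y j⟫) ^ 4 ∂(halfGaussian ι) ≤ 160000000 := by
  have hi : ∀ j, Integrable (fun b => ⟪b, x j⟫ ^ 8 + ⟪b, y j⟫ ^ 8) (halfGaussian ι) :=
    fun j => (integrable_inner_pow_eight (x j)).add (integrable_inner_pow_eight (y j))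
  have h1 : ∀ j, ∫ b, (⟪b, x j⟫ ^ 8 + ⟪b, y j⟫ ^ 8) ∂(halfGaussian ι) ≤ 20000000 := fun j => by
    rw [integral_add (integrable_inner_pow_eight _) (integrable_inner_pow_eight _)]
    linarith [integral_inner_pow_eight_le (hx j), integral_inner_pow_eight_le (hy j)]
  have h2 := integral_mono (integrable_pow_four_sum_inner_mul x y)
    ((integrable_finsetSum Finset.univ fun j _ => hi j).const_mul 4)
    (fun b => pow_four_sum_inner_mul_le x y b)
  rw [integral_const_mul, integral_finsetSum _ fun j _ => hi j, Fin.sum_univ_two] at h2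
  linarith [h1 0, h1 1]

/-! ### Chernoff bounds for sums of independent nonnegative variables. -/

section Chernoff

variable {Ω 𝓧 : Type*} [MeasurableSpace Ω] [MeasurableSpace 𝓧] {P : Measure Ω}
  [IsProbabilityMeasure P] {ν : Measure 𝓧} [IsProbabilityMeasure ν] {m : ℕ} {b : Fin m → Ω → 𝓧}

theorem mgf_sum_comp_eq_pow (hb : ∀ i, HasLaw (b i) ν P) (hind : iIndepFun b P) {X : 𝓧 → ℝ}
    (hX : Measurable X) (t : ℝ) :
    mgf (fun ω => ∑ i, X (b i ω)) P t = mgf X ν t ^ m := by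
  have h := (hind.comp (fun _ => X) fun _ => hX).mgf_sum₀ (t := t)
    (fun i => hX.comp_aemeasurable (hb i).aemeasurable) Finset.univ
  have h1 : (∑ i, X ∘ b i) = fun ω => ∑ i, X (b i ω) := by ext; simp
  have h2 : ∀ i, mgf (X ∘ b i) P t = mgf X ν t := fun i => by
    rw [← (hb i).map_eq, mgf_map (hb i).aemeasurable (by fun_prop)]
  simp only [h1, h2, Finset.prod_const, Finset.card_univ, Fintype.card_fin] at h
  exact h

theorem integrable_exp_mul_sum_comp (hb : ∀ i, HasLaw (b i) ν P) (hind : iIndepFun b P)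
    {X : 𝓧 → ℝ} (hX : Measurable X) {t : ℝ} (ht : Integrable (fun x => Real.exp (t * X x)) ν) :
    Integrable (fun ω => Real.exp (t * ∑ i, X (b i ω))) P := by
  by_contra h
  have h1 : mgf (fun ω => ∑ i, X (b i ω)) P t = 0 := integral_undef h
  rw [mgf_sum_comp_eq_pow hb hind hX] at h1
  exact absurd h1 (pow_pos (mgf_pos ht) m).ne'

/-- With the exponential kept in the remainder, the upper tail requires control of ∫ X² exp(sX) at
one value of s only. -/
theorem exp_le_one_add_add_sq_mul_exp {x : ℝ} (hx : 0 ≤ x) :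
    Real.exp x ≤ 1 + x + x ^ 2 * Real.exp x := by
  have h := Real.add_one_le_exp (-x)
  have h2 : Real.exp (-x) * Real.exp x = 1 := by rw [← Real.exp_add]; simp
  have h3 := Real.exp_pos x
  nlinarith [mul_le_mul_of_nonneg_right h (mul_nonneg (by linarith : 0 ≤ 1 + x) h3.le)]

/-- For the lower tail of a nonnegative variable no exponential remains, so a second moment
suffices. -/
theorem exp_neg_le_one_sub_add_sq {x : ℝ} (hx : 0 ≤ x) : Real.exp (-x) ≤ 1 - x + x ^ 2 := by
  have h := Real.add_one_le_exp x
  have h2 : Real.exp (-x) * Real.exp x = 1 := by rw [← Real.exp_add]; simp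
  have h3 := Real.exp_pos (-x)
  have h4 : Real.exp (-x) * (1 + x) ≤ 1 := by nlinarith
  have h5 : 0 < 1 - x + x ^ 2 := by nlinarith [sq_nonneg (x - 1)]
  have h6 : 1 ≤ (1 - x + x ^ 2) * (1 + x) := by nlinarith [pow_nonneg hx 3]
  exact le_of_mul_le_mul_right (h4.trans h6) (by linarith : 0 < 1 + x)

theorem pow_le_exp_mul {a c : ℝ} (ha : 0 ≤ a) (h : a ≤ 1 + c) : a ^ m ≤ Real.exp (m * c) := by
  rw [Real.exp_nat_mul]
  refine pow_le_pow_left₀ ha (h.trans ?_) m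
  rw [add_comm]
  exact Real.add_one_le_exp c

/-- An upper tail bound for sums of independent nonnegative variables. -/
theorem measureReal_le_sum_comp_le (hb : ∀ i, HasLaw (b i) ν P) (hind : iIndepFun b P) {X : 𝓧 → ℝ}
    (hX : Measurable X) (h0 : ∀ x, 0 ≤ X x) {s K μ₀ ε : ℝ} (hs : 0 ≤ s)
    (hint : Integrable (fun x => X x ^ 2 * Real.exp (s * X x)) ν)
    (hK : ∫ x, X x ^ 2 * Real.exp (s * X x) ∂ν ≤ K) (hμ : ∫ x, X x ∂ν ≤ μ₀) :
    P.real {ω | m * (μ₀ + ε) ≤ ∑ i, X (b i ω)} ≤ Real.exp (-(m * (s * (ε - K * s)))) := by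
  have hXint : Integrable X ν := by
    refine ((integrable_const (1 : ℝ)).add hint).mono' (by fun_prop) (ae_of_all _ fun x => ?_)
    rw [Real.norm_of_nonneg (h0 x)]
    have h1 := Real.one_le_exp (mul_nonneg hs (h0 x))
    simp only [Pi.add_apply]
    nlinarith [mul_le_mul_of_nonneg_left h1 (sq_nonneg (X x)), sq_nonneg (X x - 1)]
  have hle : ∀ x, Real.exp (s * X x) ≤
      1 + s * X x + s ^ 2 * (X x ^ 2 * Real.exp (s * X x)) := fun x => by
    have := exp_le_one_add_add_sq_mul_exp (mul_nonneg hs (h0 x))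
    linarith [mul_pow s (X x) 2]
  have hint1 : Integrable (fun x => 1 + s * X x) ν :=
    (integrable_const _).add (hXint.const_mul s)
  have hint2 : Integrable (fun x => 1 + s * X x + s ^ 2 * (X x ^ 2 * Real.exp (s * X x))) ν :=
    hint1.add (hint.const_mul _)
  have hexp : Integrable (fun x => Real.exp (s * X x)) ν := by
    refine hint2.mono' (by fun_prop) (ae_of_all _ fun x => ?_)
    rw [Real.norm_of_nonneg (Real.exp_pos _).le]
    exact hle x
  have hmgf : mgf X ν s ≤ 1 + (s * μ₀ + s ^ 2 * K) := by
    refine (integral_mono hexp hint2 hle).trans ?_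
    rw [integral_add hint1 (hint.const_mul _),
      integral_add (integrable_const _) (hXint.const_mul s), integral_const_mul,
      integral_const_mul]
    simp only [integral_const, probReal_univ, smul_eq_mul, mul_one]
    have := mul_le_mul_of_nonneg_left hμ hs
    have := mul_le_mul_of_nonneg_left hK (sq_nonneg s)
    linarith
  refine (measure_ge_le_exp_mul_mgf _ hs (integrable_exp_mul_sum_comp hb hind hX hexp)).trans ?_
  rw [mgf_sum_comp_eq_pow hb hind hX]
  refine (mul_le_mul_of_nonneg_left (pow_le_exp_mul mgf_nonneg hmgf)
    (Real.exp_pos _).le).trans ?_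
  rw [← Real.exp_add]
  exact Real.exp_le_exp.2 (le_of_eq (by ring))

/-- A lower tail bound for sums of independent nonnegative variables. -/
theorem measureReal_sum_comp_le_le (hb : ∀ i, HasLaw (b i) ν P) (hind : iIndepFun b P) {X : 𝓧 → ℝ}
    (hX : Measurable X) (h0 : ∀ x, 0 ≤ X x) {s K ε : ℝ} (hs : 0 ≤ s)
    (hint : Integrable (fun x => X x ^ 2) ν) (hK : ∫ x, X x ^ 2 ∂ν ≤ K) :
    P.real {ω | ∑ i, X (b i ω) ≤ m * (∫ x, X x ∂ν - ε)} ≤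
      Real.exp (-(m * (s * (ε - K * s)))) := by
  have hXint : Integrable X ν := by
    refine ((integrable_const (1 : ℝ)).add hint).mono' (by fun_prop) (ae_of_all _ fun x => ?_)
    rw [Real.norm_of_nonneg (h0 x)]
    simp only [Pi.add_apply]
    nlinarith [sq_nonneg (X x - 1)]
  have hle : ∀ x, Real.exp (-s * X x) ≤ 1 - s * X x + s ^ 2 * X x ^ 2 := fun x => by
    have := exp_neg_le_one_sub_add_sq (mul_nonneg hs (h0 x))
    rw [neg_mul]
    linarith [mul_pow s (X x) 2]
  have hint1 : Integrable (fun x => 1 - s * X x) ν :=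
    (integrable_const _).sub (hXint.const_mul s)
  have hint2 : Integrable (fun x => 1 - s * X x + s ^ 2 * X x ^ 2) ν :=
    hint1.add (hint.const_mul _)
  have hexp : Integrable (fun x => Real.exp (-s * X x)) ν := by
    refine hint2.mono' (by fun_prop) (ae_of_all _ fun x => ?_)
    rw [Real.norm_of_nonneg (Real.exp_pos _).le]
    exact hle x
  have hmgf : mgf X ν (-s) ≤ 1 + (-s * ∫ x, X x ∂ν + s ^ 2 * K) := by
    refine (integral_mono hexp hint2 hle).trans ?_
    rw [integral_add hint1 (hint.const_mul _),
      integral_sub (integrable_const _) (hXint.const_mul s), integral_const_mul,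
      integral_const_mul]
    simp only [integral_const, probReal_univ, smul_eq_mul, mul_one]
    have := mul_le_mul_of_nonneg_left hK (sq_nonneg s)
    linarith
  refine (measure_le_le_exp_mul_mgf _ (neg_nonpos.2 hs)
    (integrable_exp_mul_sum_comp hb hind hX hexp)).trans ?_
  rw [mgf_sum_comp_eq_pow hb hind hX]
  refine (mul_le_mul_of_nonneg_left (pow_le_exp_mul mgf_nonneg hmgf)
    (Real.exp_pos _).le).trans ?_
  rw [← Real.exp_add]
  exact Real.exp_le_exp.2 (le_of_eq (by ring))

end Chernoff

/-! ### Nets in finite-dimensional normed spaces by volume comparison. -/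

section Net

variable {F : Type*} [NormedAddCommGroup F] [NormedSpace ℝ F] [FiniteDimensional ℝ F]

open Metric Module in
theorem card_le_of_separated {R η : ℝ} (hη : 0 < η) (hR : 0 ≤ R) (s : Finset F)
    (hs : ∀ c ∈ s, ‖c‖ ≤ R) (h : ∀ c ∈ s, ∀ d ∈ s, c ≠ d → η ≤ ‖c - d‖) :
    (s.card : ℝ) ≤ (1 + 2 * R / η) ^ finrank ℝ F := by
  borelize F
  let μ : Measure F := Measure.addHaar
  have hδ : 0 < η / 2 := by positivity
  have hρ : 0 < R + η / 2 := by positivity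
  set A := ⋃ c ∈ s, ball (c : F) (η / 2) with hA
  have D : Set.Pairwise (s : Set F) (Function.onFun Disjoint fun c => ball (c : F) (η / 2)) := by
    rintro c hc d hd hcd
    apply ball_disjoint_ball
    rw [dist_eq_norm, add_halves]
    exact h c hc d hd hcd
  have A_subset : A ⊆ ball (0 : F) (R + η / 2) := by
    refine Set.iUnion₂_subset fun x hx => ball_subset_ball' ?_
    rw [dist_zero_right, add_comm]
    exact add_le_add (hs x hx) le_rfl
  have I : (s.card : ENNReal) * ENNReal.ofReal ((η / 2) ^ finrank ℝ F) * μ (ball 0 1) ≤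
      ENNReal.ofReal ((R + η / 2) ^ finrank ℝ F) * μ (ball 0 1) :=
    calc
      _ = μ A := by
        rw [hA, measure_biUnion_finset D fun c _ => measurableSet_ball]
        simp only [μ.addHaar_ball_of_pos _ hδ]
        simp only [Finset.sum_const, nsmul_eq_mul, mul_assoc]
      _ ≤ μ (ball (0 : F) (R + η / 2)) := measure_mono A_subset
      _ = _ := by simp only [μ.addHaar_ball_of_pos _ hρ]
  have J : (s.card : ENNReal) * ENNReal.ofReal ((η / 2) ^ finrank ℝ F) ≤
      ENNReal.ofReal ((R + η / 2) ^ finrank ℝ F) :=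
    (ENNReal.mul_le_mul_iff_left (measure_ball_pos _ _ zero_lt_one).ne' measure_ball_lt_top.ne).1 I
  have K := ENNReal.toReal_le_of_le_ofReal (pow_nonneg hρ.le _) J
  rw [ENNReal.toReal_mul, ENNReal.toReal_natCast, ENNReal.toReal_ofReal (by positivity)] at K
  rw [show 1 + 2 * R / η = (R + η / 2) / (η / 2) by field_simp; ring, div_pow,
    le_div_iff₀ (by positivity)]
  exact K

/-- A bounded subset of a finite-dimensional normed space has a small net of its own points. -/
theorem exists_finset_net {R η : ℝ} (hη : 0 < η) (hR : 0 ≤ R) (S : Set F)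
    (hS : ∀ x ∈ S, ‖x‖ ≤ R) : ∃ N : Finset F, (∀ x ∈ N, x ∈ S) ∧
      (∀ x ∈ S, ∃ y ∈ N, ‖x - y‖ ≤ η) ∧
      (N.card : ℝ) ≤ (1 + 2 * R / η) ^ Module.finrank ℝ F := by
  classical
  -- The sizes of the η-separated subsets of S are bounded by the volume bound; a separated set of
  -- maximal size is an η-net.
  let T : Set ℕ := {k | ∃ N : Finset F, (∀ x ∈ N, x ∈ S) ∧
    (∀ c ∈ N, ∀ d ∈ N, c ≠ d → η ≤ ‖c - d‖) ∧ N.card = k}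
  have hbound : ∀ N : Finset F, (∀ x ∈ N, x ∈ S) → (∀ c ∈ N, ∀ d ∈ N, c ≠ d → η ≤ ‖c - d‖) →
      (N.card : ℝ) ≤ (1 + 2 * R / η) ^ Module.finrank ℝ F := fun N h1 h2 =>
    card_le_of_separated hη hR N (fun c hc => hS c (h1 c hc)) h2
  have hbdd : BddAbove T := by
    refine ⟨⌊(1 + 2 * R / η) ^ Module.finrank ℝ F⌋₊, ?_⟩
    rintro _ ⟨N, h1, h2, rfl⟩
    exact Nat.le_floor (hbound N h1 h2)
  obtain ⟨N, h1, h2, h3⟩ := Nat.sSup_mem (s := T) ⟨0, ∅, by simp, by simp, by simp⟩ hbdd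
  refine ⟨N, h1, fun x hx => ?_, hbound N h1 h2⟩
  by_contra! hcon
  have hxN : x ∉ N := fun hxN => by
    have := hcon x hxN
    simp at this
    linarith
  have hmem : N.card + 1 ∈ T := by
    refine ⟨insert x N, ?_, ?_, Finset.card_insert_of_notMem hxN⟩
    · intro y hy
      rcases Finset.mem_insert.1 hy with rfl | hy
      · exact hx
      · exact h1 y hy
    · intro c hc d hd hcd
      rcases Finset.mem_insert.1 hc with hc' | hc' <;> rcases Finset.mem_insert.1 hd with hd' | hd'
      · exact absurd (hc'.trans hd'.symm) hcd
      · rw [hc']; exact (hcon d hd').le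
      · rw [hd', norm_sub_rev]; exact (hcon c hc').le
      · exact h2 c hc' d hd' hcd
  have := le_csSup hbdd hmem
  omega

end Net

/-! ### Passing from a net to the whole sphere for quadratic forms. -/

section Deterministic

variable {κ : Type*} [Fintype κ]

theorem mul_add_sq_le (p q : ℝ) {t : ℝ} (ht : 0 < t) :
    (p + q) ^ 2 ≤ (1 + t) * p ^ 2 + (1 + 1 / t) * q ^ 2 := by
  have h : 0 ≤ (t * p - q) ^ 2 / t := by positivity
  have e : (1 + t) * p ^ 2 + (1 + 1 / t) * q ^ 2 - (p + q) ^ 2 = (t * p - q) ^ 2 / t := by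
    field_simp
    ring
  linarith

theorem sum_mul_inner_sq_le {c : κ → ℝ} (hc : ∀ i, 0 ≤ c i) (β : κ → EuclideanSpace ℝ ι)
    (v w : EuclideanSpace ℝ ι) {t : ℝ} (ht : 0 < t) :
    ∑ i, c i * ⟪β i, v⟫ ^ 2 ≤ (1 + t) * ∑ i, c i * ⟪β i, w⟫ ^ 2 +
      (1 + 1 / t) * ∑ i, c i * ⟪β i, v - w⟫ ^ 2 := by
  rw [Finset.mul_sum, Finset.mul_sum, ← Finset.sum_add_distrib]
  refine Finset.sum_le_sum fun i _ => ?_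
  have h := mul_le_mul_of_nonneg_left (mul_add_sq_le ⟪β i, w⟫ ⟪β i, v - w⟫ ht) (hc i)
  rw [← inner_add_right, add_sub_cancel] at h
  linarith

/-- A bound for a weighted sum of squares on a net of the sphere extends to the sphere. -/
theorem sum_mul_inner_sq_le_of_net {c : κ → ℝ} (hc : ∀ i, 0 ≤ c i) (β : κ → EuclideanSpace ℝ ι)
    (a : EuclideanSpace ℝ ι) (ha : ‖a‖ = 1) {q₁ q₂ ε η : ℝ} (hq₁ : 0 ≤ q₁) (hq₂ : 0 ≤ q₂)
    (hq : q₁ + q₂ ≤ 1) (hε : 0 < ε) (hε1 : ε ≤ 1) (hη : η = ε / 20)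
    {N : Finset (EuclideanSpace ℝ ι)} (hN1 : ∀ x ∈ N, ‖x‖ = 1)
    (hN : ∀ x : EuclideanSpace ℝ ι, ‖x‖ = 1 → ∃ y ∈ N, ‖x - y‖ ≤ η)
    (h : ∀ v ∈ N, ∑ i, c i * ⟪β i, v⟫ ^ 2 ≤ q₁ * ‖v‖ ^ 2 + q₂ * ⟪a, v⟫ ^ 2 + ε)
    (v : EuclideanSpace ℝ ι) :
    ∑ i, c i * ⟪β i, v⟫ ^ 2 ≤ q₁ * ‖v‖ ^ 2 + q₂ * ⟪a, v⟫ ^ 2 + 2 * ε * ‖v‖ ^ 2 := by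
  have hη0 : 0 < η := by rw [hη]; positivity
  have hη1 : η ≤ 1 / 20 := by rw [hη]; linarith
  set Q : EuclideanSpace ℝ ι → ℝ := fun v => ∑ i, c i * ⟪β i, v⟫ ^ 2 with hQ
  have hscale : ∀ (t : ℝ) v, Q (t • v) = t ^ 2 * Q v := fun t v => by
    simp only [hQ, real_inner_smul_right, mul_pow, Finset.mul_sum]
    exact Finset.sum_congr rfl fun i _ => by ring
  have hai : ∀ v : EuclideanSpace ℝ ι, ⟪a, v⟫ ^ 2 ≤ ‖v‖ ^ 2 := fun v => by
    have := abs_real_inner_le_norm a v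
    rw [ha, one_mul] at this
    rw [← sq_abs]
    exact pow_le_pow_left₀ (abs_nonneg _) this 2
  have hcont : Continuous Q := by fun_prop
  have hunit : ∀ u : EuclideanSpace ℝ ι, ‖u‖ = 1 → Q u ≤ q₁ + q₂ * ⟪a, u⟫ ^ 2 + 2 * ε := by
    intro u hu
    obtain ⟨p, hp, hmax⟩ := (isCompact_sphere (0 : EuclideanSpace ℝ ι) 1).exists_isMaxOn
      ⟨u, by simpa using hu⟩ hcont.continuousOn
    have hp1 : ‖p‖ = 1 := by simpa using hp
    set S := Q p with hS
    have hSall : ∀ x, Q x ≤ S * ‖x‖ ^ 2 := fun x => by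
      rcases eq_or_ne x 0 with rfl | hx
      · simp [hQ]
      · obtain ⟨y, hy, hxy⟩ := exists_unit_smul hx
        rw [hxy, hscale, norm_smul, hy, mul_one, norm_norm, mul_comm]
        exact mul_le_mul_of_nonneg_right (hmax (by simpa using hy)) (sq_nonneg _)
    have hS0 : 0 ≤ S := Finset.sum_nonneg fun i _ => mul_nonneg (hc i) (sq_nonneg _)
    have hnear : ∀ x y : EuclideanSpace ℝ ι, ‖x - y‖ ≤ η → Q (x - y) ≤ S * η ^ 2 := fun x y hxy =>
      (hSall _).trans (mul_le_mul_of_nonneg_left (pow_le_pow_left₀ (norm_nonneg _) hxy 2) hS0)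
    have hNle : ∀ y ∈ N, Q y ≤ q₁ + q₂ * ⟪a, y⟫ ^ 2 + ε := fun y hy => by
      have := h y hy
      rw [hN1 y hy] at this
      simpa using this
    -- A crude first pass with weight t = 1 gives S ≤ 4 + S/200, hence a bound for the maximum S.
    -- The second pass below uses t = η, and S ≤ 8 makes its error of order η.
    have hS8 : S ≤ 8 := by
      obtain ⟨y, hy, hpy⟩ := hN p hp1
      have h1 := sum_mul_inner_sq_le hc β p y one_pos
      have h2 := hnear p y hpy
      have h3 := hNle y hy
      have h4 := hai y
      rw [hN1 y hy] at h4
      change S ≤ (1 + 1) * Q y + (1 + 1 / 1) * Q (p - y) at h1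
      have h5 : η ^ 2 ≤ 1 / 400 := by nlinarith
      nlinarith [mul_le_mul_of_nonneg_left h4 hq₂, mul_le_mul_of_nonneg_left h5 hS0]
    obtain ⟨y, hy, huy⟩ := hN u hu
    have h1 := sum_mul_inner_sq_le hc β u y hη0
    change Q u ≤ (1 + η) * Q y + (1 + 1 / η) * Q (u - y) at h1
    have h2 : (1 + 1 / η) * Q (u - y) ≤ 8 * (1 + η) * η := by
      calc (1 + 1 / η) * Q (u - y) ≤ (1 + 1 / η) * (8 * η ^ 2) := by
            refine mul_le_mul_of_nonneg_left ((hnear u y huy).trans ?_) (by positivity)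
            exact mul_le_mul_of_nonneg_right hS8 (sq_nonneg η)
        _ = 8 * (1 + η) * η := by field_simp; ring
    have h3 := hNle y hy
    have h4 : ⟪a, y⟫ ^ 2 ≤ (1 + η) * ⟪a, u⟫ ^ 2 + (1 + η) * η := by
      have h5 := mul_add_sq_le ⟪a, u⟫ ⟪a, y - u⟫ hη0
      rw [← inner_add_right, add_sub_cancel] at h5
      have h6 : (1 + 1 / η) * ⟪a, y - u⟫ ^ 2 ≤ (1 + η) * η := by
        calc (1 + 1 / η) * ⟪a, y - u⟫ ^ 2 ≤ (1 + 1 / η) * η ^ 2 := by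
              refine mul_le_mul_of_nonneg_left ((hai _).trans ?_) (by positivity)
              rw [norm_sub_rev]
              exact pow_le_pow_left₀ (norm_nonneg _) huy 2
          _ = (1 + η) * η := by field_simp; ring
      linarith
    have h7 := hai u
    rw [hu, one_pow] at h7
    have h8 : ⟪a, y⟫ ^ 2 ≤ ⟪a, u⟫ ^ 2 + 21 / 10 * η := by nlinarith
    have h9 : q₂ * ⟪a, y⟫ ^ 2 ≤ q₂ * ⟪a, u⟫ ^ 2 + 21 / 10 * η := by
      have := mul_le_mul_of_nonneg_left h8 hq₂
      nlinarith
    have h10 : q₂ * ⟪a, u⟫ ^ 2 ≤ q₂ := by nlinarith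
    have h11 : 0 ≤ q₂ * ⟪a, u⟫ ^ 2 := by positivity
    have h12 : Q u ≤ (1 + η) * (q₁ + (q₂ * ⟪a, u⟫ ^ 2 + 21 / 10 * η) + ε) + 8 * (1 + η) * η := by
      refine h1.trans (add_le_add (mul_le_mul_of_nonneg_left ?_ (by positivity)) h2)
      linarith
    have h13 : ε = 20 * η := by rw [hη]; ring
    rw [h13] at h12 ⊢
    generalize q₂ * ⟪a, u⟫ ^ 2 = T at *
    nlinarith
  rcases eq_or_ne v 0 with rfl | hv
  · simp
  obtain ⟨u, hu, huv⟩ := exists_unit_smul hv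
  have h1 := mul_le_mul_of_nonneg_left (hunit u hu) (sq_nonneg ‖v‖)
  rw [← hscale, ← huv] at h1
  have h2 : ⟪a, v⟫ ^ 2 = ‖v‖ ^ 2 * ⟪a, u⟫ ^ 2 := by
    conv_lhs => rw [huv, real_inner_smul_right, mul_pow]
  rw [h2]
  linarith

end Deterministic

/-! ### Uniform upper bounds for weighted quadratic forms with bounded weights. -/

section Uniform

variable {Ω : Type*} [MeasurableSpace Ω] {P : Measure Ω} [IsProbabilityMeasure P] {m : ℕ}
  {b : Fin m → Ω → EuclideanSpace ℝ ι}

/-- AM-GM separates α from β: the α part is at most 1 + α⁸, and the β part is β⁸ exp(β²/2)/2. The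
eighth power is absorbed by another exp(β²/4), where 3072 = 4! · 4⁴ / 2. -/
theorem weighted_exp_bound (α β : ℝ) : (1 + α ^ 4) * (β ^ 4 * Real.exp (1 / 4 * β ^ 2)) ≤
    1 + 76 * Real.exp (3 / 4 * α ^ 2) + 3072 * Real.exp (3 / 4 * β ^ 2) := by
  have h1 := pow_eight_le_exp α
  have h2 := Real.pow_div_factorial_le_exp (1 / 4 * β ^ 2) (by positivity) 4
  norm_num [Nat.factorial] at h2
  have h3 : (1 / 4 * β ^ 2) ^ 4 = 1 / 256 * β ^ 8 := by ring
  rw [h3] at h2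
  have h4 : Real.exp (3 / 4 * β ^ 2) =
      Real.exp (1 / 4 * β ^ 2) * Real.exp (1 / 4 * β ^ 2) * Real.exp (1 / 4 * β ^ 2) := by
    rw [← Real.exp_add, ← Real.exp_add]; congr 1; ring
  rw [h4]
  have h5 := Real.exp_pos (1 / 4 * β ^ 2)
  generalize Real.exp (1 / 4 * β ^ 2) = E at *
  have h6 : β ^ 8 * (E * E) ≤ 6144 * E * (E * E) :=
    mul_le_mul_of_nonneg_right (by linarith) (by positivity)
  nlinarith [sq_nonneg (1 + α ^ 4 - β ^ 4 * E), sq_nonneg (1 - α ^ 4)]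

/-- A pointwise tail bound for a truncated weighted sum of squares. -/
theorem measureReal_weighted_sum_le (hb : ∀ i, HasLaw (b i) (halfGaussian ι) P)
    (hind : iIndepFun b P) {w : EuclideanSpace ℝ ι → ℝ} (hw : Measurable w) (hw0 : ∀ x, 0 ≤ w x)
    {L : ℝ} (hL : 1 ≤ L) (hwL : ∀ x, w x ≤ L) {a v : EuclideanSpace ℝ ι} (ha : ‖a‖ = 1)
    (hv : ‖v‖ = 1) (hwa : ∀ x, w x ^ 2 ≤ 1 + ⟪x, a⟫ ^ 4) {q ε : ℝ}
    (hq : ∫ x, w x * ⟪x, v⟫ ^ 2 ∂(halfGaussian ι) ≤ q) (hε : 0 < ε) (hε1 : ε ≤ 1) :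
    P.real {ω | m * (q + ε) ≤ ∑ i, w (b i ω) * ⟪b i ω, v⟫ ^ 2} ≤
      Real.exp (-(m * (ε ^ 2 / (25200 * L)))) := by
  -- The second-moment integral is at most 1 + 76 · 2 + 3072 · 2 ≤ 6300, so this s makes 6300 * s
  -- equal to ε/2. Dividing by L keeps s * w below 1/4, as required by `weighted_exp_bound`.
  have hs0 : 0 ≤ ε / (12600 * L) := by positivity
  have hsL : ε / (12600 * L) * L ≤ 1 / 4 := by
    rw [div_mul_eq_mul_div, div_le_iff₀ (by positivity)]; nlinarith
  set s := ε / (12600 * L) with hs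
  have hdom : ∀ x : EuclideanSpace ℝ ι,
      (w x * ⟪x, v⟫ ^ 2) ^ 2 * Real.exp (s * (w x * ⟪x, v⟫ ^ 2)) ≤
      1 + 76 * Real.exp (3 / 4 * ⟪x, a⟫ ^ 2) + 3072 * Real.exp (3 / 4 * ⟪x, v⟫ ^ 2) := fun x => by
    refine le_trans ?_ (weighted_exp_bound ⟪x, a⟫ ⟪x, v⟫)
    have h1 : s * (w x * ⟪x, v⟫ ^ 2) ≤ 1 / 4 * ⟪x, v⟫ ^ 2 := by
      rw [← mul_assoc]
      refine mul_le_mul_of_nonneg_right ?_ (sq_nonneg _)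
      exact (mul_le_mul_of_nonneg_left (hwL x) hs0).trans hsL
    calc _ = w x ^ 2 * (⟪x, v⟫ ^ 4 * Real.exp (s * (w x * ⟪x, v⟫ ^ 2))) := by ring
      _ ≤ _ := mul_le_mul (hwa x) (mul_le_mul_of_nonneg_left (Real.exp_le_exp.2 h1)
        (by positivity)) (by positivity) (by positivity)
  have i1 : Integrable (fun x => 1 + 76 * Real.exp (3 / 4 * ⟪x, a⟫ ^ 2)) (halfGaussian ι) :=
    (integrable_const _).add ((integrable_exp_sq_inner ha).const_mul 76)
  have i2 : Integrable (fun x => 1 + 76 * Real.exp (3 / 4 * ⟪x, a⟫ ^ 2) +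
      3072 * Real.exp (3 / 4 * ⟪x, v⟫ ^ 2)) (halfGaussian ι) :=
    i1.add ((integrable_exp_sq_inner hv).const_mul 3072)
  have i3 : Integrable (fun x => (w x * ⟪x, v⟫ ^ 2) ^ 2 * Real.exp (s * (w x * ⟪x, v⟫ ^ 2)))
      (halfGaussian ι) := by
    refine i2.mono' (by fun_prop) (ae_of_all _ fun x => ?_)
    rw [Real.norm_of_nonneg (by positivity)]
    exact hdom x
  have hK : ∫ x, (w x * ⟪x, v⟫ ^ 2) ^ 2 * Real.exp (s * (w x * ⟪x, v⟫ ^ 2)) ∂(halfGaussian ι) ≤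
      6300 := by
    refine (integral_mono i3 i2 hdom).trans ?_
    rw [integral_add i1 ((integrable_exp_sq_inner hv).const_mul 3072),
      integral_add (integrable_const _) ((integrable_exp_sq_inner ha).const_mul 76),
      integral_const_mul, integral_const_mul, integral_exp_sq_inner ha, integral_exp_sq_inner hv]
    simp
    norm_num
  refine (measureReal_le_sum_comp_le hb hind (X := fun x => w x * ⟪x, v⟫ ^ 2) (by fun_prop)
    (fun x => mul_nonneg (hw0 x) (sq_nonneg _)) hs0 i3 hK hq (ε := ε)).trans ?_
  refine Real.exp_le_exp.2 (neg_le_neg (mul_le_mul_of_nonneg_left ?_ (Nat.cast_nonneg m)))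
  have h1 : 6300 * s ≤ ε / 2 := by
    rw [hs, mul_div_assoc', div_le_iff₀ (by positivity)]; nlinarith
  calc ε ^ 2 / (25200 * L) = s * (ε / 2) := by rw [hs]; field_simp; ring
    _ ≤ _ := mul_le_mul_of_nonneg_left (by linarith) hs0

/-- A uniform upper bound for a truncated weighted sum of squares. -/
theorem measureReal_not_forall_weighted_le (hm : 0 < m)
    (hb : ∀ i, HasLaw (b i) (halfGaussian ι) P)
    (hind : iIndepFun b P) {w : EuclideanSpace ℝ ι → ℝ} (hw : Measurable w) (hw0 : ∀ x, 0 ≤ w x)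
    {L : ℝ} (hL : 1 ≤ L) (hwL : ∀ x, w x ≤ L) {a : EuclideanSpace ℝ ι} (ha : ‖a‖ = 1)
    (hwa : ∀ x, w x ^ 2 ≤ 1 + ⟪x, a⟫ ^ 4) {q₁ q₂ ε : ℝ} (hq₁ : 0 ≤ q₁) (hq₂ : 0 ≤ q₂)
    (hq12 : q₁ + q₂ ≤ 1) (hq : ∀ v : EuclideanSpace ℝ ι, ‖v‖ = 1 →
      ∫ x, w x * ⟪x, v⟫ ^ 2 ∂(halfGaussian ι) ≤ q₁ * ‖v‖ ^ 2 + q₂ * ⟪a, v⟫ ^ 2)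
    (hε : 0 < ε) (hε1 : ε ≤ 1) :
    P.real {ω | ¬ ∀ v : EuclideanSpace ℝ ι, (∑ i, w (b i ω) * ⟪b i ω, v⟫ ^ 2) / m ≤
      q₁ * ‖v‖ ^ 2 + q₂ * ⟪a, v⟫ ^ 2 + 2 * ε * ‖v‖ ^ 2} ≤
      (1 + 40 / ε) ^ Fintype.card ι * Real.exp (-(m * (ε ^ 2 / (25200 * L)))) := by
  have hm' : (0 : ℝ) < m := by exact_mod_cast hm
  obtain ⟨N, hN1, hN2, hN3⟩ := exists_finset_net (F := EuclideanSpace ℝ ι) (R := 1) (η := ε / 20)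
    (by positivity) zero_le_one {x | ‖x‖ = 1} (fun x hx => le_of_eq hx)
  have hsub : {ω | ¬ ∀ v : EuclideanSpace ℝ ι, (∑ i, w (b i ω) * ⟪b i ω, v⟫ ^ 2) / m ≤
      q₁ * ‖v‖ ^ 2 + q₂ * ⟪a, v⟫ ^ 2 + 2 * ε * ‖v‖ ^ 2} ⊆ ⋃ v ∈ N,
      {ω | m * ((q₁ * ‖v‖ ^ 2 + q₂ * ⟪a, v⟫ ^ 2) + ε) ≤ ∑ i, w (b i ω) * ⟪b i ω, v⟫ ^ 2} := by
    intro ω hω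
    by_contra hcon
    simp only [Set.mem_iUnion, not_exists] at hcon
    refine hω fun v => ?_
    have e : ∀ v : EuclideanSpace ℝ ι, (∑ i, w (b i ω) * ⟪b i ω, v⟫ ^ 2) / m =
        ∑ i, w (b i ω) / m * ⟪b i ω, v⟫ ^ 2 := fun v => by
      rw [Finset.sum_div]
      exact Finset.sum_congr rfl fun i _ => by ring
    rw [e]
    refine sum_mul_inner_sq_le_of_net (fun i => div_nonneg (hw0 _) hm'.le) _ a ha hq₁ hq₂ hq12 hε
      hε1 rfl hN1 hN2 (fun v hv => ?_) v
    rw [← e, div_le_iff₀ hm', mul_comm]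
    exact (not_le.1 (hcon v hv)).le
  refine (measureReal_mono hsub (measure_ne_top _ _)).trans ((measureReal_biUnion_finset_le _ _).trans ?_)
  refine (Finset.sum_le_sum fun v hv => measureReal_weighted_sum_le hb hind hw hw0 hL hwL ha
    (hN1 v hv) hwa (hq v (hN1 v hv)) hε hε1).trans ?_
  rw [Finset.sum_const, nsmul_eq_mul]
  refine mul_le_mul_of_nonneg_right (hN3.trans (le_of_eq ?_)) (Real.exp_pos _).le
  rw [finrank_euclideanSpace]
  congr 1
  field_simp
  norm_num

end Uniform

/-! ### Truncated squares: stability in the vectors and truncation bias. -/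

section Truncation

theorem min_sq_sq (r : ℝ) {R : ℝ} (hR : 0 ≤ R) : min (r ^ 2) (R ^ 2) = min |r| R ^ 2 := by
  rw [← sq_abs r]
  rcases le_total |r| R with h | h
  · rw [min_eq_left h, min_eq_left (pow_le_pow_left₀ (abs_nonneg _) h 2)]
  · rw [min_eq_right h, min_eq_right (pow_le_pow_left₀ hR h 2)]

/-- The truncated square equals min(|r|, R)², which is 2R-Lipschitz in r; the untruncated square is
not Lipschitz, so a net argument needs this version. -/
theorem min_sq_le_add (r r' : ℝ) {R : ℝ} (hR : 0 ≤ R) :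
    min (r ^ 2) (R ^ 2) ≤ min (r' ^ 2) (R ^ 2) + 2 * R * |r - r'| := by
  rw [min_sq_sq r hR, min_sq_sq r' hR]
  have h0 : 0 ≤ min |r| R := le_min (abs_nonneg _) hR
  have h0' : 0 ≤ min |r'| R := le_min (abs_nonneg _) hR
  have h1 : min |r| R ≤ R := min_le_right _ _
  have h1' : min |r'| R ≤ R := min_le_right _ _
  have h2 : min |r| R ≤ min |r'| R + |r - r'| := by
    rw [← min_add_add_right]
    have := abs_sub_abs_le_abs_sub r r'
    exact min_le_min (by linarith) (by linarith [abs_nonneg (r - r')])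
  have h3 := abs_nonneg (r - r')
  rcases le_total (min |r| R) (min |r'| R) with h | h
  · nlinarith [mul_nonneg hR h3]
  · nlinarith [mul_nonneg hR h3]

theorem sq_le_min_add (r : ℝ) {R : ℝ} (hR : 0 < R) :
    r ^ 2 ≤ min (r ^ 2) (R ^ 2) + 1 / R ^ 2 * r ^ 4 := by
  rcases le_total (r ^ 2) (R ^ 2) with h | h
  · rw [min_eq_left h]
    have : 0 ≤ 1 / R ^ 2 * r ^ 4 := by positivity
    linarith
  · have h1 : r ^ 2 ≤ 1 / R ^ 2 * r ^ 4 := by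
      rw [div_mul_eq_mul_div, one_mul, le_div_iff₀ (by positivity)]
      nlinarith [sq_nonneg r]
    have : 0 ≤ min (r ^ 2) (R ^ 2) := by positivity
    linarith

/-- The perturbation term for the bilinear form `∑ j, ⟪b, x j⟫ * ⟪b, y j⟫`. -/
noncomputable def perturbation (η : ℝ) (x y x' y' : Fin 2 → EuclideanSpace ℝ ι)
    (b : EuclideanSpace ℝ ι) : ℝ :=
  ∑ j, (1 / η * (⟪b, x j - x' j⟫ ^ 2 + ⟪b, y j - y' j⟫ ^ 2) +
    η * (⟪b, y j⟫ ^ 2 + ⟪b, x' j⟫ ^ 2))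

/-- Weighted AM-GM turns the change of the bilinear form into squares of linear forms: small
differences are weighted by 1/η and bounded vectors by η, so a bound for the quadratic empirical
form makes the total of order η. -/
theorem two_mul_abs_sub_le_perturbation {η : ℝ} (hη : 0 < η) (x y x' y' : Fin 2 → EuclideanSpace ℝ ι)
    (b : EuclideanSpace ℝ ι) :
    2 * |∑ j, ⟪b, x j⟫ * ⟪b, y j⟫ - ∑ j, ⟪b, x' j⟫ * ⟪b, y' j⟫| ≤ perturbation η x y x' y' b := by
  have h : ∀ s t : ℝ, 2 * |s * t| ≤ 1 / η * s ^ 2 + η * t ^ 2 := fun s t => by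
    have h1 : 0 ≤ (|s| - η * |t|) ^ 2 / η := by positivity
    have e : 1 / η * |s| ^ 2 + η * |t| ^ 2 - 2 * (|s| * |t|) = (|s| - η * |t|) ^ 2 / η := by
      field_simp
      ring
    rw [abs_mul, ← sq_abs s, ← sq_abs t]
    linarith
  rw [← Finset.sum_sub_distrib]
  refine (mul_le_mul_of_nonneg_left (Finset.abs_sum_le_sum_abs _ _) zero_le_two).trans ?_
  rw [Finset.mul_sum, perturbation]
  refine Finset.sum_le_sum fun j _ => ?_
  have e : ⟪b, x j⟫ * ⟪b, y j⟫ - ⟪b, x' j⟫ * ⟪b, y' j⟫ =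
      ⟪b, x j - x' j⟫ * ⟪b, y j⟫ + ⟪b, y j - y' j⟫ * ⟪b, x' j⟫ := by
    simp only [inner_sub_right]; ring
  rw [e]
  have h1 := abs_add_le (⟪b, x j - x' j⟫ * ⟪b, y j⟫) (⟪b, y j - y' j⟫ * ⟪b, x' j⟫)
  have h2 := h ⟪b, x j - x' j⟫ ⟪b, y j⟫
  have h3 := h ⟪b, y j - y' j⟫ ⟪b, x' j⟫
  linarith

theorem min_sq_sum_le_add_perturbation {η R : ℝ} (hη : 0 < η) (hR : 0 ≤ R)
    (x y x' y' : Fin 2 → EuclideanSpace ℝ ι) (b : EuclideanSpace ℝ ι) :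
    min ((∑ j, ⟪b, x j⟫ * ⟪b, y j⟫) ^ 2) (R ^ 2) ≤
      min ((∑ j, ⟪b, x' j⟫ * ⟪b, y' j⟫) ^ 2) (R ^ 2) + R * perturbation η x y x' y' b := by
  have h1 := min_sq_le_add (∑ j, ⟪b, x j⟫ * ⟪b, y j⟫) (∑ j, ⟪b, x' j⟫ * ⟪b, y' j⟫) hR
  have h2 := mul_le_mul_of_nonneg_left (two_mul_abs_sub_le_perturbation hη x y x' y' b) hR
  linarith

theorem sum_perturbation_terms_le {η : ℝ} (hη : 0 < η) {x y x' y' : Fin 2 → EuclideanSpace ℝ ι}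
    (hy : ∀ j, ‖y j‖ ≤ 4) (hx' : ∀ j, ‖x' j‖ ≤ 4) (hxx : ∀ j, ‖x j - x' j‖ ≤ η)
    (hyy : ∀ j, ‖y j - y' j‖ ≤ η) :
    ∑ j, (1 / η * (‖x j - x' j‖ ^ 2 + ‖y j - y' j‖ ^ 2) + η * (‖y j‖ ^ 2 + ‖x' j‖ ^ 2)) ≤
      68 * η := by
  have h : ∀ j, 1 / η * (‖x j - x' j‖ ^ 2 + ‖y j - y' j‖ ^ 2) + η * (‖y j‖ ^ 2 + ‖x' j‖ ^ 2) ≤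
      34 * η := fun j => by
    have h1 := pow_le_pow_left₀ (norm_nonneg _) (hxx j) 2
    have h2 := pow_le_pow_left₀ (norm_nonneg _) (hyy j) 2
    have h3 := pow_le_pow_left₀ (norm_nonneg _) (hy j) 2
    have h4 := pow_le_pow_left₀ (norm_nonneg _) (hx' j) 2
    have h5 : 1 / η * (‖x j - x' j‖ ^ 2 + ‖y j - y' j‖ ^ 2) ≤ 1 / η * (2 * η ^ 2) :=
      mul_le_mul_of_nonneg_left (by linarith) (by positivity)
    have h6 : 1 / η * (2 * η ^ 2) = 2 * η := by field_simp
    have h7 : η * (‖y j‖ ^ 2 + ‖x' j‖ ^ 2) ≤ η * 32 :=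
      mul_le_mul_of_nonneg_left (by linarith) hη.le
    linarith
  rw [Fin.sum_univ_two]
  linarith [h 0, h 1]

theorem sum_perturbation_le {m : ℕ} {β : Fin m → EuclideanSpace ℝ ι}
    (hβ : ∀ v, (∑ i, ⟪β i, v⟫ ^ 2) / m ≤ ‖v‖ ^ 2) {η : ℝ} (hη : 0 < η)
    {x y x' y' : Fin 2 → EuclideanSpace ℝ ι}
    (hy : ∀ j, ‖y j‖ ≤ 4) (hx' : ∀ j, ‖x' j‖ ≤ 4) (hxx : ∀ j, ‖x j - x' j‖ ≤ η)
    (hyy : ∀ j, ‖y j - y' j‖ ≤ η) :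
    (∑ i, perturbation η x y x' y' (β i)) / m ≤ 68 * η := by
  refine le_trans ?_ (sum_perturbation_terms_le hη hy hx' hxx hyy)
  simp only [perturbation]
  rw [Finset.sum_comm, Finset.sum_div]
  refine Finset.sum_le_sum fun j _ => ?_
  rw [Finset.sum_add_distrib, ← Finset.mul_sum, ← Finset.mul_sum, Finset.sum_add_distrib,
    Finset.sum_add_distrib, add_div, mul_div_assoc, mul_div_assoc, add_div, add_div]
  have := hβ (x j - x' j)
  have := hβ (y j - y' j)
  have := hβ (y j)
  have := hβ (x' j)
  gcongr

theorem integrable_perturbation (η : ℝ) (x y x' y' : Fin 2 → EuclideanSpace ℝ ι) :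
    Integrable (perturbation η x y x' y') (halfGaussian ι) :=
  integrable_finsetSum _ fun _ _ =>
    (((integrable_inner_sq _).add (integrable_inner_sq _)).const_mul _).add
      (((integrable_inner_sq _).add (integrable_inner_sq _)).const_mul _)

theorem integral_perturbation_le {η : ℝ} (hη : 0 < η)
    {x y x' y' : Fin 2 → EuclideanSpace ℝ ι}
    (hy : ∀ j, ‖y j‖ ≤ 4) (hx' : ∀ j, ‖x' j‖ ≤ 4) (hxx : ∀ j, ‖x j - x' j‖ ≤ η)
    (hyy : ∀ j, ‖y j - y' j‖ ≤ η) :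
    ∫ b, perturbation η x y x' y' b ∂(halfGaussian ι) ≤ 68 * η := by
  have hi := fun v : EuclideanSpace ℝ ι => integrable_inner_sq v
  refine le_trans ?_ (sum_perturbation_terms_le hη hy hx' hxx hyy)
  simp only [perturbation]
  rw [integral_finsetSum]
  swap
  · exact fun j _ => (((hi _).add (hi _)).const_mul _).add (((hi _).add (hi _)).const_mul _)
  refine Finset.sum_le_sum fun j _ => ?_
  rw [integral_add]
  rotate_left
  · exact ((hi _).add (hi _)).const_mul _
  · exact ((hi _).add (hi _)).const_mul _
  rw [integral_const_mul, integral_const_mul, integral_add (hi _) (hi _),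
    integral_add (hi _) (hi _)]
  simp only [integral_inner_sq]
  have : 0 < 1 / η := by positivity
  gcongr <;> nlinarith [sq_nonneg ‖x j - x' j‖, sq_nonneg ‖y j - y' j‖, sq_nonneg ‖x' j‖,
    sq_nonneg ‖y j‖]

theorem integrable_min_sq_sum (R : ℝ) (x y : Fin 2 → EuclideanSpace ℝ ι) :
    Integrable (fun b => min ((∑ j, ⟪b, x j⟫ * ⟪b, y j⟫) ^ 2) (R ^ 2)) (halfGaussian ι) := by
  refine (integrable_sq_sum_inner_mul x y).mono' (by fun_prop) (ae_of_all _ fun b => ?_)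
  rw [Real.norm_of_nonneg (by positivity)]
  exact min_le_left _ _

theorem integral_sq_sum_le_min_add {R : ℝ} (hR : 0 < R) {x y : Fin 2 → EuclideanSpace ℝ ι}
    (hx : ∀ j, ‖x j‖ ≤ 4) (hy : ∀ j, ‖y j‖ ≤ 4) :
    ∫ b, (∑ j, ⟪b, x j⟫ * ⟪b, y j⟫) ^ 2 ∂(halfGaussian ι) ≤
      ∫ b, min ((∑ j, ⟪b, x j⟫ * ⟪b, y j⟫) ^ 2) (R ^ 2) ∂(halfGaussian ι) +
        1 / R ^ 2 * 160000000 := by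
  have h := integral_mono (integrable_sq_sum_inner_mul x y)
    ((integrable_min_sq_sum R x y).add ((integrable_pow_four_sum_inner_mul x y).const_mul
      (1 / R ^ 2))) (fun b => sq_le_min_add _ hR)
  rw [integral_add' (integrable_min_sq_sum R x y) ((integrable_pow_four_sum_inner_mul x y).const_mul
      (1 / R ^ 2)), integral_const_mul] at h
  refine h.trans (add_le_add_right (mul_le_mul_of_nonneg_left
    (integral_pow_four_sum_inner_mul_le hx hy) (by positivity)) _)

end Truncation

/-! ### Uniform lower bound for the quartic form. -/

section Uniform

variable {Ω : Type*} [MeasurableSpace Ω] {P : Measure Ω} [IsProbabilityMeasure P] {m : ℕ}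
  {b : Fin m → Ω → EuclideanSpace ℝ ι}

theorem measureReal_sum_min_sq_le (hb : ∀ i, HasLaw (b i) (halfGaussian ι) P)
    (hind : iIndepFun b P) {R ε : ℝ} (hR : 0 < R) (hε : 0 < ε)
    (x y : Fin 2 → EuclideanSpace ℝ ι) :
    P.real {ω | ∑ i, min ((∑ j, ⟪b i ω, x j⟫ * ⟪b i ω, y j⟫) ^ 2) (R ^ 2) ≤
      m * (∫ β, min ((∑ j, ⟪β, x j⟫ * ⟪β, y j⟫) ^ 2) (R ^ 2) ∂(halfGaussian ι) - ε)} ≤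
      Real.exp (-(m * (ε ^ 2 / (4 * R ^ 4)))) := by
  have hle : ∀ β : EuclideanSpace ℝ ι,
      min ((∑ j, ⟪β, x j⟫ * ⟪β, y j⟫) ^ 2) (R ^ 2) ^ 2 ≤ R ^ 4 := fun β => by
    calc _ ≤ (R ^ 2) ^ 2 := pow_le_pow_left₀ (by positivity) (min_le_right _ _) 2
      _ = R ^ 4 := by ring
  have hi : Integrable (fun β => min ((∑ j, ⟪β, x j⟫ * ⟪β, y j⟫) ^ 2) (R ^ 2) ^ 2)
      (halfGaussian ι) := by
    refine (integrable_const (R ^ 4)).mono' (by fun_prop) (ae_of_all _ fun β => ?_)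
    rw [Real.norm_of_nonneg (by positivity)]
    exact hle β
  have hK := integral_mono hi (integrable_const (R ^ 4)) hle
  rw [integral_const, probReal_univ, one_smul] at hK
  refine (measureReal_sum_comp_le_le hb hind
    (X := fun β => min ((∑ j, ⟪β, x j⟫ * ⟪β, y j⟫) ^ 2) (R ^ 2)) (by fun_prop)
    (fun β => by positivity) (s := ε / (2 * R ^ 4)) (ε := ε) (by positivity) hi hK).trans
    (le_of_eq ?_)
  congr 3
  field_simp
  ring

/-- A uniform lower bound for the quartic empirical form, on the event where the quadratic
empirical form is bounded. -/
theorem measureReal_not_quartic_le (hm : 0 < m) (hb : ∀ i, HasLaw (b i) (halfGaussian ι) P)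
    (hind : iIndepFun b P) :
    P.real {ω | (∀ v, (∑ i, ⟪b i ω, v⟫ ^ 2) / m ≤ ‖v‖ ^ 2) ∧
      ¬ ∀ x y : Fin 2 → EuclideanSpace ℝ ι, (∀ j, ‖x j‖ ≤ 4) → (∀ j, ‖y j‖ ≤ 4) →
        (∑ j, ∑ k, (⟪x j, y j⟫ * ⟪x k, y k⟫ + ⟪x j, x k⟫ * ⟪y j, y k⟫ +
          ⟪x j, y k⟫ * ⟪y j, x k⟫)) / 4 - 1 / 10000 ≤
          (∑ i, (∑ j, ⟪b i ω, x j⟫ * ⟪b i ω, y j⟫) ^ 2) / m} ≤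
      (1 + 8 * 10 ^ 14) ^ (4 * Fintype.card ι) *
        Real.exp (-(m * ((1 / 20000) ^ 2 / (4 * (10 ^ 7) ^ 4)))) := by
  have hm' : (0 : ℝ) < m := by exact_mod_cast hm
  -- The error 1/10000 is split into 1/20000 for the deviation on the net, twice 68Rη for moving to
  -- the net (in the sample and in the mean) and 160000000/R² for the truncation bias. These η and R
  -- make the last two kinds of error small enough.
  obtain ⟨η, hηdef⟩ : ∃ η : ℝ, η = 1 / 10 ^ 14 := ⟨_, rfl⟩
  obtain ⟨R, hRdef⟩ : ∃ R : ℝ, R = 10 ^ 7 := ⟨_, rfl⟩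
  have hη : 0 < η := by rw [hηdef]; positivity
  have hR : 0 < R := by rw [hRdef]; positivity
  obtain ⟨N, hN1, hN2, hN3⟩ := exists_finset_net
    (F := (Fin 2 → EuclideanSpace ℝ ι) × (Fin 2 → EuclideanSpace ℝ ι)) (R := 4) hη (by norm_num)
    {p | (∀ j, ‖p.1 j‖ ≤ 4) ∧ ∀ j, ‖p.2 j‖ ≤ 4} (fun p hp => norm_prod_le_iff.2
      ⟨(pi_norm_le_iff_of_nonneg (by norm_num)).2 hp.1,
        (pi_norm_le_iff_of_nonneg (by norm_num)).2 hp.2⟩)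
  have hsub : {ω | (∀ v, (∑ i, ⟪b i ω, v⟫ ^ 2) / m ≤ ‖v‖ ^ 2) ∧
      ¬ ∀ x y : Fin 2 → EuclideanSpace ℝ ι, (∀ j, ‖x j‖ ≤ 4) → (∀ j, ‖y j‖ ≤ 4) →
        (∑ j, ∑ k, (⟪x j, y j⟫ * ⟪x k, y k⟫ + ⟪x j, x k⟫ * ⟪y j, y k⟫ +
          ⟪x j, y k⟫ * ⟪y j, x k⟫)) / 4 - 1 / 10000 ≤
          (∑ i, (∑ j, ⟪b i ω, x j⟫ * ⟪b i ω, y j⟫) ^ 2) / m} ⊆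
      ⋃ p ∈ N, {ω | ∑ i, min ((∑ j, ⟪b i ω, p.1 j⟫ * ⟪b i ω, p.2 j⟫) ^ 2) (R ^ 2) ≤
        m * (∫ β, min ((∑ j, ⟪β, p.1 j⟫ * ⟪β, p.2 j⟫) ^ 2) (R ^ 2) ∂(halfGaussian ι) -
          1 / 20000)} := by
    rintro ω ⟨hω, hω'⟩
    by_contra hcon
    simp only [Set.mem_iUnion, not_exists] at hcon
    refine hω' fun x y hx hy => ?_
    obtain ⟨⟨x', y'⟩, hpN, hp⟩ := hN2 (x, y) ⟨hx, hy⟩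
    obtain ⟨hx', hy'⟩ := hN1 _ hpN
    rw [Prod.mk_sub_mk, norm_prod_le_iff] at hp
    have hxx := (pi_norm_le_iff_of_nonneg hη.le).1 hp.1
    have hyy := (pi_norm_le_iff_of_nonneg hη.le).1 hp.2
    simp only [Pi.sub_apply] at hxx hyy hx' hy'
    have h1 := hcon _ hpN
    rw [Set.mem_ofPred_eq, not_le] at h1
    simp only at h1
    rw [mul_comm, ← lt_div_iff₀ hm'] at h1
    have h2 : (∑ i, min ((∑ j, ⟪b i ω, x' j⟫ * ⟪b i ω, y' j⟫) ^ 2) (R ^ 2)) / m ≤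
        (∑ i, (∑ j, ⟪b i ω, x j⟫ * ⟪b i ω, y j⟫) ^ 2) / m + R * (68 * η) := by
      have h3 := sum_perturbation_le hω hη hy' hx (fun j => by rw [norm_sub_rev]; exact hxx j)
        (fun j => by rw [norm_sub_rev]; exact hyy j)
      refine le_trans ?_ (add_le_add_right (mul_le_mul_of_nonneg_left h3 hR.le) _)
      rw [mul_div_assoc', ← add_div, Finset.mul_sum, ← Finset.sum_add_distrib]
      gcongr with i
      refine (min_sq_sum_le_add_perturbation hη hR.le x' y' x y (b i ω)).trans ?_
      gcongr
      exact min_le_left _ _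
    have h4 : ∫ β, min ((∑ j, ⟪β, x j⟫ * ⟪β, y j⟫) ^ 2) (R ^ 2) ∂(halfGaussian ι) ≤
        ∫ β, min ((∑ j, ⟪β, x' j⟫ * ⟪β, y' j⟫) ^ 2) (R ^ 2) ∂(halfGaussian ι) + R * (68 * η) := by
      have h5 := integral_perturbation_le hη hy hx' hxx hyy
      refine le_trans ?_ (add_le_add_right (mul_le_mul_of_nonneg_left h5 hR.le) _)
      rw [← integral_const_mul, ← integral_add (integrable_min_sq_sum R x' y')
        ((integrable_perturbation η x y x' y').const_mul R)]
      exact integral_mono (integrable_min_sq_sum R x y) ((integrable_min_sq_sum R x' y').add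
        ((integrable_perturbation η x y x' y').const_mul R))
        fun β => min_sq_sum_le_add_perturbation hη hR.le x y x' y' β
    have h6 := integral_sq_sum_le_min_add hR hx hy
    rw [integral_sq_sum_inner_mul] at h6
    have h7 : R * (68 * η) = 68 / 10 ^ 7 := by rw [hRdef, hηdef]; norm_num
    have h8 : 1 / R ^ 2 * 160000000 = 16 / 10 ^ 7 := by rw [hRdef]; norm_num
    rw [h7] at h2 h4
    rw [h8] at h6
    linarith
  refine (measureReal_mono hsub (measure_ne_top _ _)).trans
    ((measureReal_biUnion_finset_le _ _).trans ?_)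
  refine (Finset.sum_le_sum fun p _ =>
    measureReal_sum_min_sq_le hb hind hR (by norm_num) p.1 p.2).trans ?_
  rw [Finset.sum_const, nsmul_eq_mul, hRdef]
  refine mul_le_mul_of_nonneg_right (hN3.trans (le_of_eq ?_)) (Real.exp_pos _).le
  have hf : Module.finrank ℝ ((Fin 2 → EuclideanSpace ℝ ι) × (Fin 2 → EuclideanSpace ℝ ι)) =
      4 * Fintype.card ι := by
    rw [Module.finrank_prod, Module.finrank_pi_fintype]
    simp
    ring
  rw [hf, hηdef]
  norm_num

end Uniform

/-! ### Realification of the complex Gaussian sample. -/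

section Sample

variable {Ω : Type*} [MeasurableSpace Ω] {P : Measure Ω} [IsProbabilityMeasure P] {m n : ℕ}

theorem hasLaw_toLp_halfGaussian {X : ι → Ω → ℝ}
    (hX : ∀ j, HasLaw (X j) (gaussianReal 0 (1 / 2)) P) (h : iIndepFun X P) :
    HasLaw (fun ω => WithLp.toLp 2 fun j => X j ω) (halfGaussian ι) P :=
  HasLaw.comp (Y := WithLp.toLp 2) ⟨by fun_prop, rfl⟩ (h.hasLaw_pi hX)

/-- Currying carries the product law of all entries to the product over rows of the row laws, which
is independence of the rows. -/
theorem iIndepFun_toLp {κ : Type*} [Fintype κ] {X : κ × ι → Ω → ℝ} {μ : Measure ℝ}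
    [IsProbabilityMeasure μ]
    (hX : ∀ p, HasLaw (X p) μ P) (h : iIndepFun X P) :
    iIndepFun (fun i ω => (WithLp.toLp 2 fun j => X (i, j) ω : EuclideanSpace ℝ ι)) P := by
  have hrow : ∀ i, HasLaw (fun ω j => X (i, j) ω) (Measure.pi fun _ : ι => μ) P := fun i =>
    (h.precomp (g := fun j => (i, j)) (Prod.mk_right_injective i)).hasLaw_pi fun j => hX (i, j)
  have hcurry : HasLaw (MeasurableEquiv.curry κ ι ℝ)
      (Measure.pi fun _ : κ => Measure.pi fun _ : ι => μ) (Measure.pi fun _ : κ × ι => μ) := by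
    have h := Measure.infinitePi_map_curry (ι := κ) (κ := ι) (X := ℝ) fun _ _ => μ
    simp only [Measure.infinitePi_eq_pi] at h
    exact ⟨(MeasurableEquiv.measurable _).aemeasurable, h⟩
  have hind : iIndepFun (fun i ω j => X (i, j) ω) P :=
    (iIndepFun_iff_hasLaw_pi_pi hrow).2 (hcurry.comp (h.hasLaw_pi hX))
  exact hind.comp (fun _ => WithLp.toLp 2) fun _ => by fun_prop

/-- The coordinates of a realified complex Gaussian sample. -/
theorem IsComplexGaussianSample.realify_hasLaw {a : Fin m → Ω → Fin n → ℂ}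
    (ha : IsComplexGaussianSample a P) (p : Fin m × (Fin n ⊕ Fin n)) :
    HasLaw (fun ω => realify (a p.1 ω) p.2) (gaussianReal 0 (1 / 2)) P := by
  obtain ⟨i, j | j⟩ := p
  · simpa [realify] using ha.re_law i j
  -- Conjugation flips the sign of the imaginary part; the centred law is symmetric.
  · have h := gaussianReal_neg (ha.im_law i j)
    rw [neg_zero] at h
    exact h

theorem IsComplexGaussianSample.realify_iIndepFun {a : Fin m → Ω → Fin n → ℂ}
    (ha : IsComplexGaussianSample a P) :
    iIndepFun (fun (p : Fin m × (Fin n ⊕ Fin n)) ω => realify (a p.1 ω) p.2) P := by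
  have h := ha.indep.comp (fun p x => Sum.elim (fun _ => x) (fun _ => -x) p.2) (fun p => by
    obtain ⟨i, j | j⟩ := p
    · exact measurable_id
    · exact measurable_neg)
  convert h using 1
  ext p ω
  obtain ⟨i, j | j⟩ := p <;> simp [realify]

theorem IsComplexGaussianSample.hasLaw_halfGaussian {a : Fin m → Ω → Fin n → ℂ}
    (ha : IsComplexGaussianSample a P) (i : Fin m) :
    HasLaw (fun ω => WithLp.toLp 2 (realify (a i ω))) (halfGaussian (Fin n ⊕ Fin n)) P :=
  hasLaw_toLp_halfGaussian (fun j => ha.realify_hasLaw (i, j))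
    (ha.realify_iIndepFun.precomp (g := fun j => (i, j)) (Prod.mk_right_injective i))

theorem IsComplexGaussianSample.iIndepFun_toLp_realify {a : Fin m → Ω → Fin n → ℂ}
    (ha : IsComplexGaussianSample a P) :
    iIndepFun (fun i ω => (WithLp.toLp 2 (realify (a i ω)) :
      EuclideanSpace ℝ (Fin n ⊕ Fin n))) P :=
  iIndepFun_toLp ha.realify_hasLaw ha.realify_iIndepFun

end Sample

/-! ### Assembling the event that the sample is regular. -/

section RegularSample

variable {Ω : Type*} [MeasurableSpace Ω] {P : Measure Ω} [IsProbabilityMeasure P] {m : ℕ}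
  {b : Fin m → Ω → EuclideanSpace ℝ ι}

/-- Markov's inequality for exp(3/4 ⟪x, a⟫²), whose mean is 2. -/
theorem measureReal_lt_inner_sq_le {X : Ω → EuclideanSpace ℝ ι}
    (hX : HasLaw X (halfGaussian ι) P) {a : EuclideanSpace ℝ ι} (ha : ‖a‖ = 1) (L : ℝ) :
    P.real {ω | L < ⟪X ω, a⟫ ^ 2} ≤ 2 * Real.exp (-(3 / 4 * L)) := by
  have h1 : P.real {ω | L < ⟪X ω, a⟫ ^ 2} = (halfGaussian ι).real {x | L < ⟪x, a⟫ ^ 2} :=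
    hX.measureReal_eq (p := fun x => L < ⟪x, a⟫ ^ 2)
      (measurableSet_lt measurable_const (by fun_prop))
  have h2 := mul_meas_ge_le_integral_of_nonneg (μ := halfGaussian ι)
    (ae_of_all _ fun x => (Real.exp_pos (3 / 4 * ⟪x, a⟫ ^ 2)).le) (integrable_exp_sq_inner ha)
    (Real.exp (3 / 4 * L))
  rw [integral_exp_sq_inner ha] at h2
  have h3 : (halfGaussian ι).real {x | L < ⟪x, a⟫ ^ 2} ≤
      (halfGaussian ι).real {x | Real.exp (3 / 4 * L) ≤ Real.exp (3 / 4 * ⟪x, a⟫ ^ 2)} := by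
    refine measureReal_mono (fun x hx => Real.exp_le_exp.2 ?_) (measure_ne_top _ _)
    have : L < ⟪x, a⟫ ^ 2 := hx
    linarith
  rw [h1, Real.exp_neg, ← div_eq_mul_inv, le_div_iff₀ (Real.exp_pos _), mul_comm]
  exact (mul_le_mul_of_nonneg_left h3 (Real.exp_pos _).le).trans h2

theorem measureReal_exists_lt_inner_sq_le (hb : ∀ i, HasLaw (b i) (halfGaussian ι) P)
    {κ : Type*} [Fintype κ] {f : κ → EuclideanSpace ℝ ι} (hf : ∀ k, ‖f k‖ = 1) (L : ℝ) :
    P.real {ω | ∃ i k, L < ⟪b i ω, f k⟫ ^ 2} ≤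
      m * Fintype.card κ * (2 * Real.exp (-(3 / 4 * L))) := by
  have e : {ω | ∃ i k, L < ⟪b i ω, f k⟫ ^ 2} =
      ⋃ p : Fin m × κ, {ω | L < ⟪b p.1 ω, f p.2⟫ ^ 2} := by
    ext ω; simp
  rw [e]
  refine (measureReal_iUnion_fintype_le _).trans ((Finset.sum_le_sum fun p _ =>
    measureReal_lt_inner_sq_le (hb p.1) (hf p.2) L).trans (le_of_eq ?_))
  simp

theorem integral_min_sq_mul_le (a v : EuclideanSpace ℝ ι) (ha : ‖a‖ = 1) (L : ℝ) (hL : 0 ≤ L) :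
    ∫ x, min (⟪x, a⟫ ^ 2) L * ⟪x, v⟫ ^ 2 ∂(halfGaussian ι) ≤
      1 / 4 * ‖v‖ ^ 2 + 1 / 2 * ⟪a, v⟫ ^ 2 := by
  have hle : ∀ x : EuclideanSpace ℝ ι,
      min (⟪x, a⟫ ^ 2) L * ⟪x, v⟫ ^ 2 ≤ ⟪x, a⟫ ^ 2 * ⟪x, v⟫ ^ 2 := fun x =>
    mul_le_mul_of_nonneg_right (min_le_left _ _) (sq_nonneg _)
  have hi := integrable_inner_sq_mul_inner_sq a v
  refine (integral_mono (hi.mono' (by fun_prop) (ae_of_all _ fun x => ?_)) hi hle).trans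
    (le_of_eq ?_)
  · rw [Real.norm_of_nonneg (by positivity)]
    exact hle x
  · rw [integral_inner_sq_mul_inner_sq, ha]
    ring

theorem min_sq_le_one_add (t L : ℝ) (hL : 0 ≤ L) : min (t ^ 2) L ^ 2 ≤ 1 + t ^ 4 := by
  have := pow_le_pow_left₀ (le_min (sq_nonneg t) hL) (min_le_left (t ^ 2) L) 2
  have e : (t ^ 2) ^ 2 = t ^ 4 := by ring
  linarith

theorem norm_pow_four_le (x : EuclideanSpace ℝ ι) :
    ‖x‖ ^ 4 ≤ Fintype.card ι * ∑ j, x j ^ 4 := by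
  have h := sq_sum_le_card_mul_sum_sq (s := Finset.univ) (f := fun j => x j ^ 2)
  rw [← EuclideanSpace.real_norm_sq_eq] at h
  simpa [← pow_mul] using h

/-- Cauchy-Schwarz reduces ‖β i‖⁴ to fourth powers of coordinates. Their means are 3/4, so the
threshold m in the hypothesis leaves a slack of 1/4 per sample. -/
theorem sum_norm_pow_four_div_le (hm : 0 < m) {β : Fin m → EuclideanSpace ℝ ι} {L : ℝ}
    (hL : ∀ i j, β i j ^ 2 ≤ L)
    (h : ∀ j, ∑ i, min (β i j ^ 2) L * β i j ^ 2 ≤ m) :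
    (∑ i, ‖β i‖ ^ 4) / m ≤ (Fintype.card ι : ℝ) ^ 2 := by
  have hm' : (0 : ℝ) < m := by exact_mod_cast hm
  rw [div_le_iff₀ hm']
  calc ∑ i, ‖β i‖ ^ 4 ≤ ∑ i, Fintype.card ι * ∑ j, β i j ^ 4 :=
        Finset.sum_le_sum fun i _ => norm_pow_four_le _
    _ = Fintype.card ι * ∑ j, ∑ i, β i j ^ 4 := by rw [← Finset.mul_sum, Finset.sum_comm]
    _ ≤ Fintype.card ι * ∑ _j : ι, (m : ℝ) := by
        gcongr with j
        refine le_trans (Finset.sum_le_sum fun i _ => ?_) (h j)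
        rw [min_eq_left (hL i j)]
        exact le_of_eq (by ring)
    _ = (Fintype.card ι : ℝ) ^ 2 * m := by simp; ring

theorem weighted_sum_le_of_forall {e : Fin 2 → EuclideanSpace ℝ ι}
    {β : Fin m → EuclideanSpace ℝ ι} {L : ℝ} (hL : ∀ i k, ⟪β i, e k⟫ ^ 2 ≤ L)
    (h : ∀ k v, (∑ i, min (⟪β i, e k⟫ ^ 2) L * ⟪β i, v⟫ ^ 2) / m ≤
      1 / 4 * ‖v‖ ^ 2 + 1 / 2 * ⟪e k, v⟫ ^ 2 + 2 * (1 / 20000) * ‖v‖ ^ 2)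
    (v : EuclideanSpace ℝ ι) :
    (∑ i, (∑ k, ⟪β i, e k⟫ ^ 2) * ⟪β i, v⟫ ^ 2) / m ≤
      (2 * ‖v‖ ^ 2 + 2 * ∑ k, ⟪v, e k⟫ ^ 2) / 4 + 2 * (1 / 10000) * ‖v‖ ^ 2 := by
  have e1 : (∑ i, (∑ k, ⟪β i, e k⟫ ^ 2) * ⟪β i, v⟫ ^ 2) / m =
      ∑ k, (∑ i, min (⟪β i, e k⟫ ^ 2) L * ⟪β i, v⟫ ^ 2) / m := by
    rw [← Finset.sum_div, Finset.sum_comm]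
    congr 1
    refine Finset.sum_congr rfl fun i _ => ?_
    rw [Finset.sum_mul]
    exact Finset.sum_congr rfl fun k _ => by rw [min_eq_left (hL i k)]
  rw [e1, Fin.sum_univ_two, Fin.sum_univ_two, real_inner_comm, real_inner_comm (e 1) v]
  linarith [h 0 v, h 1 v]

/-- A Gaussian sample is regular with high probability. -/
theorem measureReal_not_isRegularSample_le (hm : 0 < m)
    (hb : ∀ i, HasLaw (b i) (halfGaussian ι) P) (hind : iIndepFun b P)
    {e : Fin 2 → EuclideanSpace ℝ ι} (he : ∀ k, ‖e k‖ = 1) {L : ℝ} (hL : 1 ≤ L) :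
    P.real {ω | ¬ IsRegularSample (fun i => b i ω) e (1 / 10000)} ≤
      m * (2 + Fintype.card ι) * (2 * Real.exp (-(3 / 4 * L))) +
        5 * ((1 + 8 * 10 ^ 14) ^ 4) ^ Fintype.card ι *
          Real.exp (-(m * ((1 / 20000) ^ 2 / (4 * (10 ^ 7) ^ 4) / L))) := by
  have hL0 : 0 ≤ L := by linarith
  have hm' : (0 : ℝ) < m := by exact_mod_cast hm
  set u : ι → EuclideanSpace ℝ ι := fun j => EuclideanSpace.single j 1 with hu
  have hu1 : ∀ j, ‖u j‖ = 1 := fun j => by simp [hu]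
  have huin : ∀ (x : EuclideanSpace ℝ ι) j, ⟪x, u j⟫ = x j := fun x j => by
    simp [hu, EuclideanSpace.inner_single_right]
  -- The quartic lower bound has both the smallest rate and the largest net. Dividing its rate by L
  -- makes q and A common majorants for all the other events as well.
  set q : ℝ := Real.exp (-(m * ((1 / 20000) ^ 2 / (4 * (10 ^ 7) ^ 4) / L))) with hqdef
  set A : ℝ := (1 + 8 * 10 ^ 14) ^ 4 with hA
  -- Outside `Bmax` no truncation is active in the frame or coordinate directions. `B₁` gives the
  -- quadratic bound on which `B₂` is conditioned, the two `B₃` give the weighted bound and the `B₄`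
  -- the fourth moments.
  set Bmax : Set Ω := {ω | ∃ i, ∃ k : Fin 2 ⊕ ι, L < ⟪b i ω, Sum.elim e u k⟫ ^ 2}
  set B₁ : Set Ω := {ω | ¬ ∀ v : EuclideanSpace ℝ ι,
    (∑ i, (fun _ => (1 : ℝ)) (b i ω) * ⟪b i ω, v⟫ ^ 2) / m ≤
      1 / 2 * ‖v‖ ^ 2 + 0 * ⟪e 0, v⟫ ^ 2 + 2 * (1 / 4) * ‖v‖ ^ 2}
  set B₂ : Set Ω := {ω | (∀ v, (∑ i, ⟪b i ω, v⟫ ^ 2) / m ≤ ‖v‖ ^ 2) ∧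
      ¬ ∀ x y : Fin 2 → EuclideanSpace ℝ ι, (∀ j, ‖x j‖ ≤ 4) → (∀ j, ‖y j‖ ≤ 4) →
        (∑ j, ∑ k, (⟪x j, y j⟫ * ⟪x k, y k⟫ + ⟪x j, x k⟫ * ⟪y j, y k⟫ +
          ⟪x j, y k⟫ * ⟪y j, x k⟫)) / 4 - 1 / 10000 ≤
          (∑ i, (∑ j, ⟪b i ω, x j⟫ * ⟪b i ω, y j⟫) ^ 2) / m}
  set B₃ : Fin 2 → Set Ω := fun k => {ω | ¬ ∀ v : EuclideanSpace ℝ ι,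
    (∑ i, (fun x => min (⟪x, e k⟫ ^ 2) L) (b i ω) * ⟪b i ω, v⟫ ^ 2) / m ≤
      1 / 4 * ‖v‖ ^ 2 + 1 / 2 * ⟪e k, v⟫ ^ 2 + 2 * (1 / 20000) * ‖v‖ ^ 2}
  set B₄ : ι → Set Ω := fun j => {ω | m * (3 / 4 + 1 / 4 : ℝ) ≤
    ∑ i, (fun x => min (⟪x, u j⟫ ^ 2) L) (b i ω) * ⟪b i ω, u j⟫ ^ 2}
  have hexp : ∀ {c : ℝ}, (1 / 20000) ^ 2 / (4 * (10 ^ 7) ^ 4) / L ≤ c →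
      Real.exp (-(m * c)) ≤ q := fun hc =>
    Real.exp_le_exp.2 (neg_le_neg (mul_le_mul_of_nonneg_left hc hm'.le))
  have hq0 : 0 < q := Real.exp_pos _
  have hmax : P.real Bmax ≤ m * (2 + Fintype.card ι) * (2 * Real.exp (-(3 / 4 * L))) := by
    have h := measureReal_exists_lt_inner_sq_le hb (f := Sum.elim e u)
      (by rintro (k | j); exacts [he k, hu1 j]) L
    rw [Fintype.card_sum, Fintype.card_fin, Nat.cast_add, Nat.cast_two] at h
    exact h
  have h₁ : P.real B₁ ≤ A ^ Fintype.card ι * q := by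
    refine (measureReal_not_forall_weighted_le hm hb hind (w := fun _ => 1) measurable_const
      (fun _ => zero_le_one) le_rfl (fun _ => le_rfl) (he 0) (fun x => ?_) (by norm_num) le_rfl
      (by norm_num) (fun v _ => ?_) (by norm_num) (by norm_num)).trans ?_
    · have : 0 ≤ ⟪x, e 0⟫ ^ 4 := by positivity
      linarith
    · simp [integral_inner_sq]
    · refine mul_le_mul (pow_le_pow_left₀ (by norm_num) (by norm_num [hA]) _) (hexp ?_)
        (Real.exp_pos _).le (by positivity)
      rw [div_le_iff₀ (by positivity)]
      norm_num
      linarith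
  have h₂ : P.real B₂ ≤ A ^ Fintype.card ι * q := by
    refine (measureReal_not_quartic_le hm hb hind).trans ?_
    rw [pow_mul]
    exact mul_le_mul_of_nonneg_left (hexp (div_le_self (by positivity) hL)) (by positivity)
  have h₃ : ∀ k, P.real (B₃ k) ≤ A ^ Fintype.card ι * q := fun k => by
    refine (measureReal_not_forall_weighted_le hm hb hind (w := fun x => min (⟪x, e k⟫ ^ 2) L)
      (by fun_prop) (fun _ => le_min (sq_nonneg _) hL0) hL (fun _ => min_le_right _ _) (he k)
      (fun x => min_sq_le_one_add _ _ hL0) (by norm_num) (by norm_num) (by norm_num)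
      (fun v _ => integral_min_sq_mul_le _ _ (he k) _ hL0) (by norm_num) (by norm_num)).trans ?_
    refine mul_le_mul (pow_le_pow_left₀ (by norm_num) (by norm_num [hA]) _) (hexp ?_)
      (Real.exp_pos _).le (by positivity)
    rw [div_div]
    gcongr
    norm_num
  have h₄ : ∀ j, P.real (B₄ j) ≤ q := fun j => by
    refine (measureReal_weighted_sum_le hb hind (w := fun x => min (⟪x, u j⟫ ^ 2) L)
      (by fun_prop) (fun _ => le_min (sq_nonneg _) hL0) hL (fun _ => min_le_right _ _) (hu1 j)
      (hu1 j) (fun x => min_sq_le_one_add _ _ hL0) (q := 3 / 4) (ε := 1 / 4)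
      ((integral_min_sq_mul_le _ _ (hu1 j) _ hL0).trans (le_of_eq ?_)) (by norm_num)
      (by norm_num)).trans (hexp ?_)
    · rw [real_inner_self_eq_norm_sq, hu1]; norm_num
    · rw [div_div]
      gcongr <;> norm_num
  have hsub : {ω | ¬ IsRegularSample (fun i => b i ω) e (1 / 10000)} ⊆
      Bmax ∪ (B₁ ∪ (B₂ ∪ ((⋃ k, B₃ k) ∪ ⋃ j, B₄ j))) := by
    intro ω hω
    by_contra hcon
    simp only [Set.mem_union, not_or, Set.mem_iUnion, not_exists] at hcon
    obtain ⟨c0, c1, c2, c3, c4⟩ := hcon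
    have hmaxL : ∀ i (k : Fin 2 ⊕ ι), ⟪b i ω, Sum.elim e u k⟫ ^ 2 ≤ L := fun i k =>
      not_lt.1 fun h => c0 ⟨i, k, h⟩
    have hquad : ∀ v, (∑ i, ⟪b i ω, v⟫ ^ 2) / m ≤ ‖v‖ ^ 2 := fun v => by
      have := not_not.1 c1 v
      simp only [one_mul] at this
      linarith
    refine hω ⟨weighted_sum_le_of_forall (L := L) (fun i k => hmaxL i (Sum.inl k))
      (fun k => not_not.1 (c3 k)), fun x y hx hy => ?_, ?_⟩
    · by_contra h
      exact c2 ⟨hquad, fun h' => h (h' x y hx hy)⟩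
    · refine sum_norm_pow_four_div_le hm (L := L) (fun i j => ?_) fun j => ?_
      · simpa [huin] using hmaxL i (Sum.inr j)
      · have := c4 j
        simp only [B₄, huin, Set.mem_ofPred_eq, not_le] at this
        linarith
  -- The union over coordinates costs a factor `Fintype.card ι`, which is absorbed into the
  -- exponential net factor; the total is then five equal terms.
  have hcard : (Fintype.card ι : ℝ) ≤ A ^ Fintype.card ι := by
    have h1 : (Fintype.card ι : ℝ) ≤ 2 ^ Fintype.card ι := by
      exact_mod_cast Nat.lt_two_pow_self.le
    exact h1.trans (pow_le_pow_left₀ (by norm_num) (by norm_num [hA]) _)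
  have hU₃ : P.real (⋃ k, B₃ k) ≤ 2 * (A ^ Fintype.card ι * q) := by
    refine (measureReal_iUnion_fintype_le _).trans ?_
    rw [Fin.sum_univ_two]
    linarith [h₃ 0, h₃ 1]
  have hU₄ : P.real (⋃ j, B₄ j) ≤ A ^ Fintype.card ι * q := by
    refine (measureReal_iUnion_fintype_le _).trans ((Finset.sum_le_sum fun j _ => h₄ j).trans ?_)
    rw [Finset.sum_const, nsmul_eq_mul, Finset.card_univ]
    exact mul_le_mul_of_nonneg_right hcard hq0.le
  refine (measureReal_mono hsub (measure_ne_top _ _)).trans ?_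
  have u1 := measureReal_union_le (μ := P) Bmax (B₁ ∪ (B₂ ∪ ((⋃ k, B₃ k) ∪ ⋃ j, B₄ j)))
  have u2 := measureReal_union_le (μ := P) B₁ (B₂ ∪ ((⋃ k, B₃ k) ∪ ⋃ j, B₄ j))
  have u3 := measureReal_union_le (μ := P) B₂ ((⋃ k, B₃ k) ∪ ⋃ j, B₄ j)
  have u4 := measureReal_union_le (μ := P) (⋃ k, B₃ k) (⋃ j, B₄ j)
  rw [mul_assoc 5]
  generalize A ^ Fintype.card ι * q = T at *
  linarith

end RegularSample

/-! ### Choice of the sample size constant. -/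

section Constants

/-- The failure probability of a regular sample for `m ≥ C n log² n`. -/
theorem exists_sample_size_bound {A κ β : ℝ} (hA : 1 ≤ A) (hκ : 0 < κ) (hβ : 0 < β) :
    ∃ C : ℝ, 0 < C ∧ ∀ n m : ℕ, 2 ≤ n → C * n * Real.log n ^ 2 ≤ m → 2 ≤ m ∧
      m * (2 + (2 * n : ℕ)) * (2 * Real.exp (-(3 / 4 * (8 * Real.log m)))) +
        5 * A ^ (2 * n) * Real.exp (-(m * (κ / (8 * Real.log m)))) ≤
      3 * Real.exp (-β * n) + 7 / (m : ℝ) ^ 2 := by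
  have hl2 : 0 < Real.log 2 := Real.log_pos (by norm_num)
  have hlA : 0 ≤ Real.log A := Real.log_nonneg hA
  -- D is chosen so that m ≥ D n log m beats both A^(2n) and exp(βn); the extra 1 next to β yields a
  -- factor exp(-n) that turns the 5 into a 3.
  obtain ⟨D, hD⟩ : ∃ D : ℝ, D = 1 + 8 * (2 * Real.log A + β + 1) / κ := ⟨_, rfl⟩
  have hD1 : 1 ≤ D := by rw [hD]; linarith [show 0 ≤ 8 * (2 * Real.log A + β + 1) / κ by positivity]
  have hlD : 0 ≤ Real.log (4 * D ^ 2) := Real.log_nonneg (by nlinarith)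
  obtain ⟨K, hK⟩ : ∃ K : ℝ, K = Real.log (4 * D ^ 2) / Real.log 2 + 2 := ⟨_, rfl⟩
  have hK2 : 2 ≤ K := by rw [hK]; linarith [div_nonneg hlD hl2.le]
  -- The first summand ensures m ≥ n, the second gives m ≥ D n log m when m is at most quadratic in
  -- n.
  refine ⟨1 / Real.log 2 ^ 2 + D * K / Real.log 2, by positivity, fun n m hn hmn => ?_⟩
  have hn' : (2 : ℝ) ≤ n := by exact_mod_cast hn
  have hln : Real.log 2 ≤ Real.log n := Real.log_le_log (by norm_num) hn'
  have hln0 : 0 < Real.log n := hl2.trans_le hln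
  have hnm : (n : ℝ) ≤ m := by
    refine le_trans ?_ hmn
    have h1 : 1 / Real.log 2 ^ 2 * n * Real.log 2 ^ 2 = n := by field_simp
    have h2 : Real.log 2 ^ 2 ≤ Real.log n ^ 2 := pow_le_pow_left₀ hl2.le hln 2
    have h3 : 0 ≤ D * K / Real.log 2 := by positivity
    calc (n : ℝ) = 1 / Real.log 2 ^ 2 * n * Real.log 2 ^ 2 := h1.symm
      _ ≤ (1 / Real.log 2 ^ 2 + D * K / Real.log 2) * n * Real.log n ^ 2 := by
        gcongr
        linarith
  have hm2 : (2 : ℝ) ≤ m := hn'.trans hnm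
  have hm0 : (0 : ℝ) < m := by linarith
  have hlm : 0 < Real.log m := Real.log_pos (by linarith)
  have hmain : D * n * Real.log m ≤ m := by
    -- For m above 4D²n² the bound log m ≤ 2√m is enough. Below that, log m is at most a multiple of
    -- log n and the hypothesis on m applies.
    rcases le_or_gt (4 * D ^ 2 * n ^ 2) (m : ℝ) with h | h
    · have h1 : Real.log m ≤ 2 * Real.sqrt m := by
        have h2 := Real.log_le_sub_one_of_pos (Real.sqrt_pos.2 hm0)
        rw [Real.log_sqrt hm0.le] at h2
        linarith
      have h3 : 2 * D * n ≤ Real.sqrt m := by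
        refine Real.le_sqrt_of_sq_le ?_
        linarith [show (2 * D * n) ^ 2 = 4 * D ^ 2 * (n : ℝ) ^ 2 by ring]
      have h4 := Real.mul_self_sqrt hm0.le
      have h5 := Real.sqrt_nonneg (m : ℝ)
      calc D * n * Real.log m ≤ D * n * (2 * Real.sqrt m) := by gcongr
        _ = 2 * D * n * Real.sqrt m := by ring
        _ ≤ Real.sqrt m * Real.sqrt m := by gcongr
        _ = m := h4
    · have h1 : Real.log m ≤ K * Real.log n := by
        have h2 := Real.log_le_log hm0 h.le
        rw [Real.log_mul (by positivity) (by positivity), Real.log_pow] at h2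
        have h3 : Real.log (4 * D ^ 2) ≤ Real.log (4 * D ^ 2) / Real.log 2 * Real.log n := by
          rw [div_mul_eq_mul_div, le_div_iff₀ hl2]
          gcongr
        rw [hK]
        push_cast at h2
        linarith
      calc D * n * Real.log m ≤ D * n * (K * Real.log n) := by gcongr
        _ = D * K / Real.log 2 * n * (Real.log n * Real.log 2) := by field_simp
        _ ≤ (1 / Real.log 2 ^ 2 + D * K / Real.log 2) * n * (Real.log n * Real.log n) := by
          gcongr
          linarith [show 0 ≤ 1 / Real.log 2 ^ 2 by positivity]
        _ ≤ m := by rw [← sq]; exact hmn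
  refine ⟨by exact_mod_cast hm2, ?_⟩
  have hfirst : m * (2 + (2 * n : ℕ)) * (2 * Real.exp (-(3 / 4 * (8 * Real.log m)))) ≤
      7 / (m : ℝ) ^ 2 := by
    -- The truncation level 8 log m makes each tail m⁻⁶, which leaves room for the union over
    -- samples and directions.
    have h1 : Real.exp (-(3 / 4 * (8 * Real.log m))) = 1 / (m : ℝ) ^ 6 := by
      rw [Real.exp_neg, show 3 / 4 * (8 * Real.log m) = (6 : ℕ) * Real.log m by push_cast; ring,
        Real.exp_nat_mul, Real.exp_log hm0, one_div]
    rw [h1]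
    have h2 : (2 + (2 * n : ℕ) : ℝ) ≤ 3 * m := by push_cast; linarith
    calc (m : ℝ) * (2 + (2 * n : ℕ)) * (2 * (1 / (m : ℝ) ^ 6)) ≤
          m * (3 * m) * (2 * (1 / (m : ℝ) ^ 6)) := by gcongr
      _ = 6 / (m : ℝ) ^ 2 / m ^ 2 := by field_simp; norm_num
      _ ≤ 6 / (m : ℝ) ^ 2 := div_le_self (by positivity) (by nlinarith)
      _ ≤ 7 / (m : ℝ) ^ 2 := by gcongr; norm_num
  have hsecond : 5 * A ^ (2 * n) * Real.exp (-(m * (κ / (8 * Real.log m)))) ≤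
      3 * Real.exp (-β * n) := by
    have h1 : A ^ (2 * n) = Real.exp (2 * n * Real.log A) := by
      rw [show (2 * n * Real.log A : ℝ) = (2 * n : ℕ) * Real.log A by push_cast; ring,
        Real.exp_nat_mul, Real.exp_log (by linarith)]
    have h2 : (2 * Real.log A + β + 1) * n ≤ m * (κ / (8 * Real.log m)) := by
      rw [mul_div_assoc', le_div_iff₀ (by positivity)]
      have h3 : 8 * (2 * Real.log A + β + 1) ≤ κ * D := by
        rw [hD, mul_add κ, mul_div_cancel₀ _ hκ.ne']
        linarith
      calc (2 * Real.log A + β + 1) * n * (8 * Real.log m) =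
            8 * (2 * Real.log A + β + 1) * (n * Real.log m) := by ring
        _ ≤ κ * D * (n * Real.log m) := by gcongr
        _ = κ * (D * n * Real.log m) := by ring
        _ ≤ m * κ := by rw [mul_comm (m : ℝ)]; gcongr
    have h4 : (5 : ℝ) ≤ 3 * Real.exp n := by
      have := Real.add_one_le_exp (n : ℝ)
      linarith
    rw [h1]
    calc 5 * Real.exp (2 * n * Real.log A) * Real.exp (-(m * (κ / (8 * Real.log m)))) ≤
          3 * Real.exp n * Real.exp (2 * n * Real.log A) *
            Real.exp (-((2 * Real.log A + β + 1) * n)) := by gcongr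
      _ = 3 * Real.exp (-β * n) := by
          rw [mul_assoc, mul_assoc, ← Real.exp_add, ← Real.exp_add]
          congr 2
          ring
  linarith

end Constants

/-! ### The lifted signal and the run of the algorithm on a regular sample. -/

section Complex

variable {n : ℕ}

/-- The second column of the lift represents multiplication of z by -i, hence it is orthogonal to
the first and has the same norm: the rank-two problem is perfectly conditioned. -/
theorem inner_colVec_liftMatrix (z : EuclideanSpace ℂ (Fin n)) (j k : Fin 2) :
    ⟪colVec (liftMatrix z) j, colVec (liftMatrix z) k⟫ = if j = k then ‖z‖ ^ 2 else 0 := by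
  have h : ‖z‖ ^ 2 = ∑ i, ((z i).re * (z i).re + (z i).im * (z i).im) := by
    rw [EuclideanSpace.norm_sq_eq]
    exact Finset.sum_congr rfl fun i _ => by
      rw [← Complex.normSq_eq_norm_sq, Complex.normSq_apply]
  rw [h, PiLp.inner_apply, Fintype.sum_sum_type, ← Finset.sum_add_distrib]
  fin_cases j <;> fin_cases k
  all_goals simp only [colVec, liftMatrix, RCLike.inner_apply, conj_trivial, Matrix.of_apply,
    Sum.elim_inl, Sum.elim_inr, Fin.zero_eta, Fin.mk_one, Fin.isValue, Matrix.cons_val_zero,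
    Matrix.cons_val_one, if_true, zero_ne_one, one_ne_zero, if_false]
  · exact Finset.sum_congr rfl fun i _ => by ring
  · exact Finset.sum_eq_zero fun i _ => by ring
  · exact Finset.sum_eq_zero fun i _ => by ring
  · exact Finset.sum_congr rfl fun i _ => by ring

/-- The normalized columns of `liftMatrix z`. -/
noncomputable def liftFrame (z : EuclideanSpace ℂ (Fin n)) (j : Fin 2) :
    EuclideanSpace ℝ (Fin n ⊕ Fin n) :=
  ‖z‖⁻¹ • colVec (liftMatrix z) j

theorem orthonormal_liftFrame {z : EuclideanSpace ℂ (Fin n)} (hz : z ≠ 0) :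
    Orthonormal ℝ (liftFrame z) := by
  rw [orthonormal_iff_ite]
  intro j k
  have := (norm_pos_iff.2 hz).ne'
  rw [liftFrame, liftFrame, real_inner_smul_left, real_inner_smul_right, inner_colVec_liftMatrix]
  split_ifs
  · field_simp
  · simp

theorem colVec_liftMatrix {z : EuclideanSpace ℂ (Fin n)} (hz : z ≠ 0) (j : Fin 2) :
    colVec (liftMatrix z) j = ‖z‖ • liftFrame z j := by
  rw [liftFrame, smul_smul, mul_inv_cancel₀ (norm_pos_iff.2 hz).ne', one_smul]

/-- On a regular sample, every run of the algorithm converges linearly. -/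
theorem IsRegularSample.orbitDistSq_isOutput_le {m : ℕ} {z : EuclideanSpace ℂ (Fin n)}
    (hz : z ≠ 0) {a : Fin m → Fin n → ℂ}
    (hb : IsRegularSample (fun i => WithLp.toLp 2 (realify (a i))) (liftFrame z) (1 / 10000))
    {γ : ℝ} (hγ : 0 < γ) (hγ' : γ < 1 / 15876 / (n ^ 4 * ‖z‖ ^ 2)) {k : ℕ}
    {Zhat : Matrix (Fin n ⊕ Fin n) (Fin 2) ℝ}
    (h : IsOutput (fun i => intensity z (a i)) (fun i => realify (a i)) γ k Zhat) :
    orbitDistSq (liftMatrix z) Zhat ≤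
      1 * ‖z‖ ^ 2 * (1 - γ * ‖z‖ ^ 2 / 9 + γ ^ 2 * 42 ^ 2 * n ^ 4 * ‖z‖ ^ 4) ^ k := by
  obtain ⟨U₀, hU₀, rfl⟩ := h
  have hρ : 0 < ‖z‖ := norm_pos_iff.2 hz
  have hy : ∀ i, intensity z (a i) =
      ∑ j, ⟪WithLp.toLp 2 (realify (a i)), colVec (liftMatrix z) j⟫ ^ 2 := fun i => by
    rw [intensity_eq]
    exact Finset.sum_congr rfl fun j _ => by rw [← vecMul_eq_inner]
  have hn : 1 ≤ n := by
    rcases Nat.eq_zero_or_pos n with rfl | hn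
    · exact absurd (Subsingleton.elim z 0) hz
    · exact hn
  have hn1 : (1 : ℝ) ≤ (n : ℝ) ^ 4 := one_le_pow₀ (by exact_mod_cast hn)
  set ρ := ‖z‖ with hρdef
  have hs : γ * (n ^ 4 * ρ ^ 2) < 1 / 15876 := by
    rwa [lt_div_iff₀ (by positivity)] at hγ'
  have hs0 : 0 ≤ γ * ρ ^ 2 := by positivity
  have hs1 : γ * ρ ^ 2 ≤ 1 := by
    have := mul_le_mul_of_nonneg_left hn1 hs0
    linarith
  have hs2 : γ ^ 2 * 42 ^ 2 * (n : ℝ) ^ 4 * ρ ^ 4 ≤ γ * ρ ^ 2 / 9 := by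
    have := mul_le_mul_of_nonneg_left hs.le hs0
    linarith [show γ ^ 2 * 42 ^ 2 * (n : ℝ) ^ 4 * ρ ^ 4 =
      1764 * (γ * ρ ^ 2 * (γ * (n ^ 4 * ρ ^ 2))) by ring]
  have hs3 : 0 ≤ γ ^ 2 * 42 ^ 2 * (n : ℝ) ^ 4 * ρ ^ 4 := by positivity
  -- In real dimension 2n the constant is 108 · 2⁴ = 1728, at most 1764 = 42².
  have hcard : γ ^ 2 * (108 * (Fintype.card (Fin n ⊕ Fin n) : ℝ) ^ 4) * ρ ^ 4 ≤
      γ ^ 2 * 42 ^ 2 * (n : ℝ) ^ 4 * ρ ^ 4 := by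
    rw [Fintype.card_sum, Fintype.card_fin]
    push_cast
    have : 0 ≤ γ ^ 2 * (n : ℝ) ^ 4 * ρ ^ 4 := by positivity
    linarith [show γ ^ 2 * (108 * ((n : ℝ) + n) ^ 4) * ρ ^ 4 =
      1728 * (γ ^ 2 * (n : ℝ) ^ 4 * ρ ^ 4) by ring]
  have hq0 : 0 ≤ 1 - γ * ρ ^ 2 / 9 + γ ^ 2 * 42 ^ 2 * (n : ℝ) ^ 4 * ρ ^ 4 := by linarith
  have hU := hb.orbitDistSq_spectralInit_le (orthonormal_liftFrame hz) hρ (colVec_liftMatrix hz)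
    hy hU₀
  refine (hb.orbitDistSq_iterate_le (orthonormal_liftFrame hz) hρ (colVec_liftMatrix hz) hU hy
    hγ.le (by linarith) hq0 (by linarith) k).trans ?_
  have : 0 ≤ ρ ^ 2 := sq_nonneg ρ
  exact mul_le_mul_of_nonneg_right (by linarith) (pow_nonneg hq0 k)

end Complex

end LowRankRecovery

/-! ### The convergence theorem. -/

theorem mainTheorem5 :
    ∃ c C₀ C₁ : ℝ, 0 < c ∧ 0 < C₀ ∧ 0 < C₁ ∧ c * C₁ ^ 2 ≤ 1 / 9 ∧
      ∀ β : ℝ, 0 < β → ∃ C : ℝ, 0 < C ∧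
        ∀ (n m : ℕ), 2 ≤ n → C * n * Real.log n ^ 2 ≤ m →
        ∀ (z : EuclideanSpace ℂ (Fin n)), z ≠ 0 →
        ∀ (γ : ℝ), 0 < γ → γ < c / (n ^ 4 * ‖z‖ ^ 2) →
        ∀ (Ω : Type*) [MeasurableSpace Ω] (P : Measure Ω) [IsProbabilityMeasure P]
          (a : Fin m → Ω → Fin n → ℂ), LowRankRecovery.IsComplexGaussianSample a P →
          ∃ E : Set Ω, MeasurableSet E ∧
            1 - 3 * Real.exp (-β * n) - 7 / (m : ℝ) ^ 2 ≤ P.real E ∧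
            ∀ ω ∈ E, ∀ (k : ℕ) (Zhat : Matrix (Fin n ⊕ Fin n) (Fin 2) ℝ),
              LowRankRecovery.IsOutput
                  (fun i => LowRankRecovery.intensity z (a i ω))
                  (fun i => LowRankRecovery.realify (a i ω)) γ k Zhat →
                LowRankRecovery.orbitDistSq (LowRankRecovery.liftMatrix z) Zhat ≤
                  C₀ * ‖z‖ ^ 2 *
                    (1 - γ * ‖z‖ ^ 2 / 9 + γ ^ 2 * C₁ ^ 2 * n ^ 4 * ‖z‖ ^ 4) ^ k := by
  -- 15876 = 9 · 42², so c * C₁² is exactly 1/9.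
  refine ⟨1 / 15876, 1, 42, by norm_num, by norm_num, by norm_num, by norm_num, fun β hβ => ?_⟩
  obtain ⟨C, hC, h⟩ := LowRankRecovery.exists_sample_size_bound (A := (1 + 8 * 10 ^ 14) ^ 4)
    (κ := (1 / 20000) ^ 2 / (4 * (10 ^ 7) ^ 4)) (by norm_num) (by norm_num) hβ
  refine ⟨C, hC, fun n m hn hmn z hz γ hγ hγ' Ω _ P _ a ha => ?_⟩
  obtain ⟨hm, hP⟩ := h n m hn hmn
  have hL : 1 ≤ 8 * Real.log m := by
    have h1 := Real.log_le_log (by norm_num) (show (2 : ℝ) ≤ m by exact_mod_cast hm)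
    linarith [Real.log_two_gt_d9]
  have hbad := LowRankRecovery.measureReal_not_isRegularSample_le (by omega)
    ha.hasLaw_halfGaussian ha.iIndepFun_toLp_realify
    (LowRankRecovery.orthonormal_liftFrame hz).1 hL
  rw [Fintype.card_sum, Fintype.card_fin, ← two_mul, ← pow_mul] at hbad
  set B := {ω | ¬ LowRankRecovery.IsRegularSample
    (fun i => WithLp.toLp 2 (LowRankRecovery.realify (a i ω))) (LowRankRecovery.liftFrame z)
    (1 / 10000)}
  -- Measurability of the bad event is never needed: its measurable hull has the same measure, and
  -- the complement of the hull consists of regular samples.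
  refine ⟨(toMeasurable P B)ᶜ, (measurableSet_toMeasurable P B).compl, ?_, fun ω hω k Zhat hk => ?_⟩
  · rw [probReal_compl_eq_one_sub (measurableSet_toMeasurable P B), measureReal_def,
      measure_toMeasurable, ← measureReal_def]
    rw [← pow_mul] at hP
    linarith
  · have hreg : LowRankRecovery.IsRegularSample
        (fun i => WithLp.toLp 2 (LowRankRecovery.realify (a i ω))) (LowRankRecovery.liftFrame z)
        (1 / 10000) := not_not.1 fun h => hω (subset_toMeasurable P B h)
    exact hreg.orbitDistSq_isOutput_le hz hγ hγ' hk
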